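/- Let $(X,d)$ be a separable metric space and let $\mu$ be a doubling Borel measure on $X$: there is $\kappa\ge 1$ with $0<\mu(B(x,2r))\le\kappa\,\mu(B(x,r))<\infty$ for all $x\in X$, $r>0$. For $f:X\to\mathbb R$ put $\operatorname{Lip}[f](x)=\limsup_{r\to0}\sup_{y\in\bar B(x,r)}|f(y)-f(x)|/r$. A measurable set $Y\subset X$ with $\mu(Y)>0$, together with a Lipschitz map $\xi:X\to\mathbb R^n$ ($n\ge 0$), is a chart of dimension $n$ if for every Lipschitz $f:X\to\mathbb R$ there is a unique $Df\in L^\infty(Y;\mathbb R^n)$ with $\operatorname{Lip}[f-Df(x)\cdot\xi](x)=0$ for $\mu$-a.e. $x\in Y$; this differential then exists, as an a.e. unique measurable map $Y\to\mathbb R^n$, for every locally Lipschitz $f$. A measurable differentiable structure is a countable family of charts $(X_m,\xi_m)$ of dimensions $n(m)\le N$, for some $N\in\mathbb N$, with $\mu(X\setminus\bigcup_m X_m)=0$; it is non-degenerate if $n(m)\ge1$ for some $m$. Suppose that $(X,d,\mu)$ supports a non-degenerate measurable differentiable structure, fix such a structure, and let $1<p<\infty$. Let $D_mf$ be the differential of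 $f$ on $X_m$, regarded as a vector in $\mathbb R^N$ (padded by zeros), and $Df=\sum_m\chi_{X_m}D_mf:X\to\mathbb R^N$. Let $\tilde H^{1,p}(X)$ be the space of locally Lipschitz $f\in L^p(X)$ for which this series converges (unconditionally) $\mu$-a.e. (as is automatic when the sets $X_m$ are pairwise disjoint) and $|Df|\in L^p(X)$, with the norm $\|f\|_{1,p}=\|f\|_{L^p}+\||Df|\|_{L^p}$, and let $H^{1,p}(X)$ be its completion. Let $M^{1,p}(X)$ be the space of all $u\in L^p(X)$ for which there are $0\le g\in L^p(X)$ and a $\mu$-null set $E$ with $$|u(x)-u(y)|\le (g(x)+g(y))\,d(x,y)\qquad\text{for all }x,y\in X\setminus E,$$ with the norm $\|u\|_{M^{1,p}}=\|u\|_{L^p}+\inf_g\|g\|_{L^p}$, the infimum being over all such $g$. Then $H^{1,p}(X)$ and $M^{1,p}(X)$ are reflexive Banach spaces. -/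

import Mathlib

open MeasureTheory Filter Topology Set
open scoped ENNReal NNReal

noncomputable section

/-! ### Reflexivity, doubling measures, pointwise Lipschitz constants -/

/-- A real normed space is a reflexive Banach space if it is complete and the canonical map into
its bidual is onto. -/
def IsReflexiveBanach (E : Type*) [NormedAddCommGroup E] [NormedSpace ℝ E] : Prop :=
  CompleteSpace E ∧ Function.Surjective (NormedSpace.inclusionInDoubleDual ℝ E)

/-- Doubling measures: `0 < μ(B(x,2r)) ≤ κ μ(B(x,r)) < ∞` for all `x` and all `r > 0`. -/
def IsDoublingMeasure {X : Type*} [MetricSpace X] [MeasurableSpace X] (μ : Measure X) : Prop :=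
  ∃ κ : ℝ≥0, 1 ≤ κ ∧ ∀ (x : X) (r : ℝ), 0 < r →
    0 < μ (Metric.ball x (2 * r)) ∧
    μ (Metric.ball x (2 * r)) ≤ κ * μ (Metric.ball x r) ∧
    κ * μ (Metric.ball x r) < ∞

/-- The (upper) pointwise Lipschitz constant
`Lip[f](x) = limsup_{r → 0} sup_{y ∈ closedBall x r} |f y - f x| / r`, with values in `[0,∞]`. -/
def ptLip {X : Type*} [MetricSpace X] (f : X → ℝ) (x : X) : ℝ≥0∞ :=
  limsup (fun r : ℝ => ⨆ y ∈ Metric.closedBall x r, ENNReal.ofReal (|f y - f x| / r)) (𝓝[>] 0)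

section PtLip

variable {X : Type*} [MetricSpace X]

theorem ptLip_eq_zero_iff {f : X → ℝ} {x : X} :
    ptLip f x = 0 ↔ Tendsto
      (fun r : ℝ => ⨆ y ∈ Metric.closedBall x r, ENNReal.ofReal (|f y - f x| / r))
      (𝓝[>] 0) (𝓝 0) := by
  constructor
  · intro h
    exact tendsto_of_le_liminf_of_limsup_le (zero_le) (le_of_eq h)
  · intro h
    exact h.limsup_eq

theorem ptLip_add_eq_zero {f g : X → ℝ} {x : X} (hf : ptLip f x = 0) (hg : ptLip g x = 0) :
    ptLip (fun y => f y + g y) x = 0 := by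
  rw [ptLip_eq_zero_iff] at *
  have h := hf.add hg
  rw [add_zero] at h
  refine tendsto_of_tendsto_of_tendsto_of_le_of_le' tendsto_const_nhds h
    (Eventually.of_forall fun _ => zero_le) ?_
  filter_upwards [self_mem_nhdsWithin] with r hr
  have hr0 : (0 : ℝ) < r := hr
  refine iSup₂_le fun y hy => ?_
  refine le_trans ?_ (add_le_add
    (le_iSup₂ (f := fun y (_ : y ∈ Metric.closedBall x r) =>
      ENNReal.ofReal (|f y - f x| / r)) y hy)
    (le_iSup₂ (f := fun y (_ : y ∈ Metric.closedBall x r) =>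
      ENNReal.ofReal (|g y - g x| / r)) y hy))
  rw [← ENNReal.ofReal_add (by positivity) (by positivity), ← add_div]
  refine ENNReal.ofReal_le_ofReal ?_
  gcongr
  calc |f y + g y - (f x + g x)| = |(f y - f x) + (g y - g x)| := by ring_nf
    _ ≤ _ := abs_add_le _ _

theorem ptLip_const_mul_eq_zero {f : X → ℝ} {x : X} (c : ℝ) (hf : ptLip f x = 0) :
    ptLip (fun y => c * f y) x = 0 := by
  rw [ptLip_eq_zero_iff] at *
  have h := ENNReal.Tendsto.const_mul (a := ENNReal.ofReal |c|) hf (Or.inr ENNReal.ofReal_ne_top)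
  rw [mul_zero] at h
  refine h.congr fun r => ?_
  rw [ENNReal.mul_iSup]
  refine iSup_congr fun y => ?_
  rw [ENNReal.mul_iSup]
  refine iSup_congr fun _ => ?_
  rw [← ENNReal.ofReal_mul (abs_nonneg c), ← mul_sub, abs_mul, mul_div_assoc]

theorem ptLip_congr {f g : X → ℝ} {x : X} (h : f =ᶠ[𝓝 x] g) : ptLip f x = ptLip g x := by
  refine limsup_congr ?_
  obtain ⟨ε, hε, hb⟩ := Metric.eventually_nhds_iff_ball.1 h
  filter_upwards [Ioo_mem_nhdsGT hε] with r hr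
  refine iSup_congr fun y => iSup_congr fun hy => ?_
  rw [hb y (Metric.closedBall_subset_ball hr.2 hy), hb x (Metric.mem_ball_self hε)]

end PtLip

/-! ### Measurable differentials and charts -/

/-- `G` is a measurable differential of `f` on `Y` with respect to the coordinates `ξ`:
`Lip[f - G(x) · ξ](x) = 0` for a.e. `x ∈ Y`. -/
structure IsDifferentialOn {X : Type*} [MetricSpace X] [MeasurableSpace X] (μ : Measure X)
    (Y : Set X) {n : ℕ} (ξ : X → EuclideanSpace ℝ (Fin n)) (f : X → ℝ)
    (G : X → EuclideanSpace ℝ (Fin n)) : Prop where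
  aestronglyMeasurable : AEStronglyMeasurable G (μ.restrict Y)
  ptLip_eq_zero : ∀ᵐ x ∂(μ.restrict Y), ptLip (fun y => f y - inner ℝ (G x) (ξ y)) x = 0

/-- `Y` is a chart of differentiability with coordinates `ξ : X → ℝⁿ`: `Y` is measurable of
positive measure, `ξ` is Lipschitz, and every Lipschitz function has a unique differential
in `L^∞(Y; ℝⁿ)`. -/
structure IsDiffChart {X : Type*} [MetricSpace X] [MeasurableSpace X] (μ : Measure X)
    (Y : Set X) {n : ℕ} (ξ : X → EuclideanSpace ℝ (Fin n)) : Prop where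
  nullMeasurableSet : NullMeasurableSet Y μ
  measure_pos : 0 < μ Y
  lipschitz : ∃ K : ℝ≥0, LipschitzWith K ξ
  existsUnique_differential : ∀ f : X → ℝ, (∃ K : ℝ≥0, LipschitzWith K f) →
    ∃! G : Lp (EuclideanSpace ℝ (Fin n)) ∞ (μ.restrict Y), IsDifferentialOn μ Y ξ f G

section Differential

variable {X : Type*} [MetricSpace X] [MeasurableSpace X] {μ : Measure X} {Y : Set X} {n : ℕ}
  {ξ : X → EuclideanSpace ℝ (Fin n)} {f g : X → ℝ} {F G : X → EuclideanSpace ℝ (Fin n)}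

theorem IsDifferentialOn.add (hf : IsDifferentialOn μ Y ξ f F) (hg : IsDifferentialOn μ Y ξ g G) :
    IsDifferentialOn μ Y ξ (f + g) (F + G) := by
  refine ⟨hf.1.add hg.1, ?_⟩
  filter_upwards [hf.2, hg.2] with x hx hy
  convert ptLip_add_eq_zero hx hy using 2
  ext y
  simp only [Pi.add_apply, inner_add_left]
  ring

theorem IsDifferentialOn.smul (c : ℝ) (hf : IsDifferentialOn μ Y ξ f F) :
    IsDifferentialOn μ Y ξ (c • f) (c • F) := by
  refine ⟨hf.1.const_smul c, ?_⟩
  filter_upwards [hf.2] with x hx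
  convert ptLip_const_mul_eq_zero c hx using 2
  ext y
  simp only [Pi.smul_apply, smul_eq_mul, real_inner_smul_left]
  ring

/-- On a chart, differentials are a.e. unique, also among unbounded measurable maps. -/
theorem IsDiffChart.ae_eq (hY : IsDiffChart μ Y ξ) (hF : IsDifferentialOn μ Y ξ f F)
    (hG : IsDifferentialOn μ Y ξ f G) : F =ᵐ[μ.restrict Y] G := by
  set H : X → EuclideanSpace ℝ (Fin n) := fun x => F x - G x with hH
  have hHm : AEStronglyMeasurable H (μ.restrict Y) := hF.1.sub hG.1
  set T : X → EuclideanSpace ℝ (Fin n) := fun x => (1 + ‖H x‖)⁻¹ • H x with hT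
  have hTm : AEStronglyMeasurable T (μ.restrict Y) := by
    have h1 : AEMeasurable (fun x => (1 + ‖H x‖)⁻¹) (μ.restrict Y) :=
      (hHm.norm.aemeasurable.const_add 1).inv
    exact h1.aestronglyMeasurable.smul hHm
  have hTb : ∀ x, ‖T x‖ ≤ 1 := by
    intro x
    have h0 : (0 : ℝ) < 1 + ‖H x‖ := by positivity
    rw [hT, norm_smul, norm_inv, Real.norm_of_nonneg h0.le, inv_mul_le_iff₀ h0]
    linarith
  have hTL : MemLp T ∞ (μ.restrict Y) :=
    memLp_top_of_bound hTm 1 (Eventually.of_forall hTb)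
  have h0 : ∃ K : ℝ≥0, LipschitzWith K (0 : X → ℝ) := ⟨0, LipschitzWith.const 0⟩
  obtain ⟨Z, -, hZ⟩ := hY.existsUnique_differential 0 h0
  have hzero : ∀ x : X, ptLip (fun _ : X => (0 : ℝ)) x = 0 := by
    intro x
    rw [ptLip_eq_zero_iff]
    simp
  have e1 : hTL.toLp T = Z := by
    refine hZ _ ⟨(Lp.stronglyMeasurable _).aestronglyMeasurable, ?_⟩
    filter_upwards [hTL.coeFn_toLp, hF.2, hG.2] with x hx h1 h2
    rw [hx]
    have h3 := ptLip_add_eq_zero h1 (ptLip_const_mul_eq_zero (-1) h2)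
    have h4 := ptLip_const_mul_eq_zero ((1 + ‖H x‖)⁻¹) h3
    convert h4 using 2
    ext y
    simp only [hT, hH, Pi.zero_apply, real_inner_smul_left, inner_sub_left]
    ring
  have e2 : (0 : Lp (EuclideanSpace ℝ (Fin n)) ∞ (μ.restrict Y)) = Z := by
    refine hZ _ ⟨(Lp.stronglyMeasurable _).aestronglyMeasurable, ?_⟩
    filter_upwards [Lp.coeFn_zero (EuclideanSpace ℝ (Fin n)) ∞ (μ.restrict Y)] with x hx
    rw [hx]
    simpa using hzero x
  have e3 := hTL.coeFn_toLp
  rw [e1, ← e2] at e3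
  filter_upwards [e3, Lp.coeFn_zero (EuclideanSpace ℝ (Fin n)) ∞ (μ.restrict Y)] with x h1 h2
  have h3 : T x = 0 := by rw [← h1, h2]; rfl
  have h4 : (1 + ‖H x‖)⁻¹ ≠ 0 := by positivity
  exact sub_eq_zero.1 ((smul_eq_zero.1 h3).resolve_left h4)

/-- On a chart, every locally Lipschitz function has a differential. -/
theorem IsDiffChart.exists_differential [BorelSpace X] [TopologicalSpace.SeparableSpace X]
    (hY : IsDiffChart μ Y ξ) (hf : LocallyLipschitz f) :
    ∃ G, IsDifferentialOn μ Y ξ f G := by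
  choose K t ht hL using hf
  have : SecondCountableTopology X := UniformSpace.secondCountable_of_separable X
  rcases isEmpty_or_nonempty X with hX | hX
  · refine ⟨fun _ => 0, aestronglyMeasurable_const, Eventually.of_forall fun x => ?_⟩
    exact (hX.false x).elim
  obtain ⟨s, hs, hcov⟩ := TopologicalSpace.countable_cover_nhds
    (f := fun x => interior (t x)) (fun x => interior_mem_nhds.2 (ht x))
  have hsne : s.Nonempty := by
    by_contra h
    rw [not_nonempty_iff_eq_empty] at h
    rw [h, biUnion_empty] at hcov
    exact absurd (hcov ▸ mem_univ hX.some) (notMem_empty _)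
  obtain ⟨e, rfl⟩ := hs.exists_eq_range hsne
  have hfind : ∀ x, ∃ k, x ∈ interior (t (e k)) := by
    intro x
    have hx : x ∈ ⋃ z ∈ range e, interior (t z) := by rw [hcov]; trivial
    simpa using hx
  choose g hgL hgE using fun k => (hL (e k)).extend_real
  have hd := fun k => (hY.existsUnique_differential (g k) ⟨_, hgL k⟩).exists
  choose D hD using hd
  classical
  refine ⟨fun x => D (Nat.find (hfind x)) x, ?_, ?_⟩
  · exact (Measurable.find (fun k => (Lp.stronglyMeasurable (D k)).measurable)
      (p := fun k x => x ∈ interior (t (e k)))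
      (fun k => isOpen_interior.measurableSet) hfind).aestronglyMeasurable
  · have hall : ∀ᵐ x ∂(μ.restrict Y), ∀ k,
        ptLip (fun y => g k y - inner ℝ (D k x) (ξ y)) x = 0 := ae_all_iff.2 fun k => (hD k).2
    filter_upwards [hall] with x hx
    rw [← hx (Nat.find (hfind x))]
    refine ptLip_congr ?_
    filter_upwards [isOpen_interior.mem_nhds (Nat.find_spec (hfind x))] with y hy
    rw [hgE _ (interior_subset hy)]

end Differential

/-! ### Atlases and the global differential -/

/-- The inclusion `ℝⁿ → ℝᴺ` that pads a vector by zeros (used for `n ≤ N`). -/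
def euclideanPad (n N : ℕ) : EuclideanSpace ℝ (Fin n) →ₗ[ℝ] EuclideanSpace ℝ (Fin N) where
  toFun v := WithLp.toLp 2 fun i : Fin N => if h : i.1 < n then v ⟨i.1, h⟩ else 0
  map_add' v w := by
    ext i
    by_cases h : i.1 < n <;> simp [h]
  map_smul' c v := by
    ext i
    by_cases h : i.1 < n <;> simp [h]

/-- A (strong) measurable differentiable structure on `(X,d,μ)`: an atlas of charts of
differentiability, indexed by a (countable) type `ι`, whose dimensions are bounded by `N` and whose
union has full measure. -/
structure DiffAtlas {X : Type*} [MetricSpace X] [MeasurableSpace X] (μ : Measure X)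
    (ι : Type*) where
  carrier : ι → Set X
  dim : ι → ℕ
  coord : ∀ m, X → EuclideanSpace ℝ (Fin (dim m))
  isDiffChart : ∀ m, IsDiffChart μ (carrier m) (coord m)
  measure_compl : μ (⋃ m, carrier m)ᶜ = 0
  N : ℕ
  dim_le : ∀ m, dim m ≤ N

namespace DiffAtlas

variable {X : Type*} [MetricSpace X] [MeasurableSpace X] {μ : Measure X} {ι : Type*}

/-- Some chart has dimension at least one. -/
def IsNondegenerate (A : DiffAtlas μ ι) : Prop := ∃ m, 1 ≤ A.dim m

open scoped Classical in
/-- The differential `D_m f` on the chart `X_m`; it exists for every locally Lipschitz `f`, and is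
unique up to null sets. -/
def chartDiff (A : DiffAtlas μ ι) (m : ι) (f : X → ℝ) : X → EuclideanSpace ℝ (Fin (A.dim m)) :=
  if h : ∃ G, IsDifferentialOn μ (A.carrier m) (A.coord m) f G then h.choose else 0

/-- The `m`-th term `χ_{X_m} D_m f` of the global differential, as a map into `ℝᴺ`. -/
def diffTerm (A : DiffAtlas μ ι) (f : X → ℝ) (m : ι) : X → EuclideanSpace ℝ (Fin A.N) :=
  (A.carrier m).indicator fun x => euclideanPad (A.dim m) A.N (A.chartDiff m f x)

/-- The global differential `Df = ∑ₘ χ_{X_m} D_m f : X → ℝᴺ`. -/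
def globalDiff (A : DiffAtlas μ ι) (f : X → ℝ) : X → EuclideanSpace ℝ (Fin A.N) :=
  fun x => ∑' m, A.diffTerm f m x

variable [BorelSpace X] [TopologicalSpace.SeparableSpace X]

theorem isDifferentialOn_chartDiff (A : DiffAtlas μ ι) (m : ι) {f : X → ℝ}
    (hf : LocallyLipschitz f) :
    IsDifferentialOn μ (A.carrier m) (A.coord m) f (A.chartDiff m f) := by
  have h := (A.isDiffChart m).exists_differential hf
  rw [chartDiff, dif_pos h]
  exact h.choose_spec

theorem diffTerm_add [Countable ι] (A : DiffAtlas μ ι) {f g : X → ℝ} (hf : LocallyLipschitz f)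
    (hg : LocallyLipschitz g) :
    ∀ᵐ x ∂μ, ∀ m, A.diffTerm (f + g) m x = A.diffTerm f m x + A.diffTerm g m x := by
  refine ae_all_iff.2 fun m => ?_
  have hfg : LocallyLipschitz (f + g) := hf.add hg
  have h := (A.isDiffChart m).ae_eq (A.isDifferentialOn_chartDiff m hfg)
    ((A.isDifferentialOn_chartDiff m hf).add (A.isDifferentialOn_chartDiff m hg))
  rw [EventuallyEq, ae_restrict_iff'₀ (A.isDiffChart m).nullMeasurableSet] at h
  filter_upwards [h] with x hx
  by_cases hxm : x ∈ A.carrier m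
  · simp only [diffTerm, indicator_of_mem hxm, hx hxm, Pi.add_apply, map_add]
  · simp only [diffTerm, indicator_of_notMem hxm, add_zero]

theorem diffTerm_smul [Countable ι] (A : DiffAtlas μ ι) (c : ℝ) {f : X → ℝ}
    (hf : LocallyLipschitz f) :
    ∀ᵐ x ∂μ, ∀ m, A.diffTerm (c • f) m x = c • A.diffTerm f m x := by
  refine ae_all_iff.2 fun m => ?_
  have hcf : LocallyLipschitz (c • f) := (lipschitzWith_smul c).locallyLipschitz.comp hf
  have h := (A.isDiffChart m).ae_eq (A.isDifferentialOn_chartDiff m hcf)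
    ((A.isDifferentialOn_chartDiff m hf).smul c)
  rw [EventuallyEq, ae_restrict_iff'₀ (A.isDiffChart m).nullMeasurableSet] at h
  filter_upwards [h] with x hx
  by_cases hxm : x ∈ A.carrier m
  · simp only [diffTerm, indicator_of_mem hxm, hx hxm, Pi.smul_apply, map_smul]
  · simp only [diffTerm, indicator_of_notMem hxm, smul_zero]

/-- Membership in `H̃^{1,p}(X)`: `f` is locally Lipschitz, `f ∈ L^p` and `|Df| ∈ L^p`. The series
that defines `Df` has to converge a.e., which is automatic if the charts are pairwise disjoint. -/
structure MemPreSobolev (A : DiffAtlas μ ι) (p : ℝ≥0∞) (f : X → ℝ) : Prop where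
  locallyLipschitz : LocallyLipschitz f
  memLp : MemLp f p μ
  summable : ∀ᵐ x ∂μ, Summable fun m => A.diffTerm f m x
  memLp_diff : MemLp (A.globalDiff f) p μ

theorem globalDiff_add [Countable ι] (A : DiffAtlas μ ι) {p : ℝ≥0∞} {f g : X → ℝ}
    (hf : A.MemPreSobolev p f) (hg : A.MemPreSobolev p g) :
    A.globalDiff (f + g) =ᵐ[μ] A.globalDiff f + A.globalDiff g := by
  filter_upwards [A.diffTerm_add hf.1 hg.1, hf.summable, hg.summable] with x h h1 h2
  simp only [globalDiff, h, Pi.add_apply]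
  exact h1.tsum_add h2

theorem globalDiff_smul [Countable ι] (A : DiffAtlas μ ι) (c : ℝ) {f : X → ℝ}
    (hf : LocallyLipschitz f) :
    A.globalDiff (c • f) =ᵐ[μ] c • A.globalDiff f := by
  filter_upwards [A.diffTerm_smul c hf] with x h
  simp only [globalDiff, h, Pi.smul_apply]
  exact tsum_const_smul'' c

/-- `H̃^{1,p}(X)` as a linear space of functions. -/
def preSobolevSubmodule [Countable ι] (A : DiffAtlas μ ι) (p : ℝ≥0∞) : Submodule ℝ (X → ℝ) where
  carrier := {f | A.MemPreSobolev p f}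
  add_mem' {f g} hf hg := by
    refine ⟨hf.1.add hg.1, hf.2.add hg.2, ?_, ?_⟩
    · filter_upwards [A.diffTerm_add hf.1 hg.1, hf.summable, hg.summable] with x h h1 h2
      simp only [h]
      exact h1.add h2
    · exact (memLp_congr_ae (A.globalDiff_add hf hg)).2 (hf.4.add hg.4)
  zero_mem' := by
    have h0 : LocallyLipschitz (0 : X → ℝ) := LocallyLipschitz.const 0
    have h1 := A.diffTerm_smul 0 h0
    have h2 := A.globalDiff_smul 0 h0
    rw [zero_smul] at h1 h2
    refine ⟨h0, MemLp.zero, ?_, ?_⟩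
    · filter_upwards [h1] with x hx
      have hz : (fun m => A.diffTerm 0 m x) = fun _ => 0 := by
        funext m
        rw [hx m, zero_smul]
      rw [hz]
      exact summable_zero
    · refine (memLp_congr_ae h2).2 ?_
      rw [zero_smul]
      exact MemLp.zero
  smul_mem' c f hf := by
    refine ⟨(lipschitzWith_smul c).locallyLipschitz.comp hf.1, hf.2.const_smul c, ?_, ?_⟩
    · filter_upwards [A.diffTerm_smul c hf.1, hf.summable] with x h h1
      simp only [h]
      exact h1.const_smul c
    · exact (memLp_congr_ae (A.globalDiff_smul c hf.1)).2 (hf.4.const_smul c)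

/-- The space `H̃^{1,p}(X)`, normed below by `‖f‖_{L^p} + ‖ |Df| ‖_{L^p}`. -/
def PreSobolev [Countable ι] (A : DiffAtlas μ ι) (p : ℝ≥0∞) : Type _ :=
  ↥(A.preSobolevSubmodule p)

instance [Countable ι] (A : DiffAtlas μ ι) (p : ℝ≥0∞) : AddCommGroup (A.PreSobolev p) :=
  inferInstanceAs (AddCommGroup ↥(A.preSobolevSubmodule p))

instance [Countable ι] (A : DiffAtlas μ ι) (p : ℝ≥0∞) : Module ℝ (A.PreSobolev p) :=
  inferInstanceAs (Module ℝ ↥(A.preSobolevSubmodule p))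

instance [Countable ι] (A : DiffAtlas μ ι) (p : ℝ≥0∞) : Norm (A.PreSobolev p) where
  norm f := (eLpNorm f.1 p μ).toReal + (eLpNorm (A.globalDiff f.1) p μ).toReal

theorem preSobolevCore [Countable ι] (A : DiffAtlas μ ι) (p : ℝ≥0∞) [hp : Fact (1 ≤ p)] :
    SeminormedSpace.Core ℝ (A.PreSobolev p) where
  norm_nonneg f := add_nonneg ENNReal.toReal_nonneg ENNReal.toReal_nonneg
  norm_smul c f := by
    change (eLpNorm (c • f.1) p μ).toReal + (eLpNorm (A.globalDiff (c • f.1)) p μ).toReal =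
      ‖c‖ * ((eLpNorm f.1 p μ).toReal + (eLpNorm (A.globalDiff f.1) p μ).toReal)
    rw [eLpNorm_congr_ae (A.globalDiff_smul c f.2.1), eLpNorm_const_smul, eLpNorm_const_smul,
      ENNReal.toReal_mul, ENNReal.toReal_mul, toReal_enorm, mul_add]
  norm_triangle f g := by
    change (eLpNorm (f.1 + g.1) p μ).toReal + (eLpNorm (A.globalDiff (f.1 + g.1)) p μ).toReal ≤
      ((eLpNorm f.1 p μ).toReal + (eLpNorm (A.globalDiff f.1) p μ).toReal) +
      ((eLpNorm g.1 p μ).toReal + (eLpNorm (A.globalDiff g.1) p μ).toReal)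
    rw [eLpNorm_congr_ae (A.globalDiff_add f.2 g.2)]
    have hf := f.2.2.eLpNorm_ne_top
    have hg := g.2.2.eLpNorm_ne_top
    have hf' := f.2.4.eLpNorm_ne_top
    have hg' := g.2.4.eLpNorm_ne_top
    have h1 := ENNReal.toReal_mono (ENNReal.add_ne_top.2 ⟨hf, hg⟩)
      (eLpNorm_add_le f.2.2.1 g.2.2.1 hp.out)
    have h2 := ENNReal.toReal_mono (ENNReal.add_ne_top.2 ⟨hf', hg'⟩)
      (eLpNorm_add_le f.2.4.1 g.2.4.1 hp.out)
    rw [ENNReal.toReal_add hf hg] at h1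
    rw [ENNReal.toReal_add hf' hg'] at h2
    linarith

instance [Countable ι] (A : DiffAtlas μ ι) (p : ℝ≥0∞) [Fact (1 ≤ p)] :
    SeminormedAddCommGroup (A.PreSobolev p) :=
  SeminormedAddCommGroup.ofCore (A.preSobolevCore p)

instance [Countable ι] (A : DiffAtlas μ ι) (p : ℝ≥0∞) [Fact (1 ≤ p)] :
    NormedSpace ℝ (A.PreSobolev p) where
  norm_smul_le c f := le_of_eq ((A.preSobolevCore p).norm_smul c f)

/-- The Sobolev space `H^{1,p}(X)`: the completion of `H̃^{1,p}(X)`. -/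
abbrev Sobolev [Countable ι] (A : DiffAtlas μ ι) (p : ℝ≥0∞) [Fact (1 ≤ p)] : Type _ :=
  UniformSpace.Completion (A.PreSobolev p)

end DiffAtlas

/-! ### Hajłasz–Sobolev spaces -/

/-- `g` is a Hajłasz gradient of `u` in `L^p`: `g ≥ 0`, `g ∈ L^p`, and off a null set
`|u x - u y| ≤ (g x + g y) d(x, y)`. -/
structure IsHajlaszGradient {X : Type*} [MetricSpace X] [MeasurableSpace X] (μ : Measure X)
    (p : ℝ≥0∞) (u g : X → ℝ) : Prop where
  nonneg : ∀ x, 0 ≤ g x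
  memLp : MemLp g p μ
  le : ∃ E : Set X, μ E = 0 ∧ ∀ x ∉ E, ∀ y ∉ E, |u x - u y| ≤ (g x + g y) * dist x y

section Hajlasz

variable {X : Type*} [MetricSpace X] [MeasurableSpace X] {μ : Measure X} {p : ℝ≥0∞}
  {u v g h : X → ℝ}

theorem IsHajlaszGradient.congr (hu : IsHajlaszGradient μ p u g) (huv : u =ᵐ[μ] v) :
    IsHajlaszGradient μ p v g := by
  obtain ⟨h0, h1, E, hE, hle⟩ := hu
  refine ⟨h0, h1, E ∪ {x | u x = v x}ᶜ, measure_union_null hE huv, fun x hx y hy => ?_⟩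
  simp only [mem_union, mem_compl_iff, mem_ofPred_eq, not_or, not_not] at hx hy
  rw [← hx.2, ← hy.2]
  exact hle x hx.1 y hy.1

theorem IsHajlaszGradient.add (hu : IsHajlaszGradient μ p u g) (hv : IsHajlaszGradient μ p v h) :
    IsHajlaszGradient μ p (u + v) (g + h) := by
  obtain ⟨h0, h1, E, hE, hle⟩ := hu
  obtain ⟨h0', h1', E', hE', hle'⟩ := hv
  refine ⟨fun x => add_nonneg (h0 x) (h0' x), h1.add h1', E ∪ E', measure_union_null hE hE',
    fun x hx y hy => ?_⟩
  simp only [mem_union, not_or] at hx hy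
  have a := hle x hx.1 y hy.1
  have b := hle' x hx.2 y hy.2
  have c := abs_add_le (u x - u y) (v x - v y)
  simp only [Pi.add_apply]
  calc |u x + v x - (u y + v y)| = |(u x - u y) + (v x - v y)| := by ring_nf
    _ ≤ (g x + g y) * dist x y + (h x + h y) * dist x y := by linarith
    _ = (g x + h x + (g y + h y)) * dist x y := by ring

theorem IsHajlaszGradient.smul (c : ℝ) (hu : IsHajlaszGradient μ p u g) :
    IsHajlaszGradient μ p (c • u) (|c| • g) := by
  obtain ⟨h0, h1, E, hE, hle⟩ := hu
  refine ⟨fun x => mul_nonneg (abs_nonneg c) (h0 x), h1.const_smul _, E, hE, fun x hx y hy => ?_⟩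
  simp only [Pi.smul_apply, smul_eq_mul]
  rw [← mul_sub, abs_mul, ← mul_add, mul_assoc]
  exact mul_le_mul_of_nonneg_left (hle x hx y hy) (abs_nonneg c)

variable (μ p)

/-- `M^{1,p}(X)` as a linear subspace of `L^p(X)`. -/
def hajlaszSubmodule : Submodule ℝ (Lp ℝ p μ) where
  carrier := {u | ∃ g, IsHajlaszGradient μ p u g}
  add_mem' := by
    rintro u v ⟨g, hg⟩ ⟨h, hh⟩
    exact ⟨g + h, (hg.add hh).congr (Lp.coeFn_add u v).symm⟩
  zero_mem' := ⟨0, fun _ => le_rfl, MemLp.zero, {x | (0 : Lp ℝ p μ) x = 0}ᶜ,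
    Lp.coeFn_zero ℝ p μ, fun x hx y hy => by
      simp only [mem_compl_iff, mem_ofPred_eq, not_not] at hx hy
      change |((0 : Lp ℝ p μ) : X → ℝ) x - ((0 : Lp ℝ p μ) : X → ℝ) y| ≤ _
      rw [hx, hy]
      simp⟩
  smul_mem' := by
    rintro c u ⟨g, hg⟩
    exact ⟨|c| • g, (hg.smul c).congr (Lp.coeFn_smul c u).symm⟩

/-- The Hajłasz–Sobolev space `M^{1,p}(X)`. It is a type synonym, so that it does not inherit the
norm of `L^p(X)`; its norm is given below. -/
def HajlaszSobolev : Type _ := ↥(hajlaszSubmodule μ p)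

instance : AddCommGroup (HajlaszSobolev μ p) :=
  inferInstanceAs (AddCommGroup ↥(hajlaszSubmodule μ p))

instance : Module ℝ (HajlaszSobolev μ p) :=
  inferInstanceAs (Module ℝ ↥(hajlaszSubmodule μ p))

/-- The infimum of `‖g‖_{L^p}` over all Hajłasz gradients `g` of `u`. -/
def hajlaszEnergy (u : X → ℝ) : ℝ :=
  sInf {a | ∃ g, IsHajlaszGradient μ p u g ∧ a = (eLpNorm g p μ).toReal}

instance : Norm (HajlaszSobolev μ p) where
  norm u := (eLpNorm u.1 p μ).toReal + hajlaszEnergy μ p u.1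

variable {μ p}

theorem hajlaszEnergy_bddBelow (u : X → ℝ) :
    BddBelow {a | ∃ g, IsHajlaszGradient μ p u g ∧ a = (eLpNorm g p μ).toReal} :=
  ⟨0, by rintro _ ⟨g, -, rfl⟩; exact ENNReal.toReal_nonneg⟩

theorem hajlaszEnergy_le (hu : IsHajlaszGradient μ p u g) :
    hajlaszEnergy μ p u ≤ (eLpNorm g p μ).toReal :=
  csInf_le (hajlaszEnergy_bddBelow u) ⟨g, hu, rfl⟩

theorem le_hajlaszEnergy {a : ℝ} (hu : IsHajlaszGradient μ p u g)
    (ha : ∀ g, IsHajlaszGradient μ p u g → a ≤ (eLpNorm g p μ).toReal) :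
    a ≤ hajlaszEnergy μ p u :=
  le_csInf ⟨_, g, hu, rfl⟩ (by rintro _ ⟨g, hg, rfl⟩; exact ha g hg)

theorem hajlaszEnergy_nonneg : 0 ≤ hajlaszEnergy μ p u :=
  Real.sInf_nonneg (by rintro _ ⟨g, -, rfl⟩; exact ENNReal.toReal_nonneg)

theorem hajlaszEnergy_add_le [hp : Fact (1 ≤ p)] (hu : IsHajlaszGradient μ p u g)
    (hv : IsHajlaszGradient μ p v h) (w : X → ℝ) (hw : u + v =ᵐ[μ] w) :
    hajlaszEnergy μ p w ≤ hajlaszEnergy μ p u + hajlaszEnergy μ p v := by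
  rw [← sub_le_iff_le_add]
  refine le_hajlaszEnergy hu fun g' hg' => ?_
  rw [sub_le_comm]
  refine le_hajlaszEnergy hv fun h' hh' => ?_
  have a := hajlaszEnergy_le ((hg'.add hh').congr hw)
  have b := ENNReal.toReal_mono
    (ENNReal.add_ne_top.2 ⟨hg'.2.eLpNorm_ne_top, hh'.2.eLpNorm_ne_top⟩)
    (eLpNorm_add_le hg'.2.1 hh'.2.1 hp.out)
  rw [ENNReal.toReal_add hg'.2.eLpNorm_ne_top hh'.2.eLpNorm_ne_top] at b
  linarith

theorem hajlaszEnergy_smul_le (c : ℝ) (hu : IsHajlaszGradient μ p u g) (w : X → ℝ)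
    (hw : c • u =ᵐ[μ] w) : hajlaszEnergy μ p w ≤ |c| * hajlaszEnergy μ p u := by
  have key : ∀ g, IsHajlaszGradient μ p u g →
      hajlaszEnergy μ p w ≤ |c| * (eLpNorm g p μ).toReal := by
    intro g' hg'
    have a := hajlaszEnergy_le ((hg'.smul c).congr hw)
    rwa [eLpNorm_const_smul, ENNReal.toReal_mul, toReal_enorm, Real.norm_eq_abs, abs_abs] at a
  rcases eq_or_ne c 0 with rfl | hc
  · simpa using key g hu
  · have hc' : 0 < |c| := abs_pos.2 hc
    rw [← div_le_iff₀' hc']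
    exact le_hajlaszEnergy hu fun g' hg' => (div_le_iff₀' hc').2 (key g' hg')

variable (μ p)

theorem hajlaszCore [hp : Fact (1 ≤ p)] : NormedSpace.Core ℝ (HajlaszSobolev μ p) where
  norm_nonneg u := add_nonneg ENNReal.toReal_nonneg hajlaszEnergy_nonneg
  norm_smul c u := by
    obtain ⟨u, g, hg⟩ := u
    change (eLpNorm (c • u : Lp ℝ p μ) p μ).toReal + hajlaszEnergy μ p (c • u : Lp ℝ p μ) =
      ‖c‖ * ((eLpNorm u p μ).toReal + hajlaszEnergy μ p u)
    have e1 := Lp.coeFn_smul c u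
    rw [eLpNorm_congr_ae e1, eLpNorm_const_smul, ENNReal.toReal_mul, toReal_enorm, mul_add]
    congr 1
    refine le_antisymm (hajlaszEnergy_smul_le c hg _ e1.symm) ?_
    rcases eq_or_ne c 0 with rfl | hc
    · simpa using hajlaszEnergy_nonneg
    · have hg' := (hg.smul c).congr e1.symm
      have e2 : c⁻¹ • ((c • u : Lp ℝ p μ) : X → ℝ) =ᵐ[μ] u := by
        filter_upwards [e1] with x hx
        rw [Pi.smul_apply, hx, Pi.smul_apply, inv_smul_smul₀ hc]
      have := hajlaszEnergy_smul_le c⁻¹ hg' _ e2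
      rwa [abs_inv, le_inv_mul_iff₀ (abs_pos.2 hc)] at this
  norm_triangle u v := by
    obtain ⟨u, g, hg⟩ := u
    obtain ⟨v, h, hh⟩ := v
    change (eLpNorm (u + v : Lp ℝ p μ) p μ).toReal + hajlaszEnergy μ p (u + v : Lp ℝ p μ) ≤
      ((eLpNorm u p μ).toReal + hajlaszEnergy μ p u) +
      ((eLpNorm v p μ).toReal + hajlaszEnergy μ p v)
    have a := hajlaszEnergy_add_le hg hh _ (Lp.coeFn_add u v).symm
    have b := norm_add_le u v
    rw [Lp.norm_def, Lp.norm_def, Lp.norm_def] at b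
    linarith
  norm_eq_zero_iff u := by
    obtain ⟨u, g, hg⟩ := u
    change (eLpNorm u p μ).toReal + hajlaszEnergy μ p u = 0 ↔ _
    constructor
    · intro h0
      have h1 : (0 : ℝ) ≤ (eLpNorm u p μ).toReal := ENNReal.toReal_nonneg
      have h2 : 0 ≤ hajlaszEnergy μ p u := hajlaszEnergy_nonneg
      have h3 : ‖u‖ = 0 := by rw [Lp.norm_def]; linarith
      exact Subtype.ext (norm_eq_zero.1 h3)
    · intro h0
      have hu : u = 0 := congrArg Subtype.val h0
      subst hu
      have h1 : IsHajlaszGradient μ p ((0 : Lp ℝ p μ) : X → ℝ) 0 := by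
        have := (hg.smul 0)
        simp only [abs_zero, zero_smul] at this
        exact this.congr (Lp.coeFn_zero ℝ p μ).symm
      have h2 := hajlaszEnergy_le h1
      simp only [eLpNorm_zero, ENNReal.toReal_zero] at h2
      have h3 : 0 ≤ hajlaszEnergy μ p ((0 : Lp ℝ p μ) : X → ℝ) := hajlaszEnergy_nonneg
      rw [← Lp.norm_def, norm_zero]
      linarith

instance [Fact (1 ≤ p)] : NormedAddCommGroup (HajlaszSobolev μ p) :=
  NormedAddCommGroup.ofCore (hajlaszCore μ p)

instance [Fact (1 ≤ p)] : NormedSpace ℝ (HajlaszSobolev μ p) :=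
  NormedSpace.ofCore (hajlaszCore μ p)

end Hajlasz

end

/-!
Reflexivity of `H^{1,p}` and `M^{1,p}` is obtained without describing the dual spaces. A Banach
space is reflexive as soon as every bounded sequence has convex combinations of its tails that
converge in norm (`HasTailLimits.isReflexiveBanach`): if the canonical map to the bidual were not
onto, there would be functionals `f i` and points `x j` of the unit ball with `f i (x j)` close to
a fixed positive number for `i ≤ j` and close to zero for `i > j`, and no convex combinations of
tails of such a sequence can be Cauchy. Tail limits exist in `L^p` for `1 < p < ∞` by uniform
convexity (`Lp_hasTailLimits`), pass to products and can be lifted along linear maps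
(`HasTailLimits.exists_lift`). The map `f ↦ (f, Df)` to a product of `L^p` spaces then settles
`H^{1,p}` (`DiffAtlas.sobolev_hasTailLimits`).

For `M^{1,p}`, lifting to pairs `(u, g)` of a function and a Hajłasz gradient reduces matters to a
sequence `h j` of Lipschitz functions with bounded support that is bounded in `M^{1,p}` and tends to
zero in `L^p`; one has to find convex combinations of its tails that tend to zero in `M^{1,p}`
(`DiffPartition.exists_mem_tailHull_small`). No Poincaré inequality is available, so a Hajłasz
gradient is not controlled by the pointwise Lipschitz constant `Lip` of a single function. Three
facts replace it.

* If `h j → 0` in `L^p` and `Lip[h j] ≤ l` up to errors that are small in `L^p`, then further convex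
  combinations have Hajłasz gradients `l + D` with `D` small in `L^p`
  (`exists_mem_tailHull_excess_le`). In an average of `f` and of a much later `f'`, the function `f`
  is controlled by `l` at small scales while `f'` is negligible at all other scales. So at each scale
  only one of the two contributes its excess over `l`, and the norm of the excess drops by the factor
  `2 ^ (1 / p - 1) < 1`.
* Convex combinations can be chosen so that `Lip[h i - h j] → 0` in `L^p`
  (`DiffPartition.exists_tailHull_lipAt_cauchy`). On countably many disjoint pieces of the charts the
  coordinates satisfy `c ‖v‖ ≤ Lip[v · ξ]`, so that `Lip[f]` and the differential of `f` are
  comparable there, and the differentials have tail limits in `L^p`.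
* Then `Lip[h j] → 0` a.e. (`IsDiffPiece.ae_tendsto_lipAt`). The alternating sums
  `S k = H 0 - H 1 + H 2 - ⋯` of suitable convex combinations, taken at rapidly decreasing scales,
  converge to functions that are Lipschitz on sets exhausting `X` up to a null set. These limits are
  differentiable a.e. on the pieces, and at density points the differentials of `S k` converge to
  the differential of the limit. So the differentials of the terms `H k` tend to zero.

By dominated convergence `Lip[h j] → 0` in `L^p`, and the first fact with `l = 0` completes the
argument.
-/

/-! ### Convex combinations of tails, and reflexivity -/

section TailHull

variable {V W : Type*} [AddCommGroup V] [Module ℝ V] [AddCommGroup W] [Module ℝ W]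

/-- The convex hull of the tail `{x j | k ≤ j}` of a sequence. -/
def tailHull (x : ℕ → V) (k : ℕ) : Set V := convexHull ℝ (x '' Ici k)

theorem convex_tailHull (x : ℕ → V) (k : ℕ) : Convex ℝ (tailHull x k) := convex_convexHull ℝ _

theorem mem_tailHull_of_le (x : ℕ → V) {k j : ℕ} (h : k ≤ j) : x j ∈ tailHull x k :=
  subset_convexHull ℝ _ (mem_image_of_mem x h)

theorem tailHull_anti (x : ℕ → V) {k l : ℕ} (h : k ≤ l) : tailHull x l ⊆ tailHull x k :=
  convexHull_mono (image_mono (Ici_subset_Ici.2 h))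

theorem tailHull_subset {x : ℕ → V} {k : ℕ} {C : Set V} (hC : Convex ℝ C)
    (h : ∀ j, k ≤ j → x j ∈ C) : tailHull x k ⊆ C :=
  convexHull_min (by rintro _ ⟨j, hj, rfl⟩; exact h j hj) hC

theorem tailHull_trans {x y : ℕ → V} (h : ∀ k, y k ∈ tailHull x k) (k : ℕ) :
    tailHull y k ⊆ tailHull x k :=
  tailHull_subset (convex_tailHull x k) fun j hj => tailHull_anti x hj (h j)

theorem image_tailHull (φ : V →ₗ[ℝ] W) (x : ℕ → V) (k : ℕ) :
    φ '' tailHull x k = tailHull (fun j => φ (x j)) k := by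
  rw [tailHull, LinearMap.image_convexHull, tailHull, image_image]

end TailHull

/-- Every bounded sequence admits convex combinations of its tails that converge in norm.
For Banach spaces this is equivalent to reflexivity; only the implication
`HasTailLimits.isReflexiveBanach` is needed. -/
def HasTailLimits (E : Type*) [NormedAddCommGroup E] [NormedSpace ℝ E] : Prop :=
  ∀ x : ℕ → E, (∃ K, ∀ j, ‖x j‖ ≤ K) →
    ∃ y : ℕ → E, (∀ k, y k ∈ tailHull x k) ∧ ∃ z, Tendsto y atTop (𝓝 z)

section HasTailLimits

variable {E F V : Type*} [NormedAddCommGroup E] [NormedSpace ℝ E]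
  [NormedAddCommGroup F] [NormedSpace ℝ F] [AddCommGroup V] [Module ℝ V]

/-- Convex combinations of tails can be chosen in the domain of a linear map. -/
theorem HasTailLimits.exists_lift (hE : HasTailLimits E) (φ : V →ₗ[ℝ] E) (x : ℕ → V)
    (hx : ∃ K, ∀ j, ‖φ (x j)‖ ≤ K) :
    ∃ y : ℕ → V, (∀ k, y k ∈ tailHull x k) ∧ ∃ z, Tendsto (fun k => φ (y k)) atTop (𝓝 z) := by
  obtain ⟨y, hy, z, hz⟩ := hE (fun j => φ (x j)) hx
  have : ∀ k, ∃ v ∈ tailHull x k, φ v = y k := fun k => by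
    have := hy k
    rwa [← image_tailHull] at this
  choose v hv hvy using this
  exact ⟨v, hv, z, by simpa only [hvy] using hz⟩

theorem tendsto_of_mem_tailHull {x y : ℕ → E} {z : E} (hx : Tendsto x atTop (𝓝 z))
    (hy : ∀ k, y k ∈ tailHull x k) : Tendsto y atTop (𝓝 z) := by
  rw [Metric.tendsto_atTop] at hx ⊢
  intro ε hε
  obtain ⟨N, hN⟩ := hx ε hε
  refine ⟨N, fun n hn => ?_⟩
  exact tailHull_subset (convex_ball z ε) (fun j hj => Metric.mem_ball.2 (hN j (hn.trans hj))) (hy n)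

theorem norm_le_of_mem_tailHull {x : ℕ → E} {K : ℝ} {k : ℕ} {y : E} (hx : ∀ j, k ≤ j → ‖x j‖ ≤ K)
    (hy : y ∈ tailHull x k) : ‖y‖ ≤ K := by
  have := tailHull_subset (convex_closedBall (0 : E) K)
    (fun j hj => mem_closedBall_zero_iff.2 (hx j hj)) hy
  exact mem_closedBall_zero_iff.1 this

theorem HasTailLimits.completeSpace (hE : HasTailLimits E) : CompleteSpace E := by
  refine Metric.complete_of_cauchySeq_tendsto fun u hu => ?_
  obtain ⟨R, -, hR⟩ := cauchySeq_bdd hu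
  obtain ⟨y, hy, z, hz⟩ := hE u ⟨R + ‖u 0‖, fun j => by
    have h1 := hR j 0
    have h2 := norm_le_norm_sub_add (u j) (u 0)
    rw [dist_eq_norm] at h1
    linarith⟩
  refine ⟨z, ?_⟩
  have hd : Tendsto (fun k => dist (y k) (u k)) atTop (𝓝 0) := by
    rw [Metric.tendsto_atTop]
    intro ε hε
    obtain ⟨N, hN⟩ := Metric.cauchySeq_iff.1 hu ε hε
    refine ⟨N, fun n hn => ?_⟩
    have : y n ∈ Metric.ball (u n) ε := tailHull_subset (convex_ball (u n) ε)
      (fun j hj => Metric.mem_ball.2 (hN j (hn.trans hj) n hn)) (hy n)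
    rw [Real.dist_0_eq_abs, abs_of_nonneg dist_nonneg]
    exact this
  exact (tendsto_iff_of_dist hd).1 hz

/-- A finite-dimensional form of Goldstine's theorem: on finitely many functionals, an element of
the bidual is approximated by elements of the space of no larger norm. -/
theorem exists_norm_le_forall_abs_sub_lt {E : Type*} [NormedAddCommGroup E] [NormedSpace ℝ E]
    (Φ : StrongDual ℝ (StrongDual ℝ E)) (s : Finset (StrongDual ℝ E)) {ε : ℝ} (hε : 0 < ε) :
    ∃ x : E, ‖x‖ ≤ ‖Φ‖ ∧ ∀ f ∈ s, |f x - Φ f| < ε := by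
  classical
  let T : E →L[ℝ] (s → ℝ) := ContinuousLinearMap.pi fun i => i.1
  set B := Metric.closedBall (0 : E) ‖Φ‖ with hB
  have hconv : Convex ℝ (closure (T '' B)) :=
    ((convex_closedBall (0 : E) ‖Φ‖).linear_image T.toLinearMap).closure
  by_cases hy : (fun i : s => Φ i.1) ∈ closure (T '' B)
  · obtain ⟨_, ⟨x, hx, rfl⟩, hd⟩ := Metric.mem_closure_iff.1 hy ε hε
    refine ⟨x, mem_closedBall_zero_iff.1 hx, fun f hf => ?_⟩
    have := (dist_pi_lt_iff hε).1 hd ⟨f, hf⟩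
    rw [abs_sub_comm]
    exact this
  · exfalso
    obtain ⟨g, u, hg1, hg2⟩ := geometric_hahn_banach_closed_point hconv isClosed_closure hy
    set G : StrongDual ℝ E := ∑ i : s, g (Pi.single i 1) • i.1 with hG
    have hgv : ∀ v : s → ℝ, g v = ∑ i : s, g (Pi.single i 1) * v i := by
      intro v
      conv_lhs => rw [← Finset.univ_sum_single v, map_sum]
      refine Finset.sum_congr rfl fun i _ => ?_
      have : (Pi.single i (v i) : s → ℝ) = v i • Pi.single i 1 := by
        rw [← Pi.single_smul, smul_eq_mul, mul_one]
      rw [this, map_smul, smul_eq_mul, mul_comm]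
    have hGx : ∀ x ∈ B, G x < u := by
      intro x hx
      have := hg1 _ (subset_closure (mem_image_of_mem T hx))
      rw [hgv] at this
      simpa [hG, T] using this
    have hΦG : u < Φ G := by
      rw [hgv] at hg2
      simpa [hG, map_sum] using hg2
    have hu : 0 < u := by
      simpa using hGx 0 (mem_closedBall_zero_iff.2 (by rw [norm_zero]; exact norm_nonneg Φ))
    rcases (norm_nonneg Φ).eq_or_lt with h0 | h0
    · have h1 := (le_abs_self _).trans (Φ.le_opNorm G)
      rw [← h0, zero_mul] at h1
      linarith
    · have hb : ‖G‖ ≤ u / ‖Φ‖ := by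
        refine ContinuousLinearMap.opNorm_le_bound _ (by positivity) fun x => ?_
        rcases eq_or_ne x 0 with rfl | hx
        · simp
        have hx' : 0 < ‖x‖ := norm_pos_iff.2 hx
        have key : ∀ c : ℝ, |c| = 1 → c * G x ≤ u / ‖Φ‖ * ‖x‖ := by
          intro c hc
          have h1 := hGx ((c * (‖Φ‖ / ‖x‖)) • x) (by
            rw [hB, mem_closedBall_zero_iff, norm_smul, Real.norm_eq_abs, abs_mul, hc, one_mul,
              abs_of_pos (div_pos h0 hx'), div_mul_cancel₀ _ hx'.ne'])
          rw [map_smul, smul_eq_mul] at h1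
          have h2 : c * G x * (‖Φ‖ / ‖x‖) ≤ u := by linarith
          rw [mul_comm (u / ‖Φ‖), ← mul_div_assoc, le_div_iff₀ h0]
          have h3 := mul_le_mul_of_nonneg_right h2 hx'.le
          have h4 : c * G x * (‖Φ‖ / ‖x‖) * ‖x‖ = c * G x * ‖Φ‖ := by field_simp
          linarith
        rw [Real.norm_eq_abs]
        refine abs_le.2 ⟨?_, ?_⟩
        · have := key (-1) (by simp)
          linarith
        · have := key 1 (by simp)
          linarith
      have h1 := (le_abs_self _).trans (Φ.le_opNorm G)
      have h2 : ‖Φ‖ * ‖G‖ ≤ u := by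
        calc ‖Φ‖ * ‖G‖ ≤ ‖Φ‖ * (u / ‖Φ‖) := by gcongr
          _ = u := by field_simp
      linarith

set_option maxSynthPendingDepth 10 in
/-- If `Φ` in the bidual is not an evaluation, a functional `ψ` on the bidual separates it from the
space. Approximating `Φ` and `ψ` on finite sets alternately yields bounded sequences `x j` and `f i`
with `f i (x j) ≈ ψ Φ` for `i ≤ j` and `f i (x j) ≈ 0` for `j < i`; convex combinations of the tails
of such a sequence `x` cannot form a Cauchy sequence. -/
theorem HasTailLimits.isReflexiveBanach (hE : HasTailLimits E) : IsReflexiveBanach E := by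
  classical
  have hc := hE.completeSpace
  refine ⟨hc, fun Φ => ?_⟩
  by_contra hΦ
  set J := NormedSpace.inclusionInDoubleDual ℝ E with hJ
  have hcl : IsClosed (range J) := by
    have := (NormedSpace.inclusionInDoubleDualLi (E := E) ℝ).isometry.isUniformInducing
    exact this.isComplete_range.isClosed
  have hconv : Convex ℝ (range J) := by
    rintro _ ⟨a, rfl⟩ _ ⟨b, rfl⟩ s t - - -
    exact ⟨s • a + t • b, by rw [map_add, map_smul, map_smul]⟩
  obtain ⟨ψ, u, h1, h2⟩ := geometric_hahn_banach_closed_point hconv hcl hΦ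
  have hu : 0 < u := by simpa using h1 (J 0) (mem_range_self 0)
  have hψ0 : ∀ x, ψ (J x) = 0 := by
    intro x
    by_contra h
    have := h1 (J ((u / ψ (J x)) • x)) (mem_range_self _)
    rw [map_smul, map_smul, smul_eq_mul, div_mul_cancel₀ _ h] at this
    exact lt_irrefl _ this
  set θ := ψ Φ with hθ
  have hθ0 : 0 < θ := hu.trans h2
  set ε := θ / 8 with hε
  have hε0 : 0 < ε := by positivity
  obtain ⟨q, hq1, hq2⟩ := exists_seq_of_forall_finset_exists
    (fun q : E × StrongDual ℝ E => ‖q.1‖ ≤ ‖Φ‖ ∧ ‖q.2‖ ≤ ‖ψ‖ ∧ |Φ q.2 - θ| < ε ∧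
      |q.2 q.1 - Φ q.2| < ε)
    (fun q q' => |q'.2 q.1| < ε ∧ |q.2 q'.1 - Φ q.2| < ε) (by
      intro s _
      obtain ⟨f, hf1, hf2⟩ := exists_norm_le_forall_abs_sub_lt ψ
        (insert Φ (s.image fun q => J q.1)) hε0
      obtain ⟨x, hx1, hx2⟩ := exists_norm_le_forall_abs_sub_lt Φ
        (insert f (s.image fun q => q.2)) hε0
      refine ⟨(x, f), ⟨hx1, hf1, hf2 Φ (Finset.mem_insert_self _ _),
        hx2 f (Finset.mem_insert_self _ _)⟩, fun q hq => ⟨?_, ?_⟩⟩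
      · have := hf2 (J q.1) (Finset.mem_insert_of_mem (Finset.mem_image_of_mem _ hq))
        rw [hψ0, sub_zero] at this
        simpa [hJ] using this
      · exact hx2 q.2 (Finset.mem_insert_of_mem (Finset.mem_image_of_mem _ hq)))
  obtain ⟨y, hy, z, hz⟩ := hE (fun j => (q j).1) ⟨_, fun j => (hq1 j).1⟩
  have hlow : ∀ k, θ - 2 * ε ≤ (q k).2 (y k) := by
    intro k
    have hset : Convex ℝ {v : E | θ - 2 * ε ≤ (q k).2 v} :=
      convex_halfSpace_ge (q k).2.toLinearMap.isLinear _
    refine tailHull_subset hset (fun j hj => ?_) (hy k)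
    have ha := (hq1 k).2.2.1
    have hb : |(q k).2 (q j).1 - Φ (q k).2| < ε := by
      rcases hj.eq_or_lt with rfl | hlt
      · exact (hq1 k).2.2.2
      · exact (hq2 k j hlt).2
    rw [abs_lt] at ha hb
    change θ - 2 * ε ≤ _
    linarith
  have hup : ∀ k, ∃ N, ∀ i, N ≤ i → (q i).2 (y k) ≤ ε := by
    intro k
    have hset : Convex ℝ {v : E | ∃ N, ∀ i, N ≤ i → (q i).2 v ≤ ε} := by
      rintro a ⟨N, hN⟩ b ⟨M, hM⟩ s t hs ht hst
      refine ⟨max N M, fun i hi => ?_⟩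
      have ha := mul_le_mul_of_nonneg_left (hN i ((le_max_left _ _).trans hi)) hs
      have hb := mul_le_mul_of_nonneg_left (hM i ((le_max_right _ _).trans hi)) ht
      rw [map_add, map_smul, map_smul, smul_eq_mul, smul_eq_mul]
      calc _ ≤ s * ε + t * ε := add_le_add ha hb
        _ = ε := by rw [← add_mul, hst, one_mul]
    refine tailHull_subset hset (fun j _ => ⟨j + 1, fun i hi => ?_⟩) (hy k)
    exact ((le_abs_self _).trans_lt (hq2 j i hi).1).le
  have hψpos : 0 < ‖ψ‖ + 1 := by positivity
  obtain ⟨N, hN⟩ := Metric.cauchySeq_iff.1 hz.cauchySeq (ε / (‖ψ‖ + 1)) (by positivity)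
  obtain ⟨M, hM⟩ := hup N
  set l := max N M
  have a1 := hlow l
  have a2 := hM l (le_max_right _ _)
  have a3 := hN l (le_max_left _ _) N le_rfl
  have a4 : (q l).2 (y l) - (q l).2 (y N) ≤ ‖ψ‖ * (ε / (‖ψ‖ + 1)) := by
    rw [← map_sub]
    refine (le_abs_self _).trans (((q l).2.le_opNorm _).trans ?_)
    rw [← dist_eq_norm]
    exact mul_le_mul (hq1 l).2.1 a3.le dist_nonneg (norm_nonneg _)
  have a5 : ‖ψ‖ * (ε / (‖ψ‖ + 1)) ≤ ε := by
    rw [← mul_div_assoc, div_le_iff₀ hψpos]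
    nlinarith [norm_nonneg ψ]
  have a6 : ε * 8 = θ := by rw [hε]; ring
  linarith

theorem HasTailLimits.prod (hE : HasTailLimits E) (hF : HasTailLimits F) :
    HasTailLimits (E × F) := by
  rintro x ⟨K, hK⟩
  obtain ⟨y, hy, a, ha⟩ := hE.exists_lift (LinearMap.fst ℝ E F) x
    ⟨K, fun j => (norm_fst_le _).trans (hK j)⟩
  obtain ⟨z, hz, b, hb⟩ := hF.exists_lift (LinearMap.snd ℝ E F) y
    ⟨K, fun j => (norm_snd_le _).trans (norm_le_of_mem_tailHull (fun j _ => hK j) (hy j))⟩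
  refine ⟨z, fun k => tailHull_trans hy k (hz k), (a, b), ?_⟩
  have h1 : Tendsto (fun k => (z k).1) atTop (𝓝 a) := by
    refine tendsto_of_mem_tailHull ha fun k => ?_
    have := mem_image_of_mem (LinearMap.fst ℝ E F) (hz k)
    rwa [image_tailHull] at this
  exact h1.prodMk_nhds hb

/-- It suffices to find tail limits for sequences in a dense subspace. -/
theorem HasTailLimits.of_denseRange {E₀ : Type*} [AddCommGroup E₀] [Module ℝ E₀]
    (ι : E₀ →ₗ[ℝ] E) (hι : DenseRange ι)
    (h : ∀ x : ℕ → E₀, (∃ K, ∀ j, ‖ι (x j)‖ ≤ K) →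
      ∃ y : ℕ → E₀, (∀ k, y k ∈ tailHull x k) ∧ ∃ z, Tendsto (fun k => ι (y k)) atTop (𝓝 z)) :
    HasTailLimits E := by
  rintro x ⟨K, hK⟩
  have hap : ∀ j : ℕ, ∃ x' : E₀, ‖x j - ι x'‖ < 1 / ((j : ℝ) + 1) := fun j => by
    obtain ⟨x', hx'⟩ := hι.exists_dist_lt (x j) (ε := 1 / ((j : ℝ) + 1)) (by positivity)
    exact ⟨x', by rwa [dist_eq_norm] at hx'⟩
  choose x' hx' using hap
  obtain ⟨y, hy, z, hz⟩ := h x' ⟨K + 1, fun j => by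
    have h1 : 1 / ((j : ℝ) + 1) ≤ 1 := by
      rw [div_le_one (by positivity)]
      linarith [(Nat.cast_nonneg j : (0 : ℝ) ≤ j)]
    have h2 := norm_le_norm_add_norm_sub (x j) (ι (x' j))
    linarith [hx' j, hK j]⟩
  have : ∀ k, ∃ v : E × E₀, v ∈ tailHull (fun j => (x j, x' j)) k ∧ v.2 = y k := fun k => by
    have h1 := hy k
    have h2 := image_tailHull (LinearMap.snd ℝ E E₀) (fun j => (x j, x' j)) k
    simp only [LinearMap.snd_apply] at h2
    rw [← h2] at h1
    exact h1
  choose v hv hvy using this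
  refine ⟨fun k => (v k).1, fun k => ?_, z, ?_⟩
  · have h1 := mem_image_of_mem (LinearMap.fst ℝ E E₀) (hv k)
    rw [image_tailHull] at h1
    exact h1
  · have hd : ∀ k, ‖(v k).1 - ι (y k)‖ ≤ 1 / ((k : ℝ) + 1) := by
      intro k
      have hset : Convex ℝ {w : E × E₀ | ‖w.1 - ι w.2‖ ≤ 1 / ((k : ℝ) + 1)} := by
        have := (convex_closedBall (0 : E) (1 / ((k : ℝ) + 1))).linear_preimage
          (LinearMap.fst ℝ E E₀ - ι.comp (LinearMap.snd ℝ E E₀))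
        refine cast ?_ this
        congr 1
        ext w
        simp
      have := tailHull_subset hset (fun j hj => (hx' j).le.trans ?_) (hv k)
      · rw [← hvy]; exact this
      · gcongr
    have h0 : Tendsto (fun k => (v k).1 - ι (y k)) atTop (𝓝 0) :=
      squeeze_zero_norm hd tendsto_one_div_add_atTop_nhds_zero_nat
    simpa using h0.add hz

/-- Uniform convexity, in the form of a bound for `‖a - b‖ ^ q` by the midpoint deficit of
`‖·‖ ^ q`, yields tail limits: elements of the tail hulls of almost minimal norm form a Cauchy
sequence. -/
theorem HasTailLimits.of_midpoint_deficit [CompleteSpace E] {q : ℝ} (hq : 0 < q)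
    (h : ∀ ε > 0, ∃ C : ℝ, 0 ≤ C ∧ ∀ a b : E, ‖a - b‖ ^ q ≤ ε * (‖a‖ ^ q + ‖b‖ ^ q) +
      C * ((‖a‖ ^ q + ‖b‖ ^ q) / 2 - ‖(1 / 2 : ℝ) • (a + b)‖ ^ q)) : HasTailLimits E := by
  rintro x ⟨K, hK⟩
  have hK0 : 0 ≤ K := (norm_nonneg _).trans (hK 0)
  set d : ℕ → ℝ := fun k => sInf ((fun v => ‖v‖ ^ q) '' tailHull x k) with hd
  have hbdd : ∀ k, BddBelow ((fun v => ‖v‖ ^ q) '' tailHull x k) := fun k =>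
    ⟨0, by rintro _ ⟨v, -, rfl⟩; positivity⟩
  have hne : ∀ k, ((fun v => ‖v‖ ^ q) '' tailHull x k).Nonempty := fun k =>
    ⟨_, mem_image_of_mem _ (mem_tailHull_of_le x le_rfl)⟩
  have hdle : ∀ k, ∀ v ∈ tailHull x k, d k ≤ ‖v‖ ^ q := fun k v hv =>
    csInf_le (hbdd k) (mem_image_of_mem _ hv)
  have hmono : Monotone d := fun k l hkl =>
    csInf_le_csInf (hbdd k) (hne l) (image_mono (tailHull_anti x hkl))
  have hdK : ∀ k, d k ≤ K ^ q := fun k =>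
    (hdle k _ (mem_tailHull_of_le x le_rfl)).trans (Real.rpow_le_rpow (norm_nonneg _) (hK k) hq.le)
  set D := ⨆ k, d k with hD
  have hdD : Tendsto d atTop (𝓝 D) := tendsto_atTop_ciSup hmono ⟨_, by rintro _ ⟨k, rfl⟩; exact hdK k⟩
  have hdD' : ∀ k, d k ≤ D := hmono.ge_of_tendsto hdD
  have hex : ∀ k : ℕ, ∃ v ∈ tailHull x k, ‖v‖ ^ q < d k + 1 / ((k : ℝ) + 1) := by
    intro k
    obtain ⟨_, ⟨v, hv, rfl⟩, hlt⟩ := exists_lt_of_csInf_lt (hne k)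
      (lt_add_of_pos_right (d k) (by positivity : (0 : ℝ) < 1 / ((k : ℝ) + 1)))
    exact ⟨v, hv, hlt⟩
  choose y hy hyd using hex
  have hyK : ∀ k, ‖y k‖ ^ q ≤ K ^ q := fun k =>
    Real.rpow_le_rpow (norm_nonneg _) (norm_le_of_mem_tailHull (fun j _ => hK j) (hy k)) hq.le
  refine ⟨y, hy, cauchySeq_tendsto_of_complete ?_⟩
  rw [Metric.cauchySeq_iff']
  intro η hη
  have hηq : 0 < η ^ q := by positivity
  have hKq : 0 ≤ K ^ q := by positivity
  obtain ⟨C, hC0, hC⟩ := h (η ^ q / (4 * (K ^ q + 1))) (by positivity)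
  have hlim : Tendsto (fun k : ℕ => C * (D + 1 / ((k : ℝ) + 1) - d k)) atTop (𝓝 0) := by
    have := ((tendsto_const_nhds (x := D)).add tendsto_one_div_add_atTop_nhds_zero_nat).sub hdD
    simpa using this.const_mul C
  obtain ⟨N, hN⟩ := (hlim.eventually (gt_mem_nhds (half_pos hηq))).exists
  refine ⟨N, fun l hl => ?_⟩
  have hmid : d N ≤ ‖(1 / 2 : ℝ) • (y l + y N)‖ ^ q := by
    refine hdle N _ ?_
    rw [smul_add]
    exact convex_tailHull x N (tailHull_anti x hl (hy l)) (hy N) (by norm_num) (by norm_num)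
      (by norm_num)
  have h1 := hC (y l) (y N)
  have h2 : ‖y l‖ ^ q ≤ D + 1 / ((N : ℝ) + 1) := by
    have h3 : 1 / ((l : ℝ) + 1) ≤ 1 / ((N : ℝ) + 1) := by gcongr
    linarith [hyd l, hdD' l]
  have h3 : ‖y N‖ ^ q ≤ D + 1 / ((N : ℝ) + 1) := by linarith [hyd N, hdD' N]
  have h4 : C * ((‖y l‖ ^ q + ‖y N‖ ^ q) / 2 - ‖(1 / 2 : ℝ) • (y l + y N)‖ ^ q) ≤
      C * (D + 1 / ((N : ℝ) + 1) - d N) := by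
    refine mul_le_mul_of_nonneg_left ?_ hC0
    linarith
  have h5 : η ^ q / (4 * (K ^ q + 1)) * (‖y l‖ ^ q + ‖y N‖ ^ q) < η ^ q / 2 := by
    have : ‖y l‖ ^ q + ‖y N‖ ^ q < 2 * (K ^ q + 1) := by linarith [hyK l, hyK N]
    calc _ < η ^ q / (4 * (K ^ q + 1)) * (2 * (K ^ q + 1)) := by gcongr
      _ = η ^ q / 2 := by field_simp; ring
  rw [dist_eq_norm]
  refine lt_of_not_ge fun hge => ?_
  have := Real.rpow_le_rpow hη.le hge hq.le
  linarith

end HasTailLimits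

/-! ### Tail limits in `L^p`, `1 < p < ∞` -/

section LpTailLimits

variable {F : Type*} [NormedAddCommGroup F] [InnerProductSpace ℝ F]

theorem norm_half_smul_add_rpow_lt {q : ℝ} (hq : 1 < q) {a b : F} (hab : a ≠ b) :
    ‖(1 / 2 : ℝ) • (a + b)‖ ^ q < (‖a‖ ^ q + ‖b‖ ^ q) / 2 := by
  have hn : ‖(1 / 2 : ℝ) • (a + b)‖ ≤ (1 / 2 : ℝ) * ‖a‖ + (1 / 2 : ℝ) * ‖b‖ := by
    rw [norm_smul, Real.norm_of_nonneg (by norm_num), ← mul_add]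
    gcongr
    exact norm_add_le a b
  by_cases h : ‖a‖ = ‖b‖
  · have h1 : ‖(1 / 2 : ℝ) • a + (1 / 2 : ℝ) • b‖ < ‖a‖ :=
      norm_combo_lt_of_ne le_rfl h.ge hab (by norm_num) (by norm_num) (by norm_num)
    rw [← h, smul_add]
    calc _ < ‖a‖ ^ q := Real.rpow_lt_rpow (norm_nonneg _) h1 (by linarith)
      _ = _ := by ring
  · have h1 := (strictConvexOn_rpow hq).2 (norm_nonneg a) (norm_nonneg b) h
      (by norm_num : (0 : ℝ) < 1 / 2) (by norm_num : (0 : ℝ) < 1 / 2) (by norm_num)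
    simp only [smul_eq_mul] at h1
    calc _ ≤ ((1 / 2 : ℝ) * ‖a‖ + (1 / 2 : ℝ) * ‖b‖) ^ q :=
          Real.rpow_le_rpow (norm_nonneg _) hn (by linarith)
      _ < _ := h1
      _ = _ := by ring

/-- Homogeneous uniform convexity of `‖·‖ ^ q` on a finite-dimensional inner product space. By
homogeneity it suffices to consider the compact unit sphere of `F × F`. -/
theorem exists_norm_sub_rpow_le [FiniteDimensional ℝ F] {q : ℝ} (hq : 1 < q) {ε : ℝ} (hε : 0 < ε) :
    ∃ C : ℝ, 0 ≤ C ∧ ∀ a b : F, ‖a - b‖ ^ q ≤ ε * (‖a‖ ^ q + ‖b‖ ^ q) +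
      C * ((‖a‖ ^ q + ‖b‖ ^ q) / 2 - ‖(1 / 2 : ℝ) • (a + b)‖ ^ q) := by
  have hq0 : 0 < q := by linarith
  set Δ : F × F → ℝ := fun v => (‖v.1‖ ^ q + ‖v.2‖ ^ q) / 2 - ‖(1 / 2 : ℝ) • (v.1 + v.2)‖ ^ q with hΔ
  have hΔ0 : ∀ v, 0 ≤ Δ v := by
    intro v
    by_cases h : v.1 = v.2
    · have : (1 / 2 : ℝ) • (v.1 + v.2) = v.1 := by rw [← h, smul_add, ← add_smul]; norm_num
      simp only [hΔ, this]
      rw [← h]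
      linarith
    · exact sub_nonneg.2 (norm_half_smul_add_rpow_lt hq h).le
  have hΔc : Continuous Δ := by
    have h1 : ∀ f : F × F → F, Continuous f → Continuous fun v => ‖f v‖ ^ q := fun f hf =>
      hf.norm.rpow_const fun _ => Or.inr hq0.le
    exact (((h1 _ continuous_fst).add (h1 _ continuous_snd)).div_const 2).sub
      (h1 _ ((continuous_fst.add continuous_snd).const_smul _))
  set S : Set (F × F) := Metric.sphere 0 1 ∩
    {v | ε * (‖v.1‖ ^ q + ‖v.2‖ ^ q) ≤ ‖v.1 - v.2‖ ^ q} with hS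
  have hSc : IsCompact S := by
    refine (isCompact_sphere _ _).inter_right (isClosed_le ?_ ?_)
    · exact ((continuous_fst.norm.rpow_const fun _ => Or.inr hq0.le).add
        (continuous_snd.norm.rpow_const fun _ => Or.inr hq0.le)).const_mul ε
    · exact (continuous_fst.sub continuous_snd).norm.rpow_const fun _ => Or.inr hq0.le
  obtain ⟨m, hm, hmS⟩ : ∃ m : ℝ, 0 < m ∧ ∀ v ∈ S, m ≤ Δ v := by
    rcases S.eq_empty_or_nonempty with h | h
    · exact ⟨1, one_pos, by simp [h]⟩
    · obtain ⟨v, hv, hvm⟩ := hSc.exists_isMinOn h hΔc.continuousOn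
      refine ⟨Δ v, ?_, fun w hw => hvm hw⟩
      refine sub_pos.2 (norm_half_smul_add_rpow_lt hq fun heq => ?_)
      have h1 := hv.2
      simp only [mem_ofPred_eq] at h1
      rw [← heq, sub_self, norm_zero, Real.zero_rpow hq0.ne'] at h1
      have h2 : v.1 ≠ 0 := by
        intro h0
        have h3 : v = 0 := Prod.ext h0 (by rw [← heq]; exact h0)
        have h4 := hv.1
        rw [h3] at h4
        simp at h4
      have h3 : 0 < ‖v.1‖ ^ q := Real.rpow_pos_of_pos (norm_pos_iff.2 h2) q
      nlinarith
  have hdiff : ∀ a b : F, ‖a - b‖ ≤ 2 * ‖(a, b)‖ := fun a b => by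
    have h1 := norm_sub_le a b
    have h2 := norm_fst_le (a, b)
    have h3 := norm_snd_le (a, b)
    simp only at h2 h3
    linarith
  refine ⟨2 ^ q / m, by positivity, fun a b => ?_⟩
  have hnn : 0 ≤ ε * (‖a‖ ^ q + ‖b‖ ^ q) := by positivity
  have hCn : 0 ≤ 2 ^ q / m * Δ (a, b) := mul_nonneg (by positivity) (hΔ0 _)
  by_cases hsmall : ‖a - b‖ ^ q ≤ ε * (‖a‖ ^ q + ‖b‖ ^ q)
  · exact hsmall.trans (le_add_of_nonneg_right hCn)
  · refine le_add_of_nonneg_of_le hnn ?_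
    change _ ≤ 2 ^ q / m * Δ (a, b)
    have hab : (a, b) ≠ 0 := by
      intro h0
      rw [Prod.mk_eq_zero] at h0
      rw [h0.1, h0.2] at hsmall
      apply hsmall
      simp [Real.zero_rpow hq0.ne']
    set t := ‖(a, b)‖ with ht
    have ht0 : 0 < t := norm_pos_iff.2 hab
    have hsc : ∀ v : F, ‖t⁻¹ • v‖ ^ q = (t⁻¹) ^ q * ‖v‖ ^ q := fun v => by
      rw [norm_smul, Real.norm_of_nonneg (by positivity), Real.mul_rpow (by positivity)
        (norm_nonneg _)]
    have hs : ((t⁻¹ • a, t⁻¹ • b) : F × F) ∈ S := by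
      refine ⟨?_, ?_⟩
      · rw [← Prod.smul_mk, mem_sphere_zero_iff_norm, norm_smul, Real.norm_of_nonneg (by positivity)]
        exact inv_mul_cancel₀ ht0.ne'
      · simp only [mem_ofPred_eq]
        rw [← smul_sub, hsc, hsc, hsc, ← mul_add, mul_left_comm]
        exact mul_le_mul_of_nonneg_left (not_le.1 hsmall).le (by positivity)
    have h1 : m ≤ (t⁻¹) ^ q * Δ (a, b) := by
      refine (hmS _ hs).trans (le_of_eq ?_)
      simp only [hΔ]
      rw [← smul_add, smul_comm, hsc, hsc, hsc]
      ring
    have h2 : m * t ^ q ≤ Δ (a, b) := by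
      rw [Real.inv_rpow ht0.le, inv_mul_eq_div, le_div_iff₀ (by positivity)] at h1
      exact h1
    calc ‖a - b‖ ^ q ≤ (2 * t) ^ q := Real.rpow_le_rpow (norm_nonneg _) (hdiff a b) hq0.le
      _ = 2 ^ q / m * (m * t ^ q) := by
        rw [Real.mul_rpow (by norm_num) ht0.le]; field_simp
      _ ≤ _ := by gcongr

variable {X : Type*} [MeasurableSpace X] {μ : Measure X} {p : ℝ≥0∞}

theorem integrable_norm_rpow_coeFn {G : Type*} [NormedAddCommGroup G] (hp1 : 1 < p) (hp : p < ∞)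
    (f : Lp G p μ) :
    Integrable (fun x => ‖f x‖ ^ p.toReal) μ :=
  (Lp.memLp f).integrable_norm_rpow (by positivity) hp.ne

theorem Lp_norm_rpow_eq_integral {G : Type*} [NormedAddCommGroup G] (hp1 : 1 < p) (hp : p < ∞)
    (f : Lp G p μ) :
    ‖f‖ ^ p.toReal = ∫ x, ‖f x‖ ^ p.toReal ∂μ := by
  have h0 : p ≠ 0 := by positivity
  have ht : 0 < p.toReal := ENNReal.toReal_pos h0 hp.ne
  rw [Lp.norm_def, (Lp.memLp f).eLpNorm_eq_integral_rpow_norm h0 hp.ne,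
    ENNReal.toReal_ofReal (by positivity), ← Real.rpow_mul (by positivity),
    inv_mul_cancel₀ ht.ne', Real.rpow_one]

theorem Lp_hasTailLimits [FiniteDimensional ℝ F] [Fact (1 ≤ p)] (hp1 : 1 < p) (hp : p < ∞) :
    HasTailLimits (Lp F p μ) := by
  have hq : 1 < p.toReal := by
    rw [← ENNReal.toReal_one]
    exact (ENNReal.toReal_lt_toReal ENNReal.one_ne_top hp.ne).2 hp1
  have : CompleteSpace F := FiniteDimensional.complete ℝ F
  refine HasTailLimits.of_midpoint_deficit (q := p.toReal) (by linarith) fun ε hε => ?_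
  obtain ⟨C, hC0, hC⟩ := exists_norm_sub_rpow_le (F := F) hq hε
  refine ⟨C, hC0, fun f g => ?_⟩
  simp only [Lp_norm_rpow_eq_integral hp1 hp]
  have i1 := integrable_norm_rpow_coeFn hp1 hp f
  have i2 := integrable_norm_rpow_coeFn hp1 hp g
  have i3 := integrable_norm_rpow_coeFn hp1 hp ((1 / 2 : ℝ) • (f + g))
  have i4 := integrable_norm_rpow_coeFn hp1 hp (f - g)
  rw [← integral_add i1 i2, ← integral_const_mul, ← integral_div, ← integral_sub _ i3,
    ← integral_const_mul, ← integral_add]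
  · refine integral_mono_ae i4 ?_ ?_
    · exact ((i1.add i2).const_mul ε).add ((((i1.add i2).div_const 2).sub i3).const_mul C)
    · filter_upwards [Lp.coeFn_sub f g, Lp.coeFn_smul (1 / 2 : ℝ) (f + g), Lp.coeFn_add f g]
        with x h1 h2 h3
      rw [h1, h2, Pi.smul_apply, h3]
      exact hC (f x) (g x)
  · exact (i1.add i2).const_mul ε
  · exact (((i1.add i2).div_const 2).sub i3).const_mul C
  · exact (i1.add i2).div_const 2

end LpTailLimits

/-! ### The space `H^{1,p}` -/

section Sobolev

variable {X : Type*} [MetricSpace X] [TopologicalSpace.SeparableSpace X]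
  [MeasurableSpace X] [BorelSpace X] {μ : Measure X} {ι : Type*} [Countable ι]

/-- `f ↦ (f, Df)` as a linear map from `H̃^{1,p}(X)` to `L^p(X) × L^p(X; ℝᴺ)`. -/
noncomputable def DiffAtlas.toLpProd (A : DiffAtlas μ ι) (p : ℝ≥0∞) :
    A.PreSobolev p →ₗ[ℝ] Lp ℝ p μ × Lp (EuclideanSpace ℝ (Fin A.N)) p μ where
  toFun f := (f.2.memLp.toLp f.1, f.2.memLp_diff.toLp (A.globalDiff f.1))
  map_add' f g := by
    refine Prod.ext (MemLp.toLp_add f.2.memLp g.2.memLp) ?_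
    rw [Prod.snd_add, ← MemLp.toLp_add f.2.memLp_diff g.2.memLp_diff]
    exact MemLp.toLp_congr (f + g).2.memLp_diff _ (A.globalDiff_add f.2 g.2)
  map_smul' c f := by
    refine Prod.ext (MemLp.toLp_const_smul c f.2.memLp) ?_
    rw [RingHom.id_apply, Prod.smul_snd, ← MemLp.toLp_const_smul c f.2.memLp_diff]
    exact MemLp.toLp_congr (c • f).2.memLp_diff _ (A.globalDiff_smul c f.2.locallyLipschitz)

theorem DiffAtlas.norm_eq_toLpProd (A : DiffAtlas μ ι) {p : ℝ≥0∞} [Fact (1 ≤ p)]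
    (f : A.PreSobolev p) : ‖f‖ = ‖(A.toLpProd p f).1‖ + ‖(A.toLpProd p f).2‖ := by
  change (eLpNorm f.1 p μ).toReal + (eLpNorm (A.globalDiff f.1) p μ).toReal = _
  simp [DiffAtlas.toLpProd, Lp.norm_toLp]

theorem DiffAtlas.sobolev_hasTailLimits (A : DiffAtlas μ ι) {p : ℝ≥0∞} [Fact (1 ≤ p)]
    (hp1 : 1 < p) (hp : p < ∞) : HasTailLimits (A.Sobolev p) := by
  refine HasTailLimits.of_denseRange (E₀ := A.PreSobolev p)
    (UniformSpace.Completion.toComplL : A.PreSobolev p →L[ℝ] A.Sobolev p).toLinearMap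
    UniformSpace.Completion.denseRange_coe ?_
  rintro x ⟨K, hK⟩
  have hcoe : ∀ f : A.PreSobolev p,
      (UniformSpace.Completion.toComplL : A.PreSobolev p →L[ℝ] A.Sobolev p).toLinearMap f =
        (f : A.Sobolev p) := fun _ => rfl
  simp only [hcoe, UniformSpace.Completion.norm_coe] at hK ⊢
  have hP := (Lp_hasTailLimits (F := ℝ) (μ := μ) hp1 hp).prod
    (Lp_hasTailLimits (F := EuclideanSpace ℝ (Fin A.N)) (μ := μ) hp1 hp)
  obtain ⟨y, hy, z, hz⟩ := hP.exists_lift (A.toLpProd p) x ⟨K, fun j => by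
    refine le_trans ?_ (hK j)
    rw [A.norm_eq_toLpProd, Prod.norm_def]
    exact max_le (le_add_of_nonneg_right (norm_nonneg _)) (le_add_of_nonneg_left (norm_nonneg _))⟩
  refine ⟨y, hy, cauchySeq_tendsto_of_complete ?_⟩
  rw [Metric.cauchySeq_iff]
  intro ε hε
  obtain ⟨N, hN⟩ := Metric.cauchySeq_iff.1 hz.cauchySeq (ε / 2) (half_pos hε)
  refine ⟨N, fun m hm n hn => ?_⟩
  have h := hN m hm n hn
  rw [UniformSpace.Completion.dist_eq, dist_eq_norm, A.norm_eq_toLpProd, map_sub]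
  rw [dist_eq_norm, Prod.norm_def, max_lt_iff] at h
  linarith [h.1, h.2]

end Sobolev

/-! ### Difference quotients and pointwise Lipschitz constants -/

section LipAt

variable {X : Type*} [MetricSpace X]

/-- The difference quotient `|f y - f x| / d(y, x)`, with value `0` if `y = x`. -/
noncomputable def diffQuot (f : X → ℝ) (x y : X) : ℝ≥0∞ :=
  ENNReal.ofReal (|f y - f x| / dist y x)

/-- The supremum of the difference quotients of `f` at `x` at distances less than `r`. -/
noncomputable def lipScale (f : X → ℝ) (r : ℝ) (x : X) : ℝ≥0∞ :=
  ⨆ y ∈ Metric.ball x r, diffQuot f x y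

/-- The limit of `lipScale f r x` as `r → 0`, that is `limsup |f y - f x| / d(y, x)` as `y → x`. -/
noncomputable def lipAt (f : X → ℝ) (x : X) : ℝ≥0∞ :=
  ⨅ n : ℕ, lipScale f (1 / ((n : ℝ) + 1)) x

variable {f g : X → ℝ} {x y : X} {r : ℝ}

theorem diffQuot_comm (f : X → ℝ) (x y : X) : diffQuot f x y = diffQuot f y x := by
  rw [diffQuot, diffQuot, abs_sub_comm, dist_comm]

@[simp] theorem diffQuot_self (f : X → ℝ) (x : X) : diffQuot f x x = 0 := by simp [diffQuot]

theorem diffQuot_le_ofReal {c : ℝ} (h : |f y - f x| ≤ c * dist y x) :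
    diffQuot f x y ≤ ENNReal.ofReal c := by
  rcases eq_or_ne y x with rfl | hxy
  · simp
  · exact ENNReal.ofReal_le_ofReal ((div_le_iff₀ (dist_pos.2 hxy)).2 h)

theorem abs_sub_le_of_diffQuot_le {c : ℝ} (hc : 0 ≤ c) (h : diffQuot f x y ≤ ENNReal.ofReal c) :
    |f y - f x| ≤ c * dist y x := by
  rcases eq_or_ne y x with rfl | hxy
  · simp
  · exact (div_le_iff₀ (dist_pos.2 hxy)).1 ((ENNReal.ofReal_le_ofReal_iff hc).1 h)

theorem diffQuot_add_le (f g : X → ℝ) (x y : X) :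
    diffQuot (f + g) x y ≤ diffQuot f x y + diffQuot g x y := by
  rw [diffQuot, diffQuot, diffQuot, ← ENNReal.ofReal_add (by positivity) (by positivity), ← add_div]
  refine ENNReal.ofReal_le_ofReal ?_
  gcongr
  calc |(f + g) y - (f + g) x| = |(f y - f x) + (g y - g x)| := by
        simp only [Pi.add_apply]; ring_nf
    _ ≤ _ := abs_add_le _ _

theorem diffQuot_smul (c : ℝ) (f : X → ℝ) (x y : X) :
    diffQuot (c • f) x y = ENNReal.ofReal |c| * diffQuot f x y := by
  rw [diffQuot, diffQuot, ← ENNReal.ofReal_mul (abs_nonneg c)]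
  simp only [Pi.smul_apply, smul_eq_mul]
  rw [← mul_sub, abs_mul, mul_div_assoc]

theorem diffQuot_neg (f : X → ℝ) (x y : X) : diffQuot (-f) x y = diffQuot f x y := by
  simp only [diffQuot, Pi.neg_apply]
  rw [← neg_sub', abs_neg]

theorem diffQuot_le_lipScale (f : X → ℝ) (h : dist y x < r) : diffQuot f x y ≤ lipScale f r x :=
  le_iSup₂ (f := fun y (_ : y ∈ Metric.ball x r) => diffQuot f x y) y h

theorem lipScale_le {c : ℝ≥0∞} (h : ∀ y, dist y x < r → diffQuot f x y ≤ c) :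
    lipScale f r x ≤ c := iSup₂_le h

theorem lipScale_mono (f : X → ℝ) (x : X) {r s : ℝ} (h : r ≤ s) : lipScale f r x ≤ lipScale f s x :=
  lipScale_le fun _ hy => diffQuot_le_lipScale f (hy.trans_le h)

theorem lipScale_add_le (f g : X → ℝ) (r : ℝ) (x : X) :
    lipScale (f + g) r x ≤ lipScale f r x + lipScale g r x :=
  lipScale_le fun _ hy => (diffQuot_add_le f g x _).trans
    (add_le_add (diffQuot_le_lipScale f hy) (diffQuot_le_lipScale g hy))

theorem lipAt_le_lipScale (f : X → ℝ) (x : X) (hr : 0 < r) : lipAt f x ≤ lipScale f r x := by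
  obtain ⟨n, hn⟩ := exists_nat_one_div_lt hr
  exact (iInf_le _ n).trans (lipScale_mono f x hn.le)

theorem tendsto_lipScale (f : X → ℝ) (x : X) :
    Tendsto (fun n : ℕ => lipScale f (1 / ((n : ℝ) + 1)) x) atTop (𝓝 (lipAt f x)) :=
  tendsto_atTop_iInf fun m n h => lipScale_mono f x (by gcongr)

theorem le_lipAt {c : ℝ≥0∞} (h : ∀ r > 0, c ≤ lipScale f r x) : c ≤ lipAt f x :=
  le_iInf fun _ => h _ (by positivity)

theorem lipAt_add_le (f g : X → ℝ) (x : X) : lipAt (f + g) x ≤ lipAt f x + lipAt g x :=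
  le_of_tendsto_of_tendsto' (tendsto_lipScale (f + g) x)
    ((tendsto_lipScale f x).add (tendsto_lipScale g x)) fun _ => lipScale_add_le f g _ x

theorem lipScale_smul (c : ℝ) (f : X → ℝ) (r : ℝ) (x : X) :
    lipScale (c • f) r x = ENNReal.ofReal |c| * lipScale f r x := by
  simp only [lipScale, ENNReal.mul_iSup, diffQuot_smul]

theorem lipAt_smul (c : ℝ) (f : X → ℝ) (x : X) :
    lipAt (c • f) x = ENNReal.ofReal |c| * lipAt f x := by
  refine tendsto_nhds_unique (tendsto_lipScale (c • f) x) ?_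
  simp only [lipScale_smul]
  exact ENNReal.Tendsto.const_mul (tendsto_lipScale f x) (Or.inr ENNReal.ofReal_ne_top)

theorem lipScale_neg (f : X → ℝ) (r : ℝ) (x : X) : lipScale (-f) r x = lipScale f r x := by
  simp only [lipScale, diffQuot_neg]

theorem lipAt_neg (f : X → ℝ) (x : X) : lipAt (-f) x = lipAt f x := by
  simp only [lipAt, lipScale_neg]

theorem lipAt_sub_comm (f g : X → ℝ) (x : X) : lipAt (f - g) x = lipAt (g - f) x := by
  rw [← neg_sub, lipAt_neg]

theorem lipAt_sub_le (f g : X → ℝ) (x : X) : lipAt (f - g) x ≤ lipAt f x + lipAt g x := by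
  rw [sub_eq_add_neg, ← lipAt_neg g]
  exact lipAt_add_le _ _ _

theorem lipAt_sub_le_add (f g h : X → ℝ) (x : X) :
    lipAt (f - h) x ≤ lipAt (f - g) x + lipAt (g - h) x := by
  rw [← sub_add_sub_cancel f g h]
  exact lipAt_add_le _ _ _

@[simp] theorem lipAt_zero (x : X) : lipAt (0 : X → ℝ) x = 0 := by
  have := lipAt_smul 0 (0 : X → ℝ) x
  simpa using this

theorem convex_setOf_lipAt_sub_le (g : X → ℝ) (x : X) (c : ℝ≥0∞) :
    Convex ℝ {f : X → ℝ | lipAt (f - g) x ≤ c} := by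
  intro f hf h hh a b ha hb hab
  have e : a • f + b • h - g = a • (f - g) + b • (h - g) := by
    rw [smul_sub, smul_sub, sub_add_sub_comm, ← add_smul, hab, one_smul]
  rw [mem_ofPred_eq] at hf hh ⊢
  rw [e]
  refine (lipAt_add_le _ _ _).trans ?_
  rw [lipAt_smul, lipAt_smul, abs_of_nonneg ha, abs_of_nonneg hb]
  calc _ ≤ ENNReal.ofReal a * c + ENNReal.ofReal b * c := by gcongr
    _ = c := by rw [← add_mul, ← ENNReal.ofReal_add ha hb, hab, ENNReal.ofReal_one, one_mul]

theorem lipScale_le_of_lipschitzWith {K : ℝ≥0} (hf : LipschitzWith K f) (r : ℝ) (x : X) :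
    lipScale f r x ≤ K := by
  refine lipScale_le fun y _ => ?_
  rw [← ENNReal.ofReal_coe_nnreal]
  refine diffQuot_le_ofReal ?_
  rw [← Real.dist_eq]
  exact hf.dist_le_mul y x

theorem lipAt_le_of_lipschitzWith {K : ℝ≥0} (hf : LipschitzWith K f) (x : X) : lipAt f x ≤ K :=
  (lipAt_le_lipScale f x one_pos).trans (lipScale_le_of_lipschitzWith hf 1 x)

theorem exists_forall_abs_sub_le_of_lipAt_lt {c : ℝ} (h : lipAt f x < ENNReal.ofReal c) :
    ∃ r > 0, ∀ y, dist y x < r → |f y - f x| ≤ c * dist y x := by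
  have hc : 0 < c := ENNReal.ofReal_pos.1 ((zero_le).trans_lt h)
  obtain ⟨n, hn⟩ := iInf_lt_iff.1 h
  exact ⟨_, by positivity, fun y hy => abs_sub_le_of_diffQuot_le hc.le
    ((diffQuot_le_lipScale f hy).trans hn.le)⟩

theorem lipAt_le_of_forall_abs_sub_le {c : ℝ} (hr : 0 < r)
    (h : ∀ y, dist y x < r → |f y - f x| ≤ c * dist y x) : lipAt f x ≤ ENNReal.ofReal c :=
  (lipAt_le_lipScale f x hr).trans (lipScale_le fun y hy => diffQuot_le_ofReal (h y hy))

theorem ptLip_eq_zero_iff_lipAt_eq_zero : ptLip f x = 0 ↔ lipAt f x = 0 := by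
  rw [ptLip_eq_zero_iff]
  constructor
  · intro h
    refine le_antisymm (ENNReal.le_of_forall_pos_le_add fun ε hε _ => ?_) (zero_le)
    rw [zero_add]
    have h1 := h.eventually (gt_mem_nhds (ENNReal.coe_pos.2 hε))
    obtain ⟨δ, hδ, hb⟩ := mem_nhdsGT_iff_exists_Ioo_subset.1 h1
    refine (lipAt_le_lipScale f x hδ).trans (lipScale_le fun y hy => ?_)
    rcases eq_or_ne y x with rfl | hxy
    · simp
    have h2 : (⨆ z ∈ Metric.closedBall x (dist y x), ENNReal.ofReal (|f z - f x| / dist y x)) < ε :=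
      hb ⟨dist_pos.2 hxy, hy⟩
    exact (le_iSup₂ (f := fun z (_ : z ∈ Metric.closedBall x (dist y x)) =>
      ENNReal.ofReal (|f z - f x| / dist y x)) y (Metric.mem_closedBall.2 le_rfl)).trans h2.le
  · intro h
    rw [ENNReal.tendsto_nhds_zero]
    intro ε hε
    rw [← h] at hε
    obtain ⟨n, hn⟩ := iInf_lt_iff.1 hε
    filter_upwards [Ioo_mem_nhdsGT (by positivity : (0 : ℝ) < 1 / ((n : ℝ) + 1))] with r hr
    refine iSup₂_le fun y hy => ?_
    refine le_trans ?_ ((diffQuot_le_lipScale f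
      ((Metric.mem_closedBall.1 hy).trans_lt hr.2)).trans hn.le)
    rcases eq_or_ne y x with rfl | hxy
    · simp
    refine ENNReal.ofReal_le_ofReal ?_
    have := dist_pos.2 hxy
    exact div_le_div_of_nonneg_left (abs_nonneg _) this hy

/-- At distances at least `r`, the difference quotients of `u` are controlled by `|u| / r`. -/
theorem diffQuot_le_of_le_dist (u : X → ℝ) {r : ℝ} (hr : 0 < r) {x y : X} (h : r ≤ dist y x) :
    diffQuot u x y ≤ ENNReal.ofReal (|u x| / r) + ENNReal.ofReal (|u y| / r) := by
  rw [← ENNReal.ofReal_add (by positivity) (by positivity)]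
  refine diffQuot_le_ofReal ?_
  have h1 : |u y - u x| ≤ |u x| + |u y| := by
    rw [add_comm]; exact abs_sub _ _
  rw [← add_div, div_mul_eq_mul_div, le_div_iff₀ hr]
  exact mul_le_mul h1 h hr.le (by positivity)

/-- For a jointly continuous family `F`, the quantity `lipScale (F q) r x` is lower semicontinuous
in `(q, x)`. -/
theorem lowerSemicontinuous_lipScale {Q : Type*} [TopologicalSpace Q] {F : Q → X → ℝ}
    (hF : Continuous (Function.uncurry F)) (r : ℝ) :
    LowerSemicontinuous fun z : Q × X => lipScale (F z.1) r z.2 := by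
  rintro ⟨q, x⟩ c hc
  simp only [lipScale, lt_iSup_iff] at hc
  obtain ⟨y, hy, hcy⟩ := hc
  have hyx : dist y x ≠ 0 := by
    intro h
    rw [dist_eq_zero.1 h, diffQuot_self] at hcy
    exact not_lt_bot hcy
  have hcont : ContinuousAt (fun z : Q × X => diffQuot (F z.1) z.2 y) (q, x) := by
    refine ENNReal.continuous_ofReal.continuousAt.comp (ContinuousAt.div ?_ ?_ hyx)
    · have h1 : Continuous fun z : Q × X => F z.1 y :=
        hF.comp (continuous_fst.prodMk continuous_const)
      exact (h1.sub hF).abs.continuousAt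
    · exact (continuous_const.dist continuous_snd).continuousAt
  have hball : ∀ᶠ z : Q × X in 𝓝 (q, x), dist y z.2 < r := by
    have : Continuous fun z : Q × X => dist y z.2 := continuous_const.dist continuous_snd
    exact this.continuousAt.eventually (gt_mem_nhds (Metric.mem_ball.1 hy))
  filter_upwards [hcont.eventually (lt_mem_nhds hcy), hball] with z h1 h2
  exact h1.trans_le (diffQuot_le_lipScale _ h2)

section Measurable

variable [TopologicalSpace.SeparableSpace X] [MeasurableSpace X] [BorelSpace X]

theorem measurable_lipScale_family {Q : Type*} [TopologicalSpace Q] [SecondCountableTopology Q]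
    [MeasurableSpace Q] [BorelSpace Q] {F : Q → X → ℝ}
    (hF : Continuous (Function.uncurry F)) (r : ℝ) {v : X → Q} (hv : Measurable v) :
    Measurable fun x => lipScale (F (v x)) r x := by
  have : SecondCountableTopology X := UniformSpace.secondCountable_of_separable X
  have h1 : Measurable fun z : Q × X => lipScale (F z.1) r z.2 :=
    (lowerSemicontinuous_lipScale hF r).measurable
  have h2 : Measurable fun x => (v x, x) := hv.prodMk measurable_id
  simpa only [Function.comp_def] using h1.comp h2

theorem measurable_lipAt_family {Q : Type*} [TopologicalSpace Q] [SecondCountableTopology Q]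
    [MeasurableSpace Q] [BorelSpace Q] {F : Q → X → ℝ}
    (hF : Continuous (Function.uncurry F)) {v : X → Q} (hv : Measurable v) :
    Measurable fun x => lipAt (F (v x)) x := by
  simp only [lipAt]
  exact Measurable.iInf fun n => measurable_lipScale_family hF _ hv

theorem measurable_lipScale (hf : Continuous f) (r : ℝ) : Measurable (lipScale f r) :=
  measurable_lipScale_family (Q := Unit) (F := fun _ => f) (hf.comp continuous_snd) r
    (v := fun _ => ()) measurable_const

theorem measurable_lipAt (hf : Continuous f) : Measurable (lipAt f) :=
  measurable_lipAt_family (Q := Unit) (F := fun _ => f) (hf.comp continuous_snd)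
    (v := fun _ => ()) measurable_const

end Measurable

end LipAt

/-! ### Hajłasz gradients with values in `[0, ∞]` -/

theorem eLpNorm_ofReal {X : Type*} [MeasurableSpace X] {μ : Measure X} {p : ℝ≥0∞} {g : X → ℝ}
    (h : ∀ x, 0 ≤ g x) :
    eLpNorm (fun x => ENNReal.ofReal (g x)) p μ = eLpNorm g p μ := by
  refine eLpNorm_congr_enorm_ae (Eventually.of_forall fun x => ?_)
  rw [enorm_eq_self, Real.enorm_of_nonneg (h x)]

section HajlaszBound

variable {X : Type*} [MetricSpace X] [MeasurableSpace X] {μ : Measure X} {p : ℝ≥0∞}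
  {u v : X → ℝ} {G H : X → ℝ≥0∞}

/-- `G` is a measurable `[0, ∞]`-valued Hajłasz gradient of `u`. -/
structure IsHajlaszBound (μ : Measure X) (u : X → ℝ) (G : X → ℝ≥0∞) : Prop where
  aemeasurable : AEMeasurable G μ
  le : ∃ E : Set X, μ E = 0 ∧ ∀ x ∉ E, ∀ y ∉ E, diffQuot u x y ≤ G x + G y

theorem IsHajlaszBound.add (hu : IsHajlaszBound μ u G) (hv : IsHajlaszBound μ v H) :
    IsHajlaszBound μ (u + v) (G + H) := by
  obtain ⟨hm, E, hE, h⟩ := hu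
  obtain ⟨hm', E', hE', h'⟩ := hv
  refine ⟨hm.add hm', E ∪ E', measure_union_null hE hE', fun x hx y hy => ?_⟩
  simp only [mem_union, not_or] at hx hy
  refine (diffQuot_add_le u v x y).trans ((add_le_add (h x hx.1 y hy.1) (h' x hx.2 y hy.2)).trans ?_)
  simp only [Pi.add_apply]
  rw [add_add_add_comm]

theorem IsHajlaszBound.smul (c : ℝ) (hu : IsHajlaszBound μ u G) :
    IsHajlaszBound μ (c • u) (fun x => ENNReal.ofReal |c| * G x) := by
  obtain ⟨hm, E, hE, h⟩ := hu
  refine ⟨hm.const_mul _, E, hE, fun x hx y hy => ?_⟩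
  rw [diffQuot_smul, ← mul_add]
  gcongr
  exact h x hx y hy

theorem IsHajlaszBound.mono (hu : IsHajlaszBound μ u G) (hH : AEMeasurable H μ) (h : G ≤ᵐ[μ] H) :
    IsHajlaszBound μ u H := by
  obtain ⟨hm, E, hE, h'⟩ := hu
  refine ⟨hH, E ∪ {x | G x ≤ H x}ᶜ, measure_union_null hE h, fun x hx y hy => ?_⟩
  simp only [mem_union, mem_compl_iff, mem_ofPred_eq, not_or, not_not] at hx hy
  exact (h' x hx.1 y hy.1).trans (add_le_add hx.2 hy.2)

theorem IsHajlaszBound.congr (hu : IsHajlaszBound μ u G) (huv : u =ᵐ[μ] v) :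
    IsHajlaszBound μ v G := by
  obtain ⟨hm, E, hE, h'⟩ := hu
  refine ⟨hm, E ∪ {x | u x = v x}ᶜ, measure_union_null hE huv, fun x hx y hy => ?_⟩
  simp only [mem_union, mem_compl_iff, mem_ofPred_eq, not_or, not_not] at hx hy
  rw [diffQuot, ← hx.2, ← hy.2]
  exact h' x hx.1 y hy.1

theorem IsHajlaszGradient.isHajlaszBound {g : X → ℝ} (h : IsHajlaszGradient μ p u g) :
    IsHajlaszBound μ u fun x => ENNReal.ofReal (g x) := by
  obtain ⟨h0, h1, E, hE, h2⟩ := h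
  refine ⟨h1.1.aemeasurable.ennreal_ofReal, E, hE, fun x hx y hy => ?_⟩
  rw [← ENNReal.ofReal_add (h0 x) (h0 y)]
  refine diffQuot_le_ofReal ?_
  rw [add_comm (g x)]
  exact h2 y hy x hx

theorem IsHajlaszBound.exists_isHajlaszGradient (hu : IsHajlaszBound μ u G) (hp0 : p ≠ 0)
    (hp : p ≠ ∞) (hG : eLpNorm G p μ ≠ ∞) :
    ∃ g, IsHajlaszGradient μ p u g ∧ eLpNorm g p μ = eLpNorm G p μ := by
  obtain ⟨hm, E, hE, h⟩ := hu
  have hfin : ∀ᵐ x ∂μ, G x < ∞ := by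
    have h1 := lintegral_rpow_enorm_lt_top_of_eLpNorm_lt_top hp0 hp hG.lt_top
    simp only [enorm_eq_self] at h1
    filter_upwards [ae_lt_top' (hm.pow_const _) h1.ne] with x hx
    exact (ENNReal.rpow_lt_top_iff_of_pos (ENNReal.toReal_pos hp0 hp)).1 hx
  have heq : eLpNorm (fun x => (G x).toReal) p μ = eLpNorm G p μ := by
    refine eLpNorm_congr_enorm_ae ?_
    filter_upwards [hfin] with x hx
    rw [enorm_eq_self, Real.enorm_of_nonneg ENNReal.toReal_nonneg, ENNReal.ofReal_toReal hx.ne]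
  refine ⟨fun x => (G x).toReal, ⟨fun x => ENNReal.toReal_nonneg,
    ⟨hm.ennreal_toReal.aestronglyMeasurable, by rw [heq]; exact hG.lt_top⟩,
    E ∪ {x | G x < ∞}ᶜ, measure_union_null hE hfin, fun x hx y hy => ?_⟩, heq⟩
  simp only [mem_union, mem_compl_iff, mem_ofPred_eq, not_or, not_not] at hx hy
  refine abs_sub_le_of_diffQuot_le (add_nonneg ENNReal.toReal_nonneg ENNReal.toReal_nonneg) ?_
  rw [ENNReal.ofReal_add ENNReal.toReal_nonneg ENNReal.toReal_nonneg,
    ENNReal.ofReal_toReal hx.2.ne, ENNReal.ofReal_toReal hy.2.ne, add_comm]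
  exact h y hy.1 x hx.1

theorem IsHajlaszBound.hajlaszEnergy_le (hu : IsHajlaszBound μ u G) (hp0 : p ≠ 0)
    (hp : p ≠ ∞) (hG : eLpNorm G p μ ≠ ∞) : hajlaszEnergy μ p u ≤ (eLpNorm G p μ).toReal := by
  obtain ⟨g, hg, h⟩ := hu.exists_isHajlaszGradient hp0 hp hG
  rw [← h]
  exact _root_.hajlaszEnergy_le hg

end HajlaszBound

/-! ### Doubling measures and density points -/

section Doubling

variable {X : Type*} [MetricSpace X] [MeasurableSpace X] {μ : Measure X}

theorem IsDoublingMeasure.measure_ball_lt_top (hμ : IsDoublingMeasure μ) (x : X) (r : ℝ) :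
    μ (Metric.ball x r) < ∞ := by
  obtain ⟨κ, hκ, h⟩ := hμ
  have h1 := (h x (max r 1) (by positivity)).2.2
  refine (measure_mono (Metric.ball_subset_ball (le_max_left r 1))).trans_lt (lt_of_le_of_lt ?_ h1)
  exact le_mul_of_one_le_left zero_le (by exact_mod_cast hκ)

theorem IsDoublingMeasure.isLocallyFiniteMeasure (hμ : IsDoublingMeasure μ) :
    IsLocallyFiniteMeasure μ :=
  ⟨fun x => ⟨Metric.ball x 1, Metric.ball_mem_nhds x one_pos, hμ.measure_ball_lt_top x 1⟩⟩

theorem IsDoublingMeasure.isUnifLocDoublingMeasure (hμ : IsDoublingMeasure μ) :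
    IsUnifLocDoublingMeasure μ := by
  obtain ⟨κ, hκ, h⟩ := hμ
  refine ⟨⟨κ * κ, ?_⟩⟩
  filter_upwards [self_mem_nhdsWithin] with r hr x
  have hr0 : (0 : ℝ) < r := hr
  have h1 := (h x (2 * r) (by positivity)).2.1
  have h2 := (h x r hr0).2.1
  calc μ (Metric.closedBall x (2 * r)) ≤ μ (Metric.ball x (2 * (2 * r))) :=
        measure_mono (Metric.closedBall_subset_ball (by linarith))
    _ ≤ κ * (κ * μ (Metric.ball x r)) := h1.trans (by gcongr)
    _ ≤ κ * (κ * μ (Metric.closedBall x r)) := by gcongr; exact Metric.ball_subset_closedBall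
    _ = _ := by rw [ENNReal.coe_mul, mul_assoc]

/-- Almost every point `x` of a set `S` is a point of density, in the sense that points near `x` are
close to `S`, relative to their distance from `x`. -/
theorem IsDoublingMeasure.ae_exists_dist_le [TopologicalSpace.SeparableSpace X] [BorelSpace X]
    (hμ : IsDoublingMeasure μ) {S : Set X} (hS : NullMeasurableSet S μ) :
    ∀ᵐ x ∂μ, x ∈ S → ∀ δ > 0, ∃ r > 0, ∀ y, dist y x < r → ∃ z ∈ S, dist z y ≤ δ * dist y x := by
  have := hμ.isLocallyFiniteMeasure
  have := hμ.isUnifLocDoublingMeasure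
  have : SecondCountableTopology X := UniformSpace.secondCountable_of_separable X
  have hall : ∀ᵐ x ∂μ, ∀ n : ℕ, x ∈ S →
      ∃ r > 0, ∀ y, dist y x < r → ∃ z ∈ S, dist z y ≤ 1 / ((n : ℝ) + 1) * dist y x := by
    refine ae_all_iff.2 fun n => (ae_restrict_iff'₀ hS).1 ?_
    filter_upwards [IsUnifLocDoublingMeasure.ae_tendsto_measure_inter_div μ S ((n : ℝ) + 1),
      ae_restrict_mem₀ hS] with x hx hxS
    have hn : (0 : ℝ) < (n : ℝ) + 1 := by positivity
    -- The balls are centred at the nearby points `y`, with radius proportional to `dist y x`.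
    have h1 := @hx X (𝓝[≠] x) id (fun y => 1 / ((n : ℝ) + 1) * dist y x) (by
      refine tendsto_nhdsWithin_iff.2 ⟨?_, ?_⟩
      · have : Tendsto (fun y => 1 / ((n : ℝ) + 1) * dist y x) (𝓝 x)
            (𝓝 (1 / ((n : ℝ) + 1) * dist x x)) :=
          ((continuous_id.dist continuous_const).const_mul _).continuousAt
        rw [dist_self, mul_zero] at this
        exact this.mono_left nhdsWithin_le_nhds
      · filter_upwards [self_mem_nhdsWithin] with y hy
        exact mul_pos (by positivity) (dist_pos.2 hy)) (by
      refine Eventually.of_forall fun y => ?_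
      rw [Metric.mem_closedBall, ← mul_assoc, mul_one_div_cancel hn.ne', one_mul, dist_comm]
      exact le_rfl)
    have h2 := h1.eventually (lt_mem_nhds (zero_lt_one))
    obtain ⟨r, hr, hb⟩ := Metric.mem_nhdsWithin_iff.1 h2
    refine ⟨r, hr, fun y hy => ?_⟩
    rcases eq_or_ne y x with rfl | hyx
    · exact ⟨y, hxS, by simp⟩
    have h3 : 0 < μ (S ∩ Metric.closedBall y (1 / ((n : ℝ) + 1) * dist y x)) /
        μ (Metric.closedBall y (1 / ((n : ℝ) + 1) * dist y x)) := hb ⟨hy, hyx⟩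
    obtain ⟨z, hz⟩ := nonempty_of_measure_ne_zero (ENNReal.div_pos_iff.1 h3).1
    exact ⟨z, hz.1, hz.2⟩
  filter_upwards [hall] with x hx hxS δ hδ
  obtain ⟨n, hn⟩ := exists_nat_one_div_lt hδ
  obtain ⟨r, hr, h⟩ := hx n hxS
  refine ⟨r, hr, fun y hy => ?_⟩
  obtain ⟨z, hz, hzy⟩ := h y hy
  exact ⟨z, hz, hzy.trans (by gcongr)⟩

/-- The pointwise Lipschitz constant of a Lipschitz function is at most twice any of its Hajłasz
gradients. -/
theorem IsDoublingMeasure.lipAt_le_two_mul [TopologicalSpace.SeparableSpace X] [BorelSpace X]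
    (hμ : IsDoublingMeasure μ) {f : X → ℝ} {K : ℝ≥0} (hf : LipschitzWith K f) {G : X → ℝ≥0∞}
    (hG : IsHajlaszBound μ f G) : ∀ᵐ x ∂μ, lipAt f x ≤ 2 * G x := by
  obtain ⟨hm, E, hE, h⟩ := hG
  have hden : ∀ᵐ x ∂μ, ∀ t : ℚ, x ∈ {x | G x < ENNReal.ofReal t} \ E → ∀ δ > 0, ∃ r > 0, ∀ y,
      dist y x < r → ∃ z ∈ {x | G x < ENNReal.ofReal t} \ E, dist z y ≤ δ * dist y x :=
    ae_all_iff.2 fun t => hμ.ae_exists_dist_le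
      ((nullMeasurableSet_lt hm aemeasurable_const).diff (NullMeasurableSet.of_null hE))
  filter_upwards [hden, compl_mem_ae_iff.2 hE] with x hx hxE
  refine le_of_forall_gt fun c hc => ?_
  have hc' : G x < c / 2 := by
    rw [ENNReal.lt_div_iff_mul_lt (by simp) (by simp), mul_comm]
    exact hc
  obtain ⟨t, ht0, ht1, ht2⟩ := ENNReal.lt_iff_exists_rat_btwn.1 hc'
  have ht0' : (0 : ℝ) ≤ t := by exact_mod_cast ht0
  rw [← ENNReal.ofReal] at ht1 ht2
  refine lt_of_le_of_lt ?_ ((ENNReal.lt_div_iff_mul_lt (by simp) (by simp)).1 ht2)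
  have key : ∀ δ : ℝ, 0 < δ → lipAt f x ≤ ENNReal.ofReal (2 * t * (1 + δ) + K * δ) := by
    intro δ hδ
    obtain ⟨r, hr, hb⟩ := hx t ⟨ht1, hxE⟩ δ hδ
    refine lipAt_le_of_forall_abs_sub_le hr fun y hy => ?_
    obtain ⟨z, ⟨hzt, hzE⟩, hzy⟩ := hb y hy
    have h1 : |f z - f x| ≤ 2 * t * dist z x := by
      refine abs_sub_le_of_diffQuot_le (by positivity) ((h x hxE z hzE).trans ?_)
      rw [two_mul, ENNReal.ofReal_add ht0' ht0']
      exact add_le_add ht1.le (le_of_lt hzt)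
    have h2 : |f y - f z| ≤ K * dist z y := by
      rw [← Real.dist_eq, dist_comm z y]
      exact hf.dist_le_mul y z
    have h3 := dist_triangle z y x
    have h4 : |f y - f x| ≤ |f y - f z| + |f z - f x| := abs_sub_le _ _ _
    have h5 : (K : ℝ) * dist z y ≤ K * (δ * dist y x) := by gcongr
    have h6 : 2 * (t : ℝ) * dist z x ≤ 2 * t * ((1 + δ) * dist y x) := by
      gcongr
      linarith
    calc |f y - f x| ≤ K * (δ * dist y x) + 2 * t * ((1 + δ) * dist y x) := by linarith
      _ = _ := by ring
  have hlim : Tendsto (fun δ : ℝ => ENNReal.ofReal (2 * t * (1 + δ) + K * δ)) (𝓝[>] 0)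
      (𝓝 (ENNReal.ofReal (2 * t))) := by
    have h1 : Continuous fun δ : ℝ => ENNReal.ofReal (2 * t * (1 + δ) + K * δ) :=
      ENNReal.continuous_ofReal.comp (by fun_prop)
    have h2 := h1.tendsto 0
    simp only [add_zero, mul_one, mul_zero] at h2
    exact h2.mono_left nhdsWithin_le_nhds
  have h1 := ge_of_tendsto hlim (by filter_upwards [self_mem_nhdsWithin] with δ hδ using key δ hδ)
  rwa [mul_comm, ENNReal.ofReal_mul ht0', ENNReal.ofReal_ofNat] at h1

end Doubling

/-! ### `L^p` seminorms of `[0, ∞]`-valued functions -/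

section ENNRealLp

variable {X : Type*} [MeasurableSpace X] {μ : Measure X} {p : ℝ≥0∞} {f g : X → ℝ≥0∞}

theorem eLpNorm_eq_lintegral_rpow (hp0 : p ≠ 0) (hp : p ≠ ∞) (f : X → ℝ≥0∞) :
    eLpNorm f p μ = (∫⁻ x, f x ^ p.toReal ∂μ) ^ (1 / p.toReal) := by
  simp only [eLpNorm_eq_lintegral_rpow_enorm_toReal hp0 hp, enorm_eq_self]

theorem lintegral_rpow_eq_eLpNorm_rpow (hp0 : p ≠ 0) (hp : p ≠ ∞) (f : X → ℝ≥0∞) :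
    ∫⁻ x, f x ^ p.toReal ∂μ = eLpNorm f p μ ^ p.toReal := by
  rw [eLpNorm_eq_lintegral_rpow hp0 hp, ← ENNReal.rpow_mul,
    one_div_mul_cancel (ENNReal.toReal_pos hp0 hp).ne', ENNReal.rpow_one]

theorem eLpNorm_le_of_ae_le (h : f ≤ᵐ[μ] g) : eLpNorm f p μ ≤ eLpNorm g p μ := by
  refine eLpNorm_mono_enorm_ae ?_
  filter_upwards [h] with x hx
  simpa only [enorm_eq_self] using hx

theorem eLpNorm_add_le_of_aemeasurable (hf : AEMeasurable f μ) (hg : AEMeasurable g μ)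
    (hp : 1 ≤ p) : eLpNorm (fun x => f x + g x) p μ ≤ eLpNorm f p μ + eLpNorm g p μ :=
  eLpNorm_add_le hf.aestronglyMeasurable hg.aestronglyMeasurable hp

theorem eLpNorm_const_mul_ennreal (hp0 : p ≠ 0) (hp : p ≠ ∞) (c : ℝ≥0∞) (hf : AEMeasurable f μ) :
    eLpNorm (fun x => c * f x) p μ = c * eLpNorm f p μ := by
  have ht := ENNReal.toReal_pos hp0 hp
  rw [eLpNorm_eq_lintegral_rpow hp0 hp, eLpNorm_eq_lintegral_rpow hp0 hp]
  simp only [ENNReal.mul_rpow_of_nonneg _ _ ht.le]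
  rw [lintegral_const_mul'' _ (hf.pow_const _),
    ENNReal.mul_rpow_of_nonneg _ _ (by positivity), ← ENNReal.rpow_mul,
    mul_one_div_cancel ht.ne', ENNReal.rpow_one]

theorem ae_lt_top_of_eLpNorm_ne_top (hp0 : p ≠ 0) (hp : p ≠ ∞) (hf : AEMeasurable f μ)
    (h : eLpNorm f p μ ≠ ∞) : ∀ᵐ x ∂μ, f x < ∞ := by
  have ht := ENNReal.toReal_pos hp0 hp
  have h1 : ∫⁻ x, f x ^ p.toReal ∂μ ≠ ∞ := by
    rw [lintegral_rpow_eq_eLpNorm_rpow hp0 hp]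
    exact ENNReal.rpow_ne_top_of_nonneg ht.le h
  filter_upwards [ae_lt_top' (hf.pow_const _) h1] with x hx
  exact (ENNReal.rpow_lt_top_iff_of_pos ht).1 hx

theorem tendsto_eLpNorm_zero_of_dominated (hp0 : p ≠ 0) (hp : p ≠ ∞) {F : ℕ → X → ℝ≥0∞}
    (hF : ∀ n, AEMeasurable (F n) μ) (hle : ∀ n, F n ≤ᵐ[μ] g) (hg : eLpNorm g p μ ≠ ∞)
    (hlim : ∀ᵐ x ∂μ, Tendsto (fun n => F n x) atTop (𝓝 0)) :
    Tendsto (fun n => eLpNorm (F n) p μ) atTop (𝓝 0) := by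
  have ht := ENNReal.toReal_pos hp0 hp
  have h1 := tendsto_lintegral_of_dominated_convergence' (μ := μ)
    (F := fun n x => F n x ^ p.toReal) (f := fun _ => 0) (fun x => g x ^ p.toReal)
    (fun n => (hF n).pow_const _)
    (fun n => by
      filter_upwards [hle n] with x hx
      exact ENNReal.rpow_le_rpow hx ht.le)
    (by
      rw [lintegral_rpow_eq_eLpNorm_rpow hp0 hp]
      exact ENNReal.rpow_ne_top_of_nonneg ht.le hg)
    (by
      filter_upwards [hlim] with x hx
      have := (ENNReal.continuous_rpow_const (y := p.toReal)).tendsto 0 |>.comp hx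
      rwa [ENNReal.zero_rpow_of_pos ht] at this)
  have h2 := (ENNReal.continuous_rpow_const (y := 1 / p.toReal)).tendsto 0 |>.comp
    (by simpa using h1)
  rw [ENNReal.zero_rpow_of_pos (by positivity)] at h2
  simpa only [eLpNorm_eq_lintegral_rpow hp0 hp, Function.comp_def] using h2

end ENNRealLp

/-! ### Lipschitz functions with bounded support -/

/-- The space of Lipschitz functions that vanish off a bounded set. -/
def boundedSupportLipschitz (X : Type*) [MetricSpace X] : Submodule ℝ (X → ℝ) where
  carrier := {f | (∃ K : ℝ≥0, LipschitzWith K f) ∧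
    ∃ B : Set X, Bornology.IsBounded B ∧ ∀ x ∉ B, f x = 0}
  add_mem' := by
    rintro f g ⟨⟨K, hK⟩, B, hB, hf⟩ ⟨⟨L, hL⟩, C, hC, hg⟩
    refine ⟨⟨K + L, hK.add hL⟩, B ∪ C, hB.union hC, fun x hx => ?_⟩
    simp only [mem_union, not_or] at hx
    rw [Pi.add_apply, hf x hx.1, hg x hx.2, add_zero]
  zero_mem' := ⟨⟨0, LipschitzWith.const 0⟩, ∅, Bornology.isBounded_empty, fun _ _ => rfl⟩
  smul_mem' := by
    rintro c f ⟨⟨K, hK⟩, B, hB, hf⟩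
    refine ⟨⟨‖c‖₊ * K, (lipschitzWith_smul c).comp hK⟩, B, hB, fun x hx => ?_⟩
    rw [Pi.smul_apply, hf x hx, smul_zero]

section BoundedSupportLipschitz

variable {X : Type*} [MetricSpace X] {f : X → ℝ}

theorem exists_ball_of_mem_boundedSupportLipschitz (hf : f ∈ boundedSupportLipschitz X) (x₀ : X) :
    ∃ K : ℝ≥0, LipschitzWith K f ∧ ∃ R > 0, (∀ x, R ≤ dist x x₀ → f x = 0) ∧
      ∃ C : ℝ, 0 ≤ C ∧ ∀ x, |f x| ≤ C := by
  obtain ⟨⟨K, hK⟩, B, hB, h⟩ := hf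
  obtain ⟨R, hR⟩ := hB.subset_ball x₀
  have hz : ∀ x, max R 1 ≤ dist x x₀ → f x = 0 := fun x hx => h x fun hxB =>
    absurd (Metric.mem_ball.1 (hR hxB)) (not_lt.2 ((le_max_left _ _).trans hx))
  refine ⟨K, hK, max R 1, by positivity, hz, |f x₀| + K * max R 1, by positivity, fun x => ?_⟩
  rcases le_or_gt (max R 1) (dist x x₀) with hx | hx
  · rw [hz x hx, abs_zero]
    positivity
  · have h1 := hK.dist_le_mul x x₀
    rw [Real.dist_eq] at h1
    have h2 := abs_sub_abs_le_abs_sub (f x) (f x₀)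
    have h3 : (K : ℝ) * dist x x₀ ≤ K * max R 1 := by gcongr
    linarith

variable [MeasurableSpace X] [BorelSpace X] {μ : Measure X} {p : ℝ≥0∞}

theorem eLpNorm_indicator_ball_ne_top (hμ : IsDoublingMeasure μ) (c : ℝ≥0) (x₀ : X) (R : ℝ) :
    eLpNorm ((Metric.ball x₀ R).indicator fun _ => (c : ℝ≥0∞)) p μ ≠ ∞ := by
  have h : MemLp ((Metric.ball x₀ R).indicator fun _ => (c : ℝ)) p μ :=
    memLp_indicator_const p measurableSet_ball _ (Or.inr (hμ.measure_ball_lt_top x₀ R).ne)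
  refine ne_of_eq_of_ne (eLpNorm_congr_enorm_ae (Eventually.of_forall fun x => ?_)) h.eLpNorm_ne_top
  by_cases hx : x ∈ Metric.ball x₀ R
  · simp [indicator_of_mem hx]
  · simp [indicator_of_notMem hx]

theorem memLp_of_mem_boundedSupportLipschitz (hμ : IsDoublingMeasure μ) [Nonempty X]
    [TopologicalSpace.SeparableSpace X] (hf : f ∈ boundedSupportLipschitz X) : MemLp f p μ := by
  have : SecondCountableTopology X := UniformSpace.secondCountable_of_separable X
  obtain ⟨x₀⟩ := ‹Nonempty X›
  obtain ⟨K, hK, R, hR, hz, C, hC, hb⟩ := exists_ball_of_mem_boundedSupportLipschitz hf x₀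
  refine ⟨hK.continuous.aestronglyMeasurable, lt_of_le_of_lt (eLpNorm_mono_enorm fun x => ?_)
    (eLpNorm_indicator_ball_ne_top hμ C.toNNReal x₀ R).lt_top⟩
  by_cases hx : x ∈ Metric.ball x₀ R
  · rw [indicator_of_mem hx, enorm_eq_self, Real.enorm_eq_ofReal_abs]
    exact ENNReal.ofReal_le_ofReal (hb x)
  · rw [hz x (not_lt.1 hx)]
    simp

theorem exists_isHajlaszBound_of_mem_boundedSupportLipschitz (hμ : IsDoublingMeasure μ) [Nonempty X]
    (hf : f ∈ boundedSupportLipschitz X) : ∃ G, IsHajlaszBound μ f G ∧ eLpNorm G p μ ≠ ∞ := by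
  obtain ⟨x₀⟩ := ‹Nonempty X›
  obtain ⟨K, hK, R, hR, hz, -⟩ := exists_ball_of_mem_boundedSupportLipschitz hf x₀
  refine ⟨(Metric.ball x₀ R).indicator fun _ => (K : ℝ≥0∞),
    ⟨(measurable_const.indicator measurableSet_ball).aemeasurable, ∅, measure_empty,
      fun x _ y _ => ?_⟩, eLpNorm_indicator_ball_ne_top hμ K x₀ R⟩
  have hle : diffQuot f x y ≤ K := by
    have h1 := lipScale_le_of_lipschitzWith hK (dist y x + 1) x
    exact (diffQuot_le_lipScale f (lt_add_one _)).trans h1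
  by_cases hx : x ∈ Metric.ball x₀ R
  · rw [indicator_of_mem hx]
    exact hle.trans le_self_add
  by_cases hy : y ∈ Metric.ball x₀ R
  · rw [indicator_of_mem hy]
    exact hle.trans le_add_self
  · rw [diffQuot, hz x (not_lt.1 hx), hz y (not_lt.1 hy)]
    simp

/-- For Lipschitz functions with bounded support, `lipScale f r` decreases to `lipAt f` in `L^p` as
`r → 0`. -/
theorem exists_lipScale_le_add (hμ : IsDoublingMeasure μ) [Nonempty X]
    [TopologicalSpace.SeparableSpace X] (hp0 : p ≠ 0) (hp : p ≠ ∞)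
    (hf : f ∈ boundedSupportLipschitz X) {ε : ℝ≥0∞} (hε : 0 < ε) {r₀ : ℝ} (hr₀ : 0 < r₀) :
    ∃ r, 0 < r ∧ r < r₀ ∧ ∃ β : X → ℝ≥0∞, AEMeasurable β μ ∧ eLpNorm β p μ ≤ ε ∧
      ∀ x, lipScale f r x ≤ lipAt f x + β x := by
  obtain ⟨x₀⟩ := ‹Nonempty X›
  obtain ⟨K, hK, R, hR, hz, -⟩ := exists_ball_of_mem_boundedSupportLipschitz hf x₀
  set β : ℕ → X → ℝ≥0∞ := fun n x => lipScale f (1 / ((n : ℝ) + 1)) x - lipAt f x with hβ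
  have hβm : ∀ n, AEMeasurable (β n) μ := fun n =>
    ((measurable_lipScale hK.continuous _).sub (measurable_lipAt hK.continuous)).aemeasurable
  have hdom : ∀ n x, β n x ≤ (Metric.ball x₀ (R + 1)).indicator (fun _ => (K : ℝ≥0∞)) x := by
    intro n x
    refine tsub_le_self.trans ?_
    by_cases hx : x ∈ Metric.ball x₀ (R + 1)
    · rw [indicator_of_mem hx]
      exact lipScale_le_of_lipschitzWith hK _ x
    · rw [indicator_of_notMem hx]
      refine lipScale_le fun y hy => ?_
      have h1 : R + 1 ≤ dist x x₀ := not_lt.1 hx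
      have h2 : 1 / ((n : ℝ) + 1) ≤ 1 := by
        rw [div_le_one (by positivity)]
        linarith [(Nat.cast_nonneg n : (0 : ℝ) ≤ n)]
      have h3 := dist_triangle x y x₀
      rw [dist_comm x y] at h3
      rw [diffQuot, hz x (by linarith), hz y (by linarith)]
      simp
  have hlim : ∀ x, Tendsto (fun n => β n x) atTop (𝓝 0) := by
    intro x
    have hfin : lipAt f x ≠ ∞ := ((lipAt_le_of_lipschitzWith hK x).trans_lt ENNReal.coe_lt_top).ne
    have := ENNReal.Tendsto.sub (tendsto_lipScale f x) (tendsto_const_nhds (x := lipAt f x))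
      (Or.inl hfin)
    rwa [tsub_self] at this
  have hT := tendsto_eLpNorm_zero_of_dominated hp0 hp hβm
    (fun n => Eventually.of_forall (hdom n)) (eLpNorm_indicator_ball_ne_top hμ K x₀ (R + 1))
    (Eventually.of_forall hlim)
  obtain ⟨n, hn1, hn2⟩ := ((hT.eventually (ge_mem_nhds hε)).and
    (tendsto_one_div_add_atTop_nhds_zero_nat.eventually (gt_mem_nhds hr₀))).exists
  exact ⟨_, by positivity, hn2, β n, hβm n, hn1, fun x => le_add_tsub⟩

end BoundedSupportLipschitz

/-! ### Density of Lipschitz functions in `M^{1,p}` -/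

section Density

variable {X : Type*} [MetricSpace X] [MeasurableSpace X] [BorelSpace X]
  [TopologicalSpace.SeparableSpace X] {μ : Measure X} {p : ℝ≥0∞} {u : X → ℝ}

/-- Truncating `u` at height `l` and extending it from the set where a Hajłasz gradient is at most
`l` yields Lipschitz approximations. -/
theorem exists_lipschitz_approx [Nonempty X] (hp1 : 1 ≤ p) (hp : p ≠ ∞) (hu : MemLp u p μ) {g : X → ℝ}
    (hg : IsHajlaszGradient μ p u g) {ε : ℝ≥0∞} (hε : 0 < ε) :
    ∃ w : X → ℝ, (∃ K : ℝ≥0, LipschitzWith K w) ∧ (∃ C, ∀ x, |w x| ≤ C) ∧ MemLp w p μ ∧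
      eLpNorm (u - w) p μ ≤ ε ∧ ∃ H, IsHajlaszBound μ (u - w) H ∧ eLpNorm H p μ ≤ ε := by
  have hp0 : p ≠ 0 := (one_pos.trans_le hp1).ne'
  obtain ⟨E, hE, hle⟩ := hg.le
  have hsum : MemLp (fun x => 4 * (g x + |u x|)) p μ := (hg.memLp.add hu.abs).const_mul 4
  set A : ℕ → Set X := fun n => {x | g x ≤ n ∧ |u x| ≤ n}ᶜ with hA
  have hAm : ∀ n, NullMeasurableSet (A n) μ := fun n =>
    ((nullMeasurableSet_le hg.memLp.1.aemeasurable aemeasurable_const).inter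
      (nullMeasurableSet_le hu.abs.1.aemeasurable aemeasurable_const)).compl
  set H : ℕ → X → ℝ≥0∞ := fun n => (A n).indicator
    fun x => ENNReal.ofReal (4 * (g x + |u x|)) with hH
  have hHm : ∀ n, AEMeasurable (H n) μ := fun n =>
    (hsum.1.aemeasurable.ennreal_ofReal).indicator₀ (hAm n)
  have hT := tendsto_eLpNorm_zero_of_dominated hp0 hp hHm
    (g := fun x => ENNReal.ofReal (4 * (g x + |u x|)))
    (fun n => Eventually.of_forall fun x => indicator_le_self _ _ x)
    (by
      rw [eLpNorm_ofReal fun x => by have := hg.nonneg x; positivity]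
      exact hsum.eLpNorm_ne_top)
    (Eventually.of_forall fun x => by
      obtain ⟨n, hn⟩ := exists_nat_ge (max (g x) |u x|)
      refine tendsto_const_nhds.congr' ?_
      filter_upwards [eventually_ge_atTop n] with m hm
      have hmn : (n : ℝ) ≤ m := by exact_mod_cast hm
      refine (indicator_of_notMem ?_ _).symm
      simp only [hA, mem_compl_iff, mem_ofPred_eq, not_not]
      exact ⟨((le_max_left _ _).trans hn).trans hmn, ((le_max_right _ _).trans hn).trans hmn⟩)
  obtain ⟨n, hn⟩ := (hT.eventually (ge_mem_nhds hε)).exists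
  have hlip : LipschitzOnWith (2 * (n : ℝ≥0)) u (E ∪ A n)ᶜ := by
    refine LipschitzOnWith.of_dist_le_mul fun x hx y hy => ?_
    simp only [hA, compl_union, compl_compl, mem_inter_iff, mem_compl_iff, mem_ofPred_eq] at hx hy
    rw [Real.dist_eq]
    refine (hle x hx.1 y hy.1).trans ?_
    push_cast
    gcongr
    linarith [hx.2.1, hy.2.1]
  obtain ⟨w₀, hw₀, hw₀u⟩ := hlip.extend_real
  set w : X → ℝ := fun x => max (min (n : ℝ) (w₀ x)) (-n) with hw
  have hwK : LipschitzWith (2 * (n : ℝ≥0)) w := (hw₀.const_min _).max_const _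
  have hwu : ∀ x ∉ E, x ∉ A n → w x = u x := by
    intro x hxE hxA
    have h1 : u x = w₀ x := hw₀u (by simp [hxE, hxA])
    simp only [hA, mem_compl_iff, mem_ofPred_eq, not_not] at hxA
    have h2 := abs_le.1 hxA.2
    rw [hw]
    simp only
    rw [← h1, min_eq_right h2.2, max_eq_left h2.1]
  have hwb : ∀ x, |w x| ≤ n := fun x => by
    refine abs_le.2 ⟨le_max_right _ _, max_le (min_le_left _ _) ?_⟩
    linarith [(Nat.cast_nonneg n : (0 : ℝ) ≤ n)]
  have hlarge : ∀ x ∈ A n, (n : ℝ) ≤ g x + |u x| := by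
    intro x hx
    by_contra! hlt
    exact hx ⟨by linarith [abs_nonneg (u x)], by linarith [hg.nonneg x]⟩
  have hsub : ∀ᵐ x ∂μ, ‖(u - w) x‖ₑ ≤ ‖H n x‖ₑ := by
    filter_upwards [compl_mem_ae_iff.2 hE] with x hx
    rw [enorm_eq_self, Real.enorm_eq_ofReal_abs, Pi.sub_apply]
    by_cases hxA : x ∈ A n
    · simp only [hH, indicator_of_mem hxA]
      refine ENNReal.ofReal_le_ofReal ?_
      have h1 := abs_sub (u x) (w x)
      have h2 := hwb x
      have h3 := hlarge x hxA
      have h4 := hg.nonneg x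
      linarith [abs_nonneg (u x)]
    · rw [hwu x hx hxA]
      simp
  have hsubn : eLpNorm (u - w) p μ ≤ eLpNorm (H n) p μ := eLpNorm_mono_enorm_ae hsub
  have : SecondCountableTopology X := UniformSpace.secondCountable_of_separable X
  have hwm : AEStronglyMeasurable w μ := hwK.continuous.aestronglyMeasurable
  have hHfin : eLpNorm (H n) p μ ≠ ∞ := by
    refine ((eLpNorm_le_of_ae_le (Eventually.of_forall fun x =>
      indicator_le_self _ _ x)).trans_lt (lt_top_iff_ne_top.2 ?_)).ne
    rw [eLpNorm_ofReal fun x => by have := hg.nonneg x; positivity]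
    exact hsum.eLpNorm_ne_top
  refine ⟨w, ⟨_, hwK⟩, ⟨n, hwb⟩, ?_, hsubn.trans hn, H n, ⟨hHm n, E, hE, fun x hx y hy => ?_⟩, hn⟩
  · have h1 : MemLp (u - w) p μ := ⟨hu.1.sub hwm, hsubn.trans_lt hHfin.lt_top⟩
    have h2 := hu.sub h1
    rwa [sub_sub_cancel] at h2
  · have h1 : |u y - u x| ≤ (g x + g y) * dist y x := by
      rw [add_comm (g x)]; exact hle y hy x hx
    have h2 : |w y - w x| ≤ 2 * n * dist y x := by
      have := hwK.dist_le_mul y x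
      rw [Real.dist_eq] at this
      exact_mod_cast this
    have h3 : |(u - w) y - (u - w) x| ≤ (g x + g y + 2 * n) * dist y x := by
      have h4 : (u - w) y - (u - w) x = (u y - u x) - (w y - w x) := by
        simp only [Pi.sub_apply]; ring
      rw [h4, add_mul]
      exact (abs_sub _ _).trans (add_le_add h1 h2)
    have gx := hg.nonneg x
    have gy := hg.nonneg y
    by_cases hxA : x ∈ A n
    · have hx' := hlarge x hxA
      by_cases hyA : y ∈ A n
      · simp only [hH, indicator_of_mem hxA, indicator_of_mem hyA]
        rw [← ENNReal.ofReal_add (by positivity) (by positivity)]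
        refine diffQuot_le_ofReal (h3.trans (mul_le_mul_of_nonneg_right ?_ dist_nonneg))
        linarith [abs_nonneg (u x), abs_nonneg (u y), hlarge y hyA]
      · simp only [hH, indicator_of_mem hxA, indicator_of_notMem hyA, add_zero]
        refine diffQuot_le_ofReal (h3.trans ?_)
        simp only [hA, mem_compl_iff, mem_ofPred_eq, not_not] at hyA
        gcongr
        linarith [abs_nonneg (u x), hyA.1]
    · have hxA' := hxA
      simp only [hA, mem_compl_iff, mem_ofPred_eq, not_not] at hxA'
      by_cases hyA : y ∈ A n
      · have hy' := hlarge y hyA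
        simp only [hH, indicator_of_mem hyA, indicator_of_notMem hxA, zero_add]
        refine diffQuot_le_ofReal (h3.trans ?_)
        gcongr
        linarith [abs_nonneg (u y), hxA'.1]
      · simp [diffQuot, hwu x hx hxA, hwu y hy hyA]

/-- Multiplying with cutoff functions yields approximations with bounded support. -/
theorem exists_boundedSupport_approx [Nonempty X] (hp1 : 1 ≤ p) (hp : p ≠ ∞) {w : X → ℝ}
    {K : ℝ≥0} (hwK : LipschitzWith K w) (hwb : ∃ C, ∀ x, |w x| ≤ C) (hw : MemLp w p μ)
    {g : X → ℝ} (hg : IsHajlaszGradient μ p w g) {ε : ℝ≥0∞} (hε : 0 < ε) :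
    ∃ f ∈ boundedSupportLipschitz X, eLpNorm (w - f) p μ ≤ ε ∧
      ∃ H, IsHajlaszBound μ (w - f) H ∧ eLpNorm H p μ ≤ ε := by
  have hp0 : p ≠ 0 := (one_pos.trans_le hp1).ne'
  have : SecondCountableTopology X := UniformSpace.secondCountable_of_separable X
  obtain ⟨x₀⟩ := ‹Nonempty X›
  obtain ⟨C, hC⟩ := hwb
  have hC0 : 0 ≤ C := (abs_nonneg _).trans (hC x₀)
  set R : ℕ → ℝ := fun n => (n : ℝ) + 1 with hR
  have hR1 : ∀ n, 1 ≤ R n := fun n => by simp [hR]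
  have hR0 : ∀ n, 0 < R n := fun n => one_pos.trans_le (hR1 n)
  set φ : ℕ → X → ℝ := fun n x => min 1 (max 0 (dist x x₀ / R n - 1)) with hφ
  have hφ0 : ∀ n x, 0 ≤ φ n x := fun n x => le_min zero_le_one (le_max_left _ _)
  have hφ1 : ∀ n x, φ n x ≤ 1 := fun n x => min_le_left _ _
  have hφK : ∀ n x y, |φ n y - φ n x| ≤ dist y x / R n := by
    intro n x y
    have h1 : |φ n y - φ n x| ≤ |(dist y x₀ / R n - 1) - (dist x x₀ / R n - 1)| := by
      refine (abs_min_sub_min_le_max _ _ _ _).trans ?_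
      rw [sub_self, abs_zero, max_eq_right (abs_nonneg _)]
      refine (abs_max_sub_max_le_max _ _ _ _).trans ?_
      rw [sub_self, abs_zero, max_eq_right (abs_nonneg _)]
    refine h1.trans ?_
    rw [sub_sub_sub_cancel_right, ← sub_div, abs_div, abs_of_pos (hR0 n)]
    have := abs_dist_sub_le y x x₀
    have := hR0 n
    gcongr
  have hφc : ∀ n, Continuous (φ n) := fun n => by
    simp only [hφ]
    fun_prop
  set B : ℕ → X → ℝ := fun n x => φ n x * g x + φ n x * |w x| + |w x| / R n with hB
  have hB0 : ∀ n x, 0 ≤ B n x := fun n x => by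
    have := hφ0 n x
    have := hg.nonneg x
    have := hR0 n
    positivity
  have hBm : ∀ n, AEMeasurable (fun x => ENNReal.ofReal (B n x)) μ := fun n => by
    have h1 := (hφc n).measurable.aemeasurable (μ := μ)
    exact (((h1.mul hg.memLp.1.aemeasurable).add (h1.mul hw.abs.1.aemeasurable)).add
      (hw.abs.1.aemeasurable.div_const _)).ennreal_ofReal
  have hdom : MemLp (fun x => g x + |w x| + |w x|) p μ := (hg.memLp.add hw.abs).add hw.abs
  have hT := tendsto_eLpNorm_zero_of_dominated hp0 hp hBm
    (g := fun x => ENNReal.ofReal (g x + |w x| + |w x|))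
    (fun n => Eventually.of_forall fun x => by
      refine ENNReal.ofReal_le_ofReal ?_
      refine add_le_add (add_le_add ?_ ?_) ?_
      · exact mul_le_of_le_one_left (hg.nonneg x) (hφ1 n x)
      · exact mul_le_of_le_one_left (abs_nonneg _) (hφ1 n x)
      · exact div_le_self (abs_nonneg _) (hR1 n))
    (by
      rw [eLpNorm_ofReal fun x => by have := hg.nonneg x; positivity]
      exact hdom.eLpNorm_ne_top)
    (Eventually.of_forall fun x => by
      have h1 : Tendsto (fun n : ℕ => |w x| / R n) atTop (𝓝 0) :=
        tendsto_const_nhds.div_atTop (tendsto_natCast_atTop_atTop.atTop_add tendsto_const_nhds)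
      have h2 : Tendsto (fun n : ℕ => B n x) atTop (𝓝 0) := by
        refine h1.congr' ?_
        obtain ⟨m, hm⟩ := exists_nat_ge (dist x x₀)
        filter_upwards [eventually_ge_atTop m] with n hn
        have hmn : (m : ℝ) ≤ n := by exact_mod_cast hn
        have h3 : φ n x = 0 := by
          have h4 : dist x x₀ / R n ≤ 1 := by
            rw [div_le_one (hR0 n)]
            simp only [hR]
            linarith
          simp only [hφ]
          rw [max_eq_left (by linarith), min_eq_right zero_le_one]
        simp only [hB, h3]
        ring
      have h3 := ENNReal.continuous_ofReal.tendsto 0 |>.comp h2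
      rwa [ENNReal.ofReal_zero] at h3)
  obtain ⟨n, hn⟩ := (hT.eventually (ge_mem_nhds hε)).exists
  have hRn := hR0 n
  have hdiff : (w - fun x => (1 - φ n x) * w x) = fun x => φ n x * w x := by
    ext x
    simp only [Pi.sub_apply]
    ring
  refine ⟨fun x => (1 - φ n x) * w x, ⟨⟨K + C.toNNReal, ?_⟩, Metric.ball x₀ (2 * R n),
    Metric.isBounded_ball, fun x hx => ?_⟩, ?_, fun x => ENNReal.ofReal (B n x), ?_, hn⟩
  · refine LipschitzWith.of_dist_le_mul fun x y => ?_
    have h1 : (1 - φ n x) * w x - (1 - φ n y) * w y =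
        (1 - φ n x) * (w x - w y) + w y * (φ n y - φ n x) := by ring
    have h2 := hwK.dist_le_mul x y
    have h3 := hφK n x y
    have h4 : dist y x / R n ≤ dist x y := by
      rw [dist_comm]
      exact div_le_self dist_nonneg (hR1 n)
    rw [Real.dist_eq] at h2 ⊢
    rw [h1, NNReal.coe_add, Real.coe_toNNReal _ hC0, add_mul]
    refine (abs_add_le _ _).trans (add_le_add ?_ ?_)
    · rw [abs_mul, abs_of_nonneg (sub_nonneg.2 (hφ1 n x))]
      exact (mul_le_of_le_one_left (abs_nonneg _) (by linarith [hφ0 n x])).trans h2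
    · rw [abs_mul]
      exact mul_le_mul (hC y) (h3.trans h4) (abs_nonneg _) hC0
  · have h1 : 2 * R n ≤ dist x x₀ := not_lt.1 hx
    have h2 : 1 ≤ dist x x₀ / R n - 1 := by
      rw [le_sub_iff_add_le, le_div_iff₀ hRn]
      linarith
    have h3 : φ n x = 1 := by
      simp only [hφ]
      rw [max_eq_right (by linarith), min_eq_left h2]
    simp only [h3, sub_self, zero_mul]
  · refine (eLpNorm_mono_enorm fun x => ?_).trans hn
    rw [hdiff, enorm_eq_self, Real.enorm_eq_ofReal_abs, abs_mul, abs_of_nonneg (hφ0 n x)]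
    refine ENNReal.ofReal_le_ofReal ?_
    have h1 := mul_nonneg (hφ0 n x) (hg.nonneg x)
    have h2 : 0 ≤ |w x| / R n := by positivity
    simp only [hB]
    linarith
  · rw [hdiff]
    obtain ⟨E, hE, hle⟩ := hg.le
    refine ⟨hBm n, E, hE, ?_⟩
    have key : ∀ x ∉ E, ∀ y ∉ E, φ n x ≤ φ n y →
        diffQuot (fun x => φ n x * w x) x y ≤ ENNReal.ofReal (B n x) + ENNReal.ofReal (B n y) := by
      intro x hx y hy hxy
      rw [← ENNReal.ofReal_add (hB0 n x) (hB0 n y)]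
      refine diffQuot_le_ofReal ?_
      -- The factor of `w y - w x` is the smaller of the two cutoff values.
      have h1 : φ n y * w y - φ n x * w x = φ n x * (w y - w x) + w y * (φ n y - φ n x) := by ring
      have h2 : |φ n x * (w y - w x)| ≤ (φ n x * g x + φ n y * g y) * dist y x := by
        rw [abs_mul, abs_of_nonneg (hφ0 n x)]
        calc φ n x * |w y - w x| ≤ φ n x * ((g y + g x) * dist y x) :=
              mul_le_mul_of_nonneg_left (hle y hy x hx) (hφ0 n x)
          _ = (φ n x * g x + φ n x * g y) * dist y x := by ring
          _ ≤ _ := by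
            have := hg.nonneg y
            gcongr
      have h3 : |w y * (φ n y - φ n x)| ≤ |w y| / R n * dist y x := by
        rw [abs_mul, div_mul_eq_mul_div, mul_div_assoc]
        exact mul_le_mul_of_nonneg_left (hφK n x y) (abs_nonneg _)
      rw [h1]
      refine (abs_add_le _ _).trans ((add_le_add h2 h3).trans ?_)
      rw [← add_mul]
      refine mul_le_mul_of_nonneg_right ?_ dist_nonneg
      have h4 := mul_nonneg (hφ0 n x) (abs_nonneg (w x))
      have h5 := mul_nonneg (hφ0 n y) (abs_nonneg (w y))
      have h6 : 0 ≤ |w x| / R n := by positivity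
      simp only [hB]
      linarith
    intro x hx y hy
    rcases le_total (φ n x) (φ n y) with h | h
    · exact key x hx y hy h
    · rw [diffQuot_comm, add_comm]
      exact key y hy x hx h

end Density

/-! ### Lipschitz functions as elements of `M^{1,p}` -/

section Embedding

variable {X : Type*} [MetricSpace X] [MeasurableSpace X] {μ : Measure X} {p : ℝ≥0∞}

theorem HajlaszSobolev.norm_def [Fact (1 ≤ p)] (u : HajlaszSobolev μ p) :
    ‖u‖ = (eLpNorm u.1 p μ).toReal + hajlaszEnergy μ p u.1 := rfl

theorem HajlaszSobolev.norm_le [Fact (1 ≤ p)] (hp : p ≠ ∞) (u : HajlaszSobolev μ p) {v : X → ℝ}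
    (huv : u.1 =ᵐ[μ] v) {G : X → ℝ≥0∞} (hG : IsHajlaszBound μ v G) {a b : ℝ} (ha0 : 0 ≤ a)
    (hb0 : 0 ≤ b) (ha : eLpNorm v p μ ≤ ENNReal.ofReal a) (hb : eLpNorm G p μ ≤ ENNReal.ofReal b) :
    ‖u‖ ≤ a + b := by
  have hp0 : p ≠ 0 := (one_pos.trans_le (Fact.out : 1 ≤ p)).ne'
  rw [HajlaszSobolev.norm_def]
  refine add_le_add ?_ ?_
  · rw [eLpNorm_congr_ae huv]
    exact ENNReal.toReal_le_of_le_ofReal ha0 ha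
  · refine ((hG.congr huv.symm).hajlaszEnergy_le hp0 hp
      (hb.trans_lt ENNReal.ofReal_lt_top).ne).trans ?_
    exact ENNReal.toReal_le_of_le_ofReal hb0 hb

theorem HajlaszSobolev.eLpNorm_le [Fact (1 ≤ p)] (u : HajlaszSobolev μ p) :
    eLpNorm u.1 p μ ≤ ENNReal.ofReal ‖u‖ := by
  rw [← ENNReal.ofReal_toReal (Lp.memLp u.1).eLpNorm_ne_top, HajlaszSobolev.norm_def]
  exact ENNReal.ofReal_le_ofReal (le_add_of_nonneg_right hajlaszEnergy_nonneg)

theorem HajlaszSobolev.exists_isHajlaszGradient_of_norm_lt [Fact (1 ≤ p)] (u : HajlaszSobolev μ p)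
    {a : ℝ} (ha : ‖u‖ < a) :
    ∃ g, IsHajlaszGradient μ p u.1 g ∧ eLpNorm g p μ ≤ ENNReal.ofReal a := by
  obtain ⟨g, hg⟩ := u.2
  have h1 : hajlaszEnergy μ p u.1 < a := by
    rw [HajlaszSobolev.norm_def] at ha
    linarith [(ENNReal.toReal_nonneg : 0 ≤ (eLpNorm u.1 p μ).toReal)]
  obtain ⟨_, ⟨g', hg', rfl⟩, hlt⟩ := exists_lt_of_csInf_lt
    (s := {a | ∃ g, IsHajlaszGradient μ p u.1 g ∧ a = (eLpNorm g p μ).toReal}) ⟨_, g, hg, rfl⟩ h1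
  refine ⟨g', hg', ?_⟩
  rw [← ENNReal.ofReal_toReal hg'.memLp.eLpNorm_ne_top]
  exact ENNReal.ofReal_le_ofReal hlt.le

variable [BorelSpace X] [TopologicalSpace.SeparableSpace X] [Nonempty X]

/-- The inclusion of the Lipschitz functions with bounded support into `M^{1,p}(X)`. -/
noncomputable def lipschitzToHajlasz (hμ : IsDoublingMeasure μ) (hp0 : p ≠ 0) (hp : p ≠ ∞) :
    boundedSupportLipschitz X →ₗ[ℝ] HajlaszSobolev μ p where
  toFun f := ⟨(memLp_of_mem_boundedSupportLipschitz hμ f.2).toLp f.1, by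
    obtain ⟨G, hG, hGfin⟩ := exists_isHajlaszBound_of_mem_boundedSupportLipschitz (p := p) hμ f.2
    obtain ⟨g, hg, -⟩ := hG.exists_isHajlaszGradient hp0 hp hGfin
    exact ⟨g, hg.congr (MemLp.coeFn_toLp _).symm⟩⟩
  map_add' _ _ := rfl
  map_smul' _ _ := rfl

theorem coeFn_lipschitzToHajlasz (hμ : IsDoublingMeasure μ) (hp0 : p ≠ 0) (hp : p ≠ ∞)
    (f : boundedSupportLipschitz X) : (lipschitzToHajlasz hμ hp0 hp f).1 =ᵐ[μ] f.1 :=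
  MemLp.coeFn_toLp (memLp_of_mem_boundedSupportLipschitz hμ f.2)

theorem denseRange_lipschitzToHajlasz [Fact (1 ≤ p)] (hμ : IsDoublingMeasure μ) (hp0 : p ≠ 0)
    (hp : p ≠ ∞) : DenseRange (lipschitzToHajlasz (X := X) (μ := μ) (p := p) hμ hp0 hp) := by
  have hp1 : 1 ≤ p := Fact.out
  refine Metric.denseRange_iff.2 fun u ε hε => ?_
  obtain ⟨g, hg⟩ := u.2
  have hδ : 0 < ENNReal.ofReal (ε / 5) := ENNReal.ofReal_pos.2 (by positivity)
  obtain ⟨w, ⟨K, hwK⟩, hwb, hw, h1, H, hH, hHn⟩ :=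
    exists_lipschitz_approx hp1 hp (Lp.memLp u.1) hg hδ
  obtain ⟨h, hh, -⟩ := hH.exists_isHajlaszGradient hp0 hp (hHn.trans_lt ENNReal.ofReal_lt_top).ne
  have hwg : IsHajlaszGradient μ p w (g + |(-1 : ℝ)| • h) := by
    have := hg.add (hh.smul (-1))
    refine this.congr (Eventually.of_forall fun x => ?_)
    simp
  obtain ⟨f, hf, h2, H', hH', hHn'⟩ := exists_boundedSupport_approx hp1 hp hwK hwb hw hwg hδ
  refine ⟨⟨f, hf⟩, ?_⟩
  rw [dist_eq_norm]
  have e : (u - lipschitzToHajlasz hμ hp0 hp ⟨f, hf⟩).1 =ᵐ[μ] ((u.1 : X → ℝ) - w) + (w - f) := by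
    have h3 : (u - lipschitzToHajlasz hμ hp0 hp ⟨f, hf⟩).1 =ᵐ[μ]
        (u.1 : X → ℝ) - ((lipschitzToHajlasz hμ hp0 hp ⟨f, hf⟩).1 : X → ℝ) := Lp.coeFn_sub _ _
    filter_upwards [h3, coeFn_lipschitzToHajlasz hμ hp0 hp ⟨f, hf⟩] with x hx hx'
    rw [hx, Pi.sub_apply, hx']
    simp
  have hfm := (memLp_of_mem_boundedSupportLipschitz (p := p) hμ hf).1
  have h3 : eLpNorm (((u.1 : X → ℝ) - w) + (w - f)) p μ ≤ ENNReal.ofReal (2 * (ε / 5)) := by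
    rw [two_mul, ENNReal.ofReal_add (by positivity) (by positivity)]
    exact (eLpNorm_add_le ((Lp.memLp u.1).1.sub hw.1) (hw.1.sub hfm) hp1).trans (add_le_add h1 h2)
  have h4 : eLpNorm (H + H') p μ ≤ ENNReal.ofReal (2 * (ε / 5)) := by
    rw [two_mul, ENNReal.ofReal_add (by positivity) (by positivity)]
    exact (eLpNorm_add_le_of_aemeasurable hH.1 hH'.1 hp1).trans (add_le_add hHn hHn')
  have := HajlaszSobolev.norm_le hp _ e (hH.add hH') (by positivity) (by positivity) h3 h4
  linarith

end Embedding

/-! ### Averaging functions that live at different scales -/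

section Averaging

theorem half_mul_add_half_mul_le_of_large_scale (l m a b d : ℝ≥0∞) :
    2⁻¹ * (l + m) + 2⁻¹ * a ≤ l + (2⁻¹ * m + (b + d + a)) := by
  have h : ∀ t : ℝ≥0∞, 2⁻¹ * t ≤ t := fun t => mul_le_of_le_one_left zero_le (by simp)
  calc 2⁻¹ * (l + m) + 2⁻¹ * a = 2⁻¹ * l + (2⁻¹ * m + 2⁻¹ * a) := by rw [mul_add, add_assoc]
    _ ≤ l + (2⁻¹ * m + (b + d + a)) := by
      gcongr
      · exact h l
      · exact (h a).trans le_add_self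

theorem half_mul_add_half_mul_le_of_small_scale (l m a b d : ℝ≥0∞) :
    2⁻¹ * (l + d + b) + 2⁻¹ * (l + m) ≤ l + (2⁻¹ * m + (b + d + a)) := by
  have h : ∀ t : ℝ≥0∞, 2⁻¹ * t ≤ t := fun t => mul_le_of_le_one_left zero_le (by simp)
  calc 2⁻¹ * (l + d + b) + 2⁻¹ * (l + m)
      = (2⁻¹ * l + 2⁻¹ * l) + (2⁻¹ * m + (2⁻¹ * b + 2⁻¹ * d)) := by ring
    _ = l + (2⁻¹ * m + (2⁻¹ * b + 2⁻¹ * d)) := by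
      rw [← add_mul, ENNReal.inv_two_add_inv_two, one_mul]
    _ ≤ l + (2⁻¹ * m + (b + d + a)) := by
      exact add_le_add le_rfl (add_le_add le_rfl ((add_le_add (h b) (h d)).trans le_self_add))

variable {X : Type*} [MeasurableSpace X] {μ : Measure X} {p : ℝ≥0∞}

theorem eLpNorm_max_le (hp0 : p ≠ 0) (hp : p ≠ ∞) {f g : X → ℝ≥0∞} (hf : AEMeasurable f μ)
    {c : ℝ≥0∞} (hfc : eLpNorm f p μ ≤ c) (hgc : eLpNorm g p μ ≤ c) :
    eLpNorm (fun x => max (f x) (g x)) p μ ≤ 2 ^ (1 / p.toReal) * c := by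
  have ht := ENNReal.toReal_pos hp0 hp
  rw [eLpNorm_eq_lintegral_rpow hp0 hp]
  have h1 : ∫⁻ x, max (f x) (g x) ^ p.toReal ∂μ ≤ 2 * c ^ p.toReal := by
    calc _ ≤ ∫⁻ x, (f x ^ p.toReal + g x ^ p.toReal) ∂μ := by
          refine lintegral_mono fun x => ?_
          rcases le_total (f x) (g x) with h | h
          · simp only [max_eq_right h]; exact le_add_self
          · simp only [max_eq_left h]; exact le_self_add
      _ = ∫⁻ x, f x ^ p.toReal ∂μ + ∫⁻ x, g x ^ p.toReal ∂μ :=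
          lintegral_add_left' (hf.pow_const _) _
      _ ≤ c ^ p.toReal + c ^ p.toReal := by
          rw [lintegral_rpow_eq_eLpNorm_rpow hp0 hp, lintegral_rpow_eq_eLpNorm_rpow hp0 hp]
          gcongr
      _ = 2 * c ^ p.toReal := (two_mul _).symm
  calc _ ≤ (2 * c ^ p.toReal) ^ (1 / p.toReal) := by gcongr
    _ = _ := by
      rw [ENNReal.mul_rpow_of_nonneg _ _ (by positivity), ← ENNReal.rpow_mul,
        mul_one_div_cancel ht.ne', ENNReal.rpow_one]

theorem convex_setOf_eLpNorm_le (hp1 : 1 ≤ p) (c : ℝ≥0∞) {V : Submodule ℝ (X → ℝ)}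
    (hV : ∀ f ∈ V, AEStronglyMeasurable f μ) : Convex ℝ {f : V | eLpNorm f.1 p μ ≤ c} := by
  intro f hf g hg a b ha hb hab
  rw [mem_ofPred_eq] at hf hg ⊢
  refine (eLpNorm_add_le (f := a • f.1) (g := b • g.1) ((hV f.1 f.2).const_smul a)
    ((hV g.1 g.2).const_smul b) hp1).trans ?_
  rw [eLpNorm_const_smul, eLpNorm_const_smul, Real.enorm_of_nonneg ha, Real.enorm_of_nonneg hb]
  calc _ ≤ ENNReal.ofReal a * c + ENNReal.ofReal b * c := by gcongr
    _ = c := by rw [← add_mul, ← ENNReal.ofReal_add ha hb, hab, ENNReal.ofReal_one, one_mul]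

variable [MetricSpace X]

theorem convex_setOf_lipAt_le_add (hp1 : 1 ≤ p) (hp : p ≠ ∞) (l : X → ℝ≥0∞) (c : ℝ≥0∞)
    (V : Submodule ℝ (X → ℝ)) :
    Convex ℝ {f : V | ∃ d, AEMeasurable d μ ∧ eLpNorm d p μ ≤ c ∧
      ∀ᵐ x ∂μ, lipAt f.1 x ≤ l x + d x} := by
  have hp0 : p ≠ 0 := (one_pos.trans_le hp1).ne'
  rintro f ⟨d, hd, hdc, hf⟩ g ⟨e, he, hec, hg⟩ a b ha hb hab
  have hab' : ENNReal.ofReal a + ENNReal.ofReal b = 1 := by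
    rw [← ENNReal.ofReal_add ha hb, hab, ENNReal.ofReal_one]
  refine ⟨fun x => ENNReal.ofReal a * d x + ENNReal.ofReal b * e x,
    (hd.const_mul _).add (he.const_mul _), ?_, ?_⟩
  · refine (eLpNorm_add_le_of_aemeasurable (hd.const_mul _) (he.const_mul _) hp1).trans ?_
    rw [eLpNorm_const_mul_ennreal hp0 hp _ hd, eLpNorm_const_mul_ennreal hp0 hp _ he]
    calc _ ≤ ENNReal.ofReal a * c + ENNReal.ofReal b * c := by gcongr
      _ = c := by rw [← add_mul, hab', one_mul]
  · filter_upwards [hf, hg] with x h1 h2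
    change lipAt (a • f.1 + b • g.1) x ≤ _
    refine (lipAt_add_le _ _ _).trans ?_
    rw [lipAt_smul, lipAt_smul, abs_of_nonneg ha, abs_of_nonneg hb]
    calc _ ≤ ENNReal.ofReal a * (l x + d x) + ENNReal.ofReal b * (l x + e x) := by gcongr
      _ = (ENNReal.ofReal a + ENNReal.ofReal b) * l x +
          (ENNReal.ofReal a * d x + ENNReal.ofReal b * e x) := by ring
      _ = _ := by rw [hab', one_mul]

variable [BorelSpace X] [TopologicalSpace.SeparableSpace X]

theorem aestronglyMeasurable_of_mem_boundedSupportLipschitz {f : X → ℝ}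
    (hf : f ∈ boundedSupportLipschitz X) : AEStronglyMeasurable f μ := by
  have : SecondCountableTopology X := UniformSpace.secondCountable_of_separable X
  obtain ⟨⟨K, hK⟩, -⟩ := hf
  exact hK.continuous.aestronglyMeasurable

theorem eLpNorm_le_of_mem_tailHull (hp1 : 1 ≤ p) {h : ℕ → boundedSupportLipschitz X} {k : ℕ}
    {c : ℝ≥0∞} (hh : ∀ j, k ≤ j → eLpNorm (h j).1 p μ ≤ c) {f : boundedSupportLipschitz X}
    (hf : f ∈ tailHull h k) : eLpNorm f.1 p μ ≤ c := by
  have hconv : Convex ℝ {f : boundedSupportLipschitz X | eLpNorm f.1 p μ ≤ c} :=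
    convex_setOf_eLpNorm_le (μ := μ) (V := boundedSupportLipschitz X) hp1 c
      fun _ hf => aestronglyMeasurable_of_mem_boundedSupportLipschitz hf
  exact tailHull_subset hconv hh hf

variable [Nonempty X]

/-- One averaging step: `f` is Lipschitz, hence controlled by `l` at small scales, and a function
`f'` that comes much later in the sequence is small at all other scales. So a Hajłasz gradient of
`(f + f') / 2` need only accommodate one of the two at each scale, and the excess over `l` drops by
the factor `2 ^ (1 / p) / 2 < 1`. -/
theorem exists_mem_tailHull_excess_le_half (hμ : IsDoublingMeasure μ) (hp1 : 1 ≤ p) (hp : p ≠ ∞)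
    {h : ℕ → boundedSupportLipschitz X} {l : X → ℝ≥0∞} (hl : AEMeasurable l μ)
    (h0 : Tendsto (fun j => eLpNorm (h j).1 p μ) atTop (𝓝 0))
    (hlip : ∀ η : ℝ≥0∞, 0 < η → ∃ k, ∀ j, k ≤ j → ∃ d, AEMeasurable d μ ∧ eLpNorm d p μ ≤ η ∧
      ∀ᵐ x ∂μ, lipAt (h j).1 x ≤ l x + d x) {c : ℝ≥0∞}
    (hc : ∀ k, ∃ H ∈ tailHull h k, ∃ D, AEMeasurable D μ ∧ eLpNorm D p μ ≤ c ∧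
      IsHajlaszBound μ H.1 fun x => l x + D x) {η : ℝ≥0∞} (hη : 0 < η) (k : ℕ) :
    ∃ H ∈ tailHull h k, ∃ D, AEMeasurable D μ ∧
      eLpNorm D p μ ≤ 2⁻¹ * (2 ^ (1 / p.toReal) * c) + (η + η + η) ∧
      IsHajlaszBound μ H.1 fun x => l x + D x := by
  have hp0 : p ≠ 0 := (one_pos.trans_le hp1).ne'
  obtain ⟨k₁, hk₁⟩ := hlip η hη
  obtain ⟨f, hf, D, hDm, hDc, hD⟩ := hc (max k k₁)
  have hfd := tailHull_subset (convex_setOf_lipAt_le_add (μ := μ) hp1 hp l η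
    (boundedSupportLipschitz X)) (fun j hj => hk₁ j ((le_max_right _ _).trans hj)) hf
  rw [mem_ofPred_eq] at hfd
  obtain ⟨d, hdm, hdη, hd⟩ := hfd
  obtain ⟨r, hr, -, β, hβm, hβη, hβ⟩ := exists_lipScale_le_add hμ hp0 hp f.2 hη one_pos
  have hr' : ENNReal.ofReal r ≠ 0 := (ENNReal.ofReal_pos.2 hr).ne'
  obtain ⟨k₂, hk₂⟩ := eventually_atTop.1 (h0.eventually (ge_mem_nhds
    (ENNReal.mul_pos hr' hη.ne')))
  obtain ⟨f', hf', D', hDm', hDc', hD'⟩ := hc (max k k₂)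
  have hf'n : eLpNorm f'.1 p μ ≤ ENNReal.ofReal r * η :=
    eLpNorm_le_of_mem_tailHull hp1 (fun j hj => hk₂ j ((le_max_right _ _).trans hj)) hf'
  have hf'm := aestronglyMeasurable_of_mem_boundedSupportLipschitz (μ := μ) f'.2
  set a : X → ℝ≥0∞ := fun x => ENNReal.ofReal (|f'.1 x| / r) with ha
  have ham : AEMeasurable a μ := by
    have := hf'm.aemeasurable.norm.div_const r
    simpa only [Real.norm_eq_abs] using this.ennreal_ofReal
  have haη : eLpNorm a p μ ≤ η := by
    have h1 : eLpNorm a p μ = (ENNReal.ofReal r)⁻¹ * eLpNorm f'.1 p μ := by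
      have h2 : eLpNorm a p μ = eLpNorm (r⁻¹ • f'.1) p μ := by
        refine eLpNorm_congr_enorm_ae (Eventually.of_forall fun x => ?_)
        rw [enorm_eq_self, Real.enorm_eq_ofReal_abs, Pi.smul_apply, smul_eq_mul, abs_mul, abs_inv,
          abs_of_pos hr, ha, inv_mul_eq_div]
      rw [h2, eLpNorm_const_smul, Real.enorm_of_nonneg (by positivity),
        ENNReal.ofReal_inv_of_pos hr]
    rw [h1]
    calc _ ≤ (ENNReal.ofReal r)⁻¹ * (ENNReal.ofReal r * η) := by gcongr
      _ = η := by
        rw [← mul_assoc, ENNReal.inv_mul_cancel hr' ENNReal.ofReal_ne_top, one_mul]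
  set M : X → ℝ≥0∞ := fun x => max (D x) (D' x) with hM
  have hMm : AEMeasurable M μ := hDm.max hDm'
  have hsm : AEMeasurable (fun x => β x + d x + a x) μ := (hβm.add hdm).add ham
  have hDnew : AEMeasurable (fun x => 2⁻¹ * M x + (β x + d x + a x)) μ := (hMm.const_mul _).add hsm
  refine ⟨(1 / 2 : ℝ) • f + (1 / 2 : ℝ) • f', convex_tailHull h k
    (tailHull_anti h (le_max_left _ _) hf) (tailHull_anti h (le_max_left _ _) hf')
    (by norm_num) (by norm_num) (by norm_num), fun x => 2⁻¹ * M x + (β x + d x + a x), hDnew,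
    ?_, hl.add hDnew, ?_⟩
  · refine (eLpNorm_add_le_of_aemeasurable (hMm.const_mul _) hsm hp1).trans ?_
    rw [eLpNorm_const_mul_ennreal hp0 hp _ hMm]
    gcongr
    · exact eLpNorm_max_le hp0 hp hDm hDc hDc'
    · refine (eLpNorm_add_le_of_aemeasurable (hβm.add hdm) ham hp1).trans (add_le_add ?_ haη)
      exact (eLpNorm_add_le_of_aemeasurable hβm hdm hp1).trans (add_le_add hβη hdη)
  · obtain ⟨E, hE, hDE⟩ := hD.le
    obtain ⟨E', hE', hDE'⟩ := hD'.le
    refine ⟨E ∪ E' ∪ {x | lipAt f.1 x ≤ l x + d x}ᶜ,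
      measure_union_null (measure_union_null hE hE') hd, fun x hx y hy => ?_⟩
    simp only [mem_union, mem_compl_iff, mem_ofPred_eq, not_or, not_not] at hx hy
    have hQ : diffQuot ((1 / 2 : ℝ) • f + (1 / 2 : ℝ) • f' : boundedSupportLipschitz X).1 x y ≤
        2⁻¹ * diffQuot f.1 x y + 2⁻¹ * diffQuot f'.1 x y := by
      refine (diffQuot_add_le ((1 / 2 : ℝ) • f.1) ((1 / 2 : ℝ) • f'.1) x y).trans (le_of_eq ?_)
      rw [diffQuot_smul, diffQuot_smul]
      have : ENNReal.ofReal |(1 / 2 : ℝ)| = 2⁻¹ := by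
        rw [abs_of_pos (by norm_num), one_div, ENNReal.ofReal_inv_of_pos (by norm_num),
          ENNReal.ofReal_ofNat]
      rw [this]
    refine hQ.trans ?_
    rcases le_or_gt r (dist y x) with hxy | hxy
    · have h1 : diffQuot f.1 x y ≤ (l x + M x) + (l y + M y) := by
        refine (hDE x hx.1.1 y hy.1.1).trans ?_
        gcongr <;> exact le_max_left _ _
      have h2 : diffQuot f'.1 x y ≤ a x + a y := diffQuot_le_of_le_dist f'.1 hr hxy
      calc _ ≤ 2⁻¹ * ((l x + M x) + (l y + M y)) + 2⁻¹ * (a x + a y) := by gcongr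
        _ = (2⁻¹ * (l x + M x) + 2⁻¹ * a x) + (2⁻¹ * (l y + M y) + 2⁻¹ * a y) := by ring
        _ ≤ _ := add_le_add (half_mul_add_half_mul_le_of_large_scale _ _ _ _ _)
          (half_mul_add_half_mul_le_of_large_scale _ _ _ _ _)
    · have h1 : diffQuot f.1 x y ≤ l x + d x + β x :=
        (diffQuot_le_lipScale f.1 hxy).trans ((hβ x).trans (by gcongr; exact hx.2))
      have h2 : diffQuot f'.1 x y ≤ (l x + M x) + (l y + M y) := by
        refine (hDE' x hx.1.2 y hy.1.2).trans ?_
        gcongr <;> exact le_max_right _ _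
      calc _ ≤ 2⁻¹ * ((l x + d x + β x) + (l y + d y + β y)) +
            2⁻¹ * ((l x + M x) + (l y + M y)) := by
            gcongr
            exact h1.trans le_self_add
        _ = (2⁻¹ * (l x + d x + β x) + 2⁻¹ * (l x + M x)) +
            (2⁻¹ * (l y + d y + β y) + 2⁻¹ * (l y + M y)) := by ring
        _ ≤ _ := add_le_add (half_mul_add_half_mul_le_of_small_scale _ _ _ _ _)
          (half_mul_add_half_mul_le_of_small_scale _ _ _ _ _)

/-- If a bounded sequence in `M^{1,p}` tends to `0` in `L^p` and its pointwise Lipschitz constants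
are asymptotically dominated by `l`, then suitable convex combinations of its tails have Hajłasz
gradients that exceed `l` by arbitrarily little. -/
theorem exists_mem_tailHull_excess_le (hμ : IsDoublingMeasure μ) (hp1 : 1 < p) (hp : p ≠ ∞)
    {h : ℕ → boundedSupportLipschitz X} {l : X → ℝ≥0∞} (hl : AEMeasurable l μ)
    (h0 : Tendsto (fun j => eLpNorm (h j).1 p μ) atTop (𝓝 0))
    (hlip : ∀ η : ℝ≥0∞, 0 < η → ∃ k, ∀ j, k ≤ j → ∃ d, AEMeasurable d μ ∧ eLpNorm d p μ ≤ η ∧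
      ∀ᵐ x ∂μ, lipAt (h j).1 x ≤ l x + d x) {C : ℝ}
    (hC : ∀ j, ∃ G, IsHajlaszBound μ (h j).1 G ∧ eLpNorm G p μ ≤ ENNReal.ofReal C)
    {ε : ℝ≥0∞} (hε : 0 < ε) (k : ℕ) :
    ∃ H ∈ tailHull h k, ∃ D, AEMeasurable D μ ∧ eLpNorm D p μ ≤ ε ∧
      IsHajlaszBound μ H.1 fun x => l x + D x := by
  set P : ℝ → Prop := fun c => ∀ k, ∃ H ∈ tailHull h k, ∃ D, AEMeasurable D μ ∧
    eLpNorm D p μ ≤ ENNReal.ofReal c ∧ IsHajlaszBound μ H.1 fun x => l x + D x with hP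
  have ht1 : 1 < p.toReal := by
    rw [← ENNReal.toReal_one]
    exact (ENNReal.toReal_lt_toReal ENNReal.one_ne_top hp).2 hp1
  set θ : ℝ := 2⁻¹ * 2 ^ (1 / p.toReal) with hθ
  have hθ0 : 0 < θ := by positivity
  have hθ1 : θ < 1 := by
    have : (2 : ℝ) ^ (1 / p.toReal) < 2 ^ (1 : ℝ) :=
      Real.rpow_lt_rpow_of_exponent_lt (by norm_num) (by rw [div_lt_one (by linarith)]; exact ht1)
    rw [Real.rpow_one] at this
    rw [hθ]
    linarith
  have hstart : P (max C 0) := fun k => by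
    obtain ⟨G, hG, hGC⟩ := hC k
    refine ⟨h k, mem_tailHull_of_le h le_rfl, G, hG.1,
      hGC.trans (ENNReal.ofReal_le_ofReal (le_max_left _ _)), ?_⟩
    exact hG.mono (hl.add hG.1) (Eventually.of_forall fun x => le_add_self)
  have hstep : ∀ c, 0 ≤ c → P c → ∀ η, 0 < η → P (θ * c + η) := by
    intro c hc hPc η hη k
    have hη' : 0 < ENNReal.ofReal (η / 3) := ENNReal.ofReal_pos.2 (by positivity)
    obtain ⟨H, hH, D, hD, hDc, hb⟩ :=
      exists_mem_tailHull_excess_le_half hμ hp1.le hp hl h0 hlip hPc hη' k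
    refine ⟨H, hH, D, hD, hDc.trans (le_of_eq ?_), hb⟩
    have h2 : (2 : ℝ≥0∞) ^ (1 / p.toReal) = ENNReal.ofReal (2 ^ (1 / p.toReal)) := by
      rw [← ENNReal.ofReal_rpow_of_pos (by norm_num), ENNReal.ofReal_ofNat]
    have h3 : (2⁻¹ : ℝ≥0∞) = ENNReal.ofReal 2⁻¹ := by
      rw [ENNReal.ofReal_inv_of_pos (by norm_num), ENNReal.ofReal_ofNat]
    rw [h2, h3, ← ENNReal.ofReal_mul (by positivity), ← ENNReal.ofReal_mul (by positivity),
      ← ENNReal.ofReal_add (by positivity) (by positivity),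
      ← ENNReal.ofReal_add (by positivity) (by positivity),
      ← ENNReal.ofReal_add (by positivity) (by positivity)]
    congr 1
    rw [hθ]
    ring
  -- The infimum of the admissible bounds is `0`, as it does not exceed its multiple by `θ < 1`.
  set S : Set ℝ := {c | 0 ≤ c ∧ P c} with hS
  have hSne : S.Nonempty := ⟨_, le_max_right _ _, hstart⟩
  have hSb : BddBelow S := ⟨0, fun c hc => hc.1⟩
  have hκ0 : 0 ≤ sInf S := le_csInf hSne fun c hc => hc.1
  have hκ : ∀ c ∈ S, sInf S ≤ θ * c := fun c hc =>
    le_of_forall_pos_le_add fun η hη =>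
      csInf_le hSb ⟨by have := hc.1; positivity, hstep c hc.1 hc.2 η hη⟩
  have hκ' : sInf S / θ ≤ sInf S := le_csInf hSne fun c hc => by
    rw [div_le_iff₀' hθ0]
    exact hκ c hc
  rw [div_le_iff₀ hθ0] at hκ'
  have hκz : sInf S = 0 := by nlinarith
  obtain ⟨e, he0, heε⟩ : ∃ e : ℝ, 0 < e ∧ ENNReal.ofReal e ≤ ε := by
    rcases eq_or_ne ε ∞ with rfl | hne
    · exact ⟨1, one_pos, le_top⟩
    · exact ⟨ε.toReal, ENNReal.toReal_pos hε.ne' hne, (ENNReal.ofReal_toReal hne).le⟩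
  obtain ⟨c, hc, hce⟩ := exists_lt_of_csInf_lt hSne (hκz.trans_lt he0)
  obtain ⟨H, hH, D, hD, hDc, hb⟩ := hc.2 k
  exact ⟨H, hH, D, hD, hDc.trans ((ENNReal.ofReal_le_ofReal hce.le).trans heε), hb⟩

end Averaging

/-! ### Linear combinations of coordinate functions -/

section LinForm

variable {X : Type*} {n : ℕ} {ξ : X → EuclideanSpace ℝ (Fin n)}

/-- The function `y ↦ v · ξ y`, as a linear map of `v`. -/
noncomputable def linForm (ξ : X → EuclideanSpace ℝ (Fin n)) :
    EuclideanSpace ℝ (Fin n) →ₗ[ℝ] X → ℝ where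
  toFun v y := inner ℝ v (ξ y)
  map_add' v w := by ext y; exact inner_add_left v w (ξ y)
  map_smul' c v := by ext y; exact real_inner_smul_left v (ξ y) c

theorem linForm_apply (v : EuclideanSpace ℝ (Fin n)) (y : X) : linForm ξ v y = inner ℝ v (ξ y) :=
  rfl

variable [MetricSpace X] {Λ : ℝ≥0}

theorem abs_linForm_sub_le (hξ : LipschitzWith Λ ξ) (v : EuclideanSpace ℝ (Fin n)) (x y : X) :
    |linForm ξ v y - linForm ξ v x| ≤ Λ * ‖v‖ * dist y x := by
  rw [linForm_apply, linForm_apply, ← inner_sub_right]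
  refine (abs_real_inner_le_norm _ _).trans ?_
  have h := hξ.dist_le_mul y x
  rw [dist_eq_norm] at h
  calc _ ≤ ‖v‖ * (Λ * dist y x) := by gcongr
    _ = _ := by ring

theorem lipScale_linForm_le (hξ : LipschitzWith Λ ξ) (v : EuclideanSpace ℝ (Fin n)) (r : ℝ)
    (x : X) : lipScale (linForm ξ v) r x ≤ ENNReal.ofReal (Λ * ‖v‖) :=
  lipScale_le fun y _ => diffQuot_le_ofReal (abs_linForm_sub_le hξ v x y)

theorem lipAt_linForm_le (hξ : LipschitzWith Λ ξ) (v : EuclideanSpace ℝ (Fin n)) (x : X) :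
    lipAt (linForm ξ v) x ≤ ENNReal.ofReal (Λ * ‖v‖) :=
  (lipAt_le_lipScale _ x one_pos).trans (lipScale_linForm_le hξ v 1 x)

theorem lipAt_linForm_le_add (hξ : LipschitzWith Λ ξ) (v w : EuclideanSpace ℝ (Fin n)) (x : X) :
    lipAt (linForm ξ v) x ≤ lipAt (linForm ξ w) x + ENNReal.ofReal (Λ * ‖v - w‖) := by
  have e : linForm ξ v = linForm ξ w + linForm ξ (v - w) := by rw [← map_add]; congr 1; abel
  rw [e]
  refine (lipAt_add_le _ _ _).trans ?_
  gcongr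
  exact lipAt_linForm_le hξ _ x

theorem continuous_lipAt_linForm (hξ : LipschitzWith Λ ξ) (x : X) :
    Continuous fun v : EuclideanSpace ℝ (Fin n) => lipAt (linForm ξ v) x := by
  have hfin : ∀ v, lipAt (linForm ξ v) x ≠ ∞ := fun v =>
    ((lipAt_linForm_le hξ v x).trans_lt ENNReal.ofReal_lt_top).ne
  have hL : LipschitzWith Λ fun v : EuclideanSpace ℝ (Fin n) => (lipAt (linForm ξ v) x).toReal := by
    refine LipschitzWith.of_le_add_mul Λ fun v w => ?_
    have h := ENNReal.toReal_mono (ENNReal.add_ne_top.2 ⟨hfin w, ENNReal.ofReal_ne_top⟩)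
      (lipAt_linForm_le_add hξ v w x)
    rwa [ENNReal.toReal_add (hfin w) ENNReal.ofReal_ne_top,
      ENNReal.toReal_ofReal (by positivity), ← dist_eq_norm] at h
  have h := ENNReal.continuous_ofReal.comp hL.continuous
  refine h.congr fun v => ?_
  exact ENNReal.ofReal_toReal (hfin v)

theorem lipAt_linForm_smul (c : ℝ) (v : EuclideanSpace ℝ (Fin n)) (x : X) :
    lipAt (linForm ξ (c • v)) x = ENNReal.ofReal |c| * lipAt (linForm ξ v) x := by
  rw [map_smul, lipAt_smul]

/-- The space of those `v` for which `v · ξ` is constant to first order at `x`. -/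
noncomputable def linFormKer (ξ : X → EuclideanSpace ℝ (Fin n)) (x : X) :
    Submodule ℝ (EuclideanSpace ℝ (Fin n)) where
  carrier := {v | lipAt (linForm ξ v) x = 0}
  add_mem' {v w} hv hw := by
    rw [mem_ofPred_eq] at hv hw ⊢
    rw [map_add, ← nonpos_iff_eq_zero]
    refine (lipAt_add_le _ _ _).trans ?_
    rw [hv, hw, add_zero]
  zero_mem' := by rw [mem_ofPred_eq, map_zero, lipAt_zero]
  smul_mem' c v hv := by
    rw [mem_ofPred_eq] at hv ⊢
    rw [lipAt_linForm_smul, hv, mul_zero]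

theorem mem_linFormKer {v : EuclideanSpace ℝ (Fin n)} {x : X} :
    v ∈ linFormKer ξ x ↔ lipAt (linForm ξ v) x = 0 := Iff.rfl

theorem exists_pos_le_lipAt_linForm (hξ : LipschitzWith Λ ξ) {x : X} (hx : linFormKer ξ x = ⊥) :
    ∃ l : ℕ, ∀ v, ENNReal.ofReal (1 / ((l : ℝ) + 1) * ‖v‖) ≤ lipAt (linForm ξ v) x := by
  have key : ∃ m : ℝ≥0∞, 0 < m ∧ ∀ v ∈ Metric.sphere (0 : EuclideanSpace ℝ (Fin n)) 1,
      m ≤ lipAt (linForm ξ v) x := by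
    rcases (Metric.sphere (0 : EuclideanSpace ℝ (Fin n)) 1).eq_empty_or_nonempty with h | h
    · exact ⟨1, one_pos, by simp [h]⟩
    · obtain ⟨v, hv, hmin⟩ := (isCompact_sphere (0 : EuclideanSpace ℝ (Fin n)) 1).exists_isMinOn h
        (continuous_lipAt_linForm hξ x).continuousOn
      refine ⟨_, pos_iff_ne_zero.2 fun h0 => ?_, fun w hw => hmin hw⟩
      have h1 : v ∈ linFormKer ξ x := h0
      rw [hx, Submodule.mem_bot] at h1
      rw [h1] at hv
      simp at hv
  obtain ⟨m, hm, hle⟩ := key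
  obtain ⟨l, hl⟩ := ENNReal.exists_inv_nat_lt hm.ne'
  refine ⟨l, fun v => ?_⟩
  rcases eq_or_ne v 0 with rfl | hv
  · simp
  have hv' : 0 < ‖v‖ := norm_pos_iff.2 hv
  have hs := hle (‖v‖⁻¹ • v) (by
    rw [mem_sphere_zero_iff_norm, norm_smul, norm_inv, norm_norm, inv_mul_cancel₀ hv'.ne'])
  have e : v = ‖v‖ • (‖v‖⁻¹ • v) := by rw [smul_smul, mul_inv_cancel₀ hv'.ne', one_smul]
  conv_rhs => rw [e]
  rw [lipAt_linForm_smul, abs_of_pos hv', mul_comm, ENNReal.ofReal_mul hv'.le]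
  gcongr
  refine le_trans ?_ (hl.le.trans hs)
  rw [one_div, ENNReal.ofReal_inv_of_pos (by positivity), ENNReal.inv_le_inv]
  rw [ENNReal.ofReal_add (by positivity) zero_le_one, ENNReal.ofReal_natCast]
  exact le_self_add

variable [TopologicalSpace.SeparableSpace X] [MeasurableSpace X] [BorelSpace X]

theorem measurable_lipAt_linForm (hξ : LipschitzWith Λ ξ) (v : EuclideanSpace ℝ (Fin n)) :
    Measurable fun x => lipAt (linForm ξ v) x := by
  refine measurable_lipAt ?_
  exact continuous_const.inner hξ.continuous

theorem norm_sub_starProjection_lt_iff {E : Type*} [NormedAddCommGroup E] [InnerProductSpace ℝ E]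
    (U : Submodule ℝ E) [U.HasOrthogonalProjection] (u : E) (a : ℝ) :
    ‖u - U.starProjection u‖ < a ↔ ∃ w ∈ U, ‖u - w‖ < a := by
  constructor
  · intro h
    exact ⟨_, Submodule.starProjection_apply_mem U u, h⟩
  · rintro ⟨w, hw, h⟩
    refine lt_of_le_of_lt ?_ h
    rw [Submodule.starProjection_minimal]
    exact ciInf_le ⟨0, by rintro _ ⟨v, rfl⟩; exact norm_nonneg _⟩ (⟨w, hw⟩ : U)

/-- The distance of `u` to the kernel is less than `a` if and only if, for some rational `b < a`,
the ball of radius `b` around `u` has elements `q` of a countable dense set with arbitrarily small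
`lipAt (linForm ξ q) x`. This is a countable condition. -/
theorem measurable_norm_sub_starProjection_linFormKer (hξ : LipschitzWith Λ ξ)
    (u : EuclideanSpace ℝ (Fin n)) :
    Measurable fun x => ‖u - (linFormKer ξ x).starProjection u‖ := by
  refine measurable_of_Iio fun a => ?_
  set e := TopologicalSpace.denseSeq (EuclideanSpace ℝ (Fin n)) with he
  have hset : (fun x => ‖u - (linFormKer ξ x).starProjection u‖) ⁻¹' Iio a =
      ⋃ b : {b : ℚ // (b : ℝ) < a}, ⋂ m : ℕ, ⋃ k : {k : ℕ // dist (e k) u < (b.1 : ℝ)},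
        {x | lipAt (linForm ξ (e k.1)) x < ((m : ℝ≥0∞) + 1)⁻¹} := by
    ext x
    simp only [mem_preimage, mem_Iio, norm_sub_starProjection_lt_iff, mem_iUnion, mem_iInter,
      mem_ofPred_eq]
    constructor
    · rintro ⟨w, hw, hwa⟩
      obtain ⟨b, hb, hba⟩ := exists_rat_btwn hwa
      refine ⟨⟨b, hba⟩, fun m => ?_⟩
      have h1 : IsOpen ({v | lipAt (linForm ξ v) x < ((m : ℝ≥0∞) + 1)⁻¹} ∩ Metric.ball u (b : ℝ)) :=
        (isOpen_lt (continuous_lipAt_linForm hξ x) continuous_const).inter Metric.isOpen_ball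
      have h2 : w ∈ {v | lipAt (linForm ξ v) x < ((m : ℝ≥0∞) + 1)⁻¹} ∩ Metric.ball u (b : ℝ) := by
        refine ⟨?_, ?_⟩
        · rw [mem_ofPred_eq, mem_linFormKer.1 hw]
          exact ENNReal.inv_pos.2 (by finiteness)
        · rw [Metric.mem_ball, dist_comm, dist_eq_norm]
          exact hb
      obtain ⟨_, ⟨h3, h4⟩, k, rfl⟩ :=
        (TopologicalSpace.denseRange_denseSeq _).inter_open_nonempty _ h1 ⟨w, h2⟩
      exact ⟨⟨k, h4⟩, h3⟩
    · rintro ⟨⟨b, hba⟩, hb⟩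
      obtain ⟨⟨k, hk⟩, -⟩ := hb 0
      obtain ⟨w, hw, hmin⟩ := (isCompact_closedBall u (b : ℝ)).exists_isMinOn
        ⟨e k, hk.le⟩ (continuous_lipAt_linForm hξ x).continuousOn
      refine ⟨w, ?_, ?_⟩
      · rw [mem_linFormKer]
        by_contra h0
        obtain ⟨m, hm⟩ := ENNReal.exists_inv_nat_lt h0
        obtain ⟨⟨k', hk'⟩, hlt⟩ := hb m
        have h5 : lipAt (linForm ξ w) x ≤ lipAt (linForm ξ (e k')) x := hmin hk'.le
        refine absurd (h5.trans_lt hlt) (not_lt.2 (le_trans ?_ hm.le))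
        exact ENNReal.inv_le_inv.2 le_self_add
      · rw [← dist_eq_norm, dist_comm]
        exact lt_of_le_of_lt hw hba
  rw [hset]
  refine MeasurableSet.iUnion fun b => MeasurableSet.iInter fun m => MeasurableSet.iUnion fun k => ?_
  exact measurableSet_lt (measurable_lipAt_linForm hξ _) measurable_const

theorem measurable_starProjection_linFormKer (hξ : LipschitzWith Λ ξ)
    (u : EuclideanSpace ℝ (Fin n)) : Measurable fun x => (linFormKer ξ x).starProjection u := by
  have hsq : ∀ w, Measurable fun x => ‖(linFormKer ξ x).starProjection w‖ ^ 2 := by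
    intro w
    have h := ((measurable_norm_sub_starProjection_linFormKer hξ w).pow_const 2).const_sub (‖w‖ ^ 2)
    convert h using 1
    funext x
    have h1 := Submodule.norm_sq_eq_add_norm_sq_starProjection w (linFormKer ξ x)
    rw [Submodule.starProjection_orthogonal'] at h1
    simp only [sub_apply, one_apply_eq_self] at h1
    linarith
  have hin : ∀ w, Measurable fun x => inner ℝ w ((linFormKer ξ x).starProjection u) := by
    intro w
    have h := (((hsq (w + u)).sub (hsq w)).sub (hsq u)).div_const 2
    convert h using 1
    funext x
    have h1 := norm_add_sq_real ((linFormKer ξ x).starProjection w)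
      ((linFormKer ξ x).starProjection u)
    have h2 := Submodule.inner_starProjection_left_eq_right (linFormKer ξ x) w
      ((linFormKer ξ x).starProjection u)
    rw [Submodule.starProjection_eq_self_iff.2 (Submodule.starProjection_apply_mem _ u)] at h2
    simp only [Pi.sub_apply, map_add]
    rw [h1, h2]
    ring
  have hsum : ∀ x, (linFormKer ξ x).starProjection u = ∑ i, inner ℝ
      (EuclideanSpace.basisFun (Fin n) ℝ i) ((linFormKer ξ x).starProjection u) •
        EuclideanSpace.basisFun (Fin n) ℝ i := fun x =>
    ((EuclideanSpace.basisFun (Fin n) ℝ).sum_repr' _).symm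
  simp_rw [funext hsum]
  exact Finset.measurable_sum _ fun i _ => (hin _).smul_const _

variable {μ : Measure X} {Y : Set X}

/-- On a chart the coordinates are a.e. independent to first order. Otherwise the projections of
the basis vectors to the kernels `linFormKer ξ x` would be nonzero differentials of the zero
function. -/
theorem IsDiffChart.ae_linFormKer_eq_bot (hY : IsDiffChart μ Y ξ) :
    ∀ᵐ x ∂(μ.restrict Y), linFormKer ξ x = ⊥ := by
  obtain ⟨Λ, hξ⟩ := hY.lipschitz
  have h0 : IsDifferentialOn μ Y ξ 0 0 := by
    refine ⟨aestronglyMeasurable_const, Eventually.of_forall fun x => ?_⟩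
    rw [ptLip_eq_zero_iff_lipAt_eq_zero]
    convert lipAt_zero x using 2
    ext y
    simp
  have h1 : ∀ i, IsDifferentialOn μ Y ξ 0 fun x =>
      (linFormKer ξ x).starProjection (EuclideanSpace.basisFun (Fin n) ℝ i) := by
    intro i
    refine ⟨(measurable_starProjection_linFormKer hξ _).aestronglyMeasurable,
      Eventually.of_forall fun x => ?_⟩
    rw [ptLip_eq_zero_iff_lipAt_eq_zero]
    have h2 := mem_linFormKer.1 (Submodule.starProjection_apply_mem (linFormKer ξ x)
      (EuclideanSpace.basisFun (Fin n) ℝ i))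
    rw [← lipAt_neg] at h2
    convert h2 using 2
    ext y
    simp [linForm_apply]
  filter_upwards [ae_all_iff.2 fun i => hY.ae_eq (h1 i) h0] with x hx
  have h3 : (linFormKer ξ x).starProjection = 0 := by
    refine ContinuousLinearMap.coe_injective ?_
    exact (EuclideanSpace.basisFun (Fin n) ℝ).toBasis.ext fun i => by simpa using hx i
  refine (Submodule.eq_bot_iff _).2 fun v hv => ?_
  rw [← Submodule.starProjection_eq_self_iff.2 hv, h3]
  rfl

end LinForm

/-! ### Pieces with quantitatively independent coordinates -/

theorem norm_euclideanPad {n N : ℕ} (h : n ≤ N) (v : EuclideanSpace ℝ (Fin n)) :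
    ‖euclideanPad n N v‖ = ‖v‖ := by
  rw [EuclideanSpace.norm_eq, EuclideanSpace.norm_eq]
  congr 1
  symm
  refine Fintype.sum_of_injective (Fin.castLE h) (Fin.castLE_injective h) _ _ (fun i hi => ?_)
    fun i => ?_
  · have hi' : ¬ i.1 < n := fun hlt => hi ⟨⟨i.1, hlt⟩, rfl⟩
    simp [euclideanPad, hi']
  · simp [euclideanPad]

theorem IsDifferentialOn.mono {X : Type*} [MetricSpace X] [MeasurableSpace X] {μ : Measure X}
    {Y Z : Set X} {n : ℕ} {ξ : X → EuclideanSpace ℝ (Fin n)} {f : X → ℝ}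
    {G : X → EuclideanSpace ℝ (Fin n)} (h : IsDifferentialOn μ Y ξ f G) (hZ : Z ⊆ Y) :
    IsDifferentialOn μ Z ξ f G :=
  ⟨h.1.mono_set hZ, ae_restrict_of_ae_restrict_of_subset hZ h.2⟩

section Pieces

variable {X : Type*} [MetricSpace X] [MeasurableSpace X] {μ : Measure X} {Y Z W : Set X} {n : ℕ}
  {ξ : X → EuclideanSpace ℝ (Fin n)} {c : ℝ}

/-- A subset of a chart on which the coordinates are independent to first order with a uniform
constant: `c ‖v‖ ≤ Lip[v · ξ](x)`. -/
structure IsDiffPiece (μ : Measure X) (Z : Set X) (ξ : X → EuclideanSpace ℝ (Fin n)) (c : ℝ) :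
    Prop where
  nullMeasurableSet : NullMeasurableSet Z μ
  lipschitz : ∃ K : ℝ≥0, LipschitzWith K ξ
  pos : 0 < c
  le_lipAt : ∀ x ∈ Z, ∀ v, ENNReal.ofReal (c * ‖v‖) ≤ lipAt (linForm ξ v) x
  exists_differential : ∀ f : X → ℝ, (∃ K : ℝ≥0, LipschitzWith K f) →
    ∃ G, IsDifferentialOn μ Z ξ f G

theorem IsDiffPiece.mono (h : IsDiffPiece μ Z ξ c) (hW : NullMeasurableSet W μ) (hWZ : W ⊆ Z) :
    IsDiffPiece μ W ξ c where
  nullMeasurableSet := hW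
  lipschitz := h.lipschitz
  pos := h.pos
  le_lipAt x hx := h.le_lipAt x (hWZ hx)
  exists_differential f hf := by
    obtain ⟨G, hG⟩ := h.exists_differential f hf
    exact ⟨G, hG.mono hWZ⟩

theorem IsDifferentialOn.ae_lipAt_eq_zero {f : X → ℝ} {G : X → EuclideanSpace ℝ (Fin n)}
    (h : IsDifferentialOn μ Z ξ f G) (hZ : NullMeasurableSet Z μ) :
    ∀ᵐ x ∂μ, x ∈ Z → lipAt (f - linForm ξ (G x)) x = 0 := by
  have h1 := h.2
  rw [ae_restrict_iff'₀ hZ] at h1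
  filter_upwards [h1] with x hx hxZ
  exact ptLip_eq_zero_iff_lipAt_eq_zero.1 (hx hxZ)

theorem IsDiffChart.exists_pieces [BorelSpace X] [TopologicalSpace.SeparableSpace X]
    (hY : IsDiffChart μ Y ξ) : ∃ Z : ℕ → Set X,
      (∀ l, IsDiffPiece μ (Z l) ξ (1 / ((l : ℝ) + 1))) ∧ ∀ᵐ x ∂μ, x ∈ Y → ∃ l, x ∈ Z l := by
  obtain ⟨Λ, hξ⟩ := hY.lipschitz
  refine ⟨fun l => {x | x ∈ Y ∧ ∀ v, ENNReal.ofReal (1 / ((l : ℝ) + 1) * ‖v‖) ≤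
    lipAt (linForm ξ v) x}, fun l => ⟨?_, ⟨Λ, hξ⟩, by positivity, fun x hx => hx.2, fun f hf => ?_⟩,
    ?_⟩
  · set e := TopologicalSpace.denseSeq (EuclideanSpace ℝ (Fin n)) with he
    have hset : {x | x ∈ Y ∧ ∀ v, ENNReal.ofReal (1 / ((l : ℝ) + 1) * ‖v‖) ≤
        lipAt (linForm ξ v) x} = Y ∩ ⋂ k, {x | ENNReal.ofReal (1 / ((l : ℝ) + 1) * ‖e k‖) ≤
          lipAt (linForm ξ (e k)) x} := by
      ext x
      simp only [mem_ofPred_eq, mem_inter_iff, mem_iInter]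
      refine and_congr_right fun _ => ⟨fun h k => h _, fun h v => ?_⟩
      have hc : IsClosed {v : EuclideanSpace ℝ (Fin n) |
          ENNReal.ofReal (1 / ((l : ℝ) + 1) * ‖v‖) ≤ lipAt (linForm ξ v) x} :=
        isClosed_le (ENNReal.continuous_ofReal.comp (continuous_const.mul continuous_norm))
          (continuous_lipAt_linForm hξ x)
      have hr : range e ⊆ {v : EuclideanSpace ℝ (Fin n) |
          ENNReal.ofReal (1 / ((l : ℝ) + 1) * ‖v‖) ≤ lipAt (linForm ξ v) x} := by
        rintro _ ⟨k, rfl⟩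
        exact h k
      have h1 := closure_minimal hr hc
      rw [(TopologicalSpace.denseRange_denseSeq _).closure_range] at h1
      exact h1 (mem_univ v)
    change NullMeasurableSet {x | x ∈ Y ∧ ∀ v, ENNReal.ofReal (1 / ((l : ℝ) + 1) * ‖v‖) ≤
        lipAt (linForm ξ v) x} μ
    rw [hset]
    exact hY.nullMeasurableSet.inter (MeasurableSet.iInter fun k =>
      measurableSet_le measurable_const (measurable_lipAt_linForm hξ _)).nullMeasurableSet
  · obtain ⟨G, hG, -⟩ := hY.existsUnique_differential f hf
    exact ⟨G, hG.mono fun x hx => hx.1⟩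
  · have h := hY.ae_linFormKer_eq_bot
    rw [ae_restrict_iff'₀ hY.nullMeasurableSet] at h
    filter_upwards [h] with x hx hxY
    obtain ⟨l, hl⟩ := exists_pos_le_lipAt_linForm hξ (hx hxY)
    exact ⟨l, hxY, hl⟩

/-- A partition of `X`, up to a null set, into pieces of charts. -/
structure DiffPartition {X : Type*} [MetricSpace X] [MeasurableSpace X] (μ : Measure X) where
  piece : ℕ → Set X
  dim : ℕ → ℕ
  coord : ∀ k, X → EuclideanSpace ℝ (Fin (dim k))
  const : ℕ → ℝ
  isDiffPiece : ∀ k, IsDiffPiece μ (piece k) (coord k) (const k)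
  disjoint : Pairwise (Function.onFun Disjoint piece)
  ae_exists_mem : ∀ᵐ x ∂μ, ∃ k, x ∈ piece k
  N : ℕ
  dim_le : ∀ k, dim k ≤ N

theorem DiffAtlas.nonempty_diffPartition [BorelSpace X] [TopologicalSpace.SeparableSpace X]
    {ι : Type*} [Countable ι] [Nonempty ι] (A : DiffAtlas μ ι) : Nonempty (DiffPartition μ) := by
  choose Z hZ hcov using fun m => (A.isDiffChart m).exists_pieces
  obtain ⟨e, he⟩ := exists_surjective_nat (ι × ℕ)
  set W : ℕ → Set X := fun k => Z (e k).1 (e k).2 with hW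
  have hWn : ∀ k, NullMeasurableSet (W k) μ := fun k => (hZ _ _).nullMeasurableSet
  refine ⟨⟨disjointed W, fun k => A.dim (e k).1, fun k => A.coord (e k).1,
    fun k => 1 / (((e k).2 : ℝ) + 1), fun k => ?_, disjoint_disjointed W, ?_, A.N,
    fun k => A.dim_le _⟩⟩
  · exact (hZ (e k).1 (e k).2).mono (NullMeasurableSet.disjointed hWn k) (disjointed_subset W k)
  · have h1 : ∀ᵐ x ∂μ, x ∈ ⋃ m, A.carrier m := A.measure_compl
    filter_upwards [h1, ae_all_iff.2 hcov] with x hx hx'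
    obtain ⟨m, hm⟩ := mem_iUnion.1 hx
    obtain ⟨l, hl⟩ := hx' m hm
    obtain ⟨k, hk⟩ := he (m, l)
    have h2 : x ∈ ⋃ k, W k := mem_iUnion.2 ⟨k, by simpa only [hW, hk] using hl⟩
    rw [← iUnion_disjointed] at h2
    exact mem_iUnion.1 h2

namespace DiffPartition

/-- `G` is the differential of `f` with respect to the partition `P`, the differential on each
piece being multiplied by the independence constant of that piece. -/
structure IsDiff (P : DiffPartition μ) (f : X → ℝ) (G : X → EuclideanSpace ℝ (Fin P.N)) :
    Prop where
  aestronglyMeasurable : AEStronglyMeasurable G μ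
  ae_spec : ∀ᵐ x ∂μ, ∀ k, x ∈ P.piece k → ∃ v, G x = P.const k • euclideanPad (P.dim k) P.N v ∧
    lipAt (f - linForm (P.coord k) v) x = 0

variable (P : DiffPartition μ) {f g : X → ℝ} {F G : X → EuclideanSpace ℝ (Fin P.N)}

theorem exists_isDiff (hf : ∃ K : ℝ≥0, LipschitzWith K f) : ∃ G, P.IsDiff f G := by
  classical
  choose D hD using fun k => (P.isDiffPiece k).exists_differential f hf
  set G : X → EuclideanSpace ℝ (Fin P.N) := fun x =>
    if h : ∃ k, x ∈ P.piece k then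
      P.const h.choose • euclideanPad (P.dim h.choose) P.N (D h.choose x) else 0 with hG
  have hGk : ∀ k, ∀ x ∈ P.piece k, G x = P.const k • euclideanPad (P.dim k) P.N (D k x) := by
    intro k x hx
    have h : ∃ k, x ∈ P.piece k := ⟨k, hx⟩
    have e : h.choose = k := by
      by_contra hne
      exact (disjoint_left.1 (P.disjoint hne)) h.choose_spec hx
    simp only [hG, dif_pos h]
    rw [e]
  refine ⟨G, ?_, ?_⟩
  · have hU : μ.restrict (⋃ k, P.piece k) = μ := Measure.restrict_eq_self_of_ae_mem (by
      filter_upwards [P.ae_exists_mem] with x hx using mem_iUnion.2 hx)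
    suffices h : AEStronglyMeasurable G (μ.restrict (⋃ k, P.piece k)) by rwa [hU] at h
    refine aestronglyMeasurable_iUnion_iff.2 fun k => ?_
    have hpad : Continuous (euclideanPad (P.dim k) P.N) := LinearMap.continuous_of_finiteDimensional _
    refine AEStronglyMeasurable.congr
      ((hpad.comp_aestronglyMeasurable (hD k).1).const_smul (P.const k)) ?_
    filter_upwards [ae_restrict_mem₀ (P.isDiffPiece k).nullMeasurableSet] with x hx
    exact (hGk k x hx).symm
  · filter_upwards [ae_all_iff.2 fun k =>
      (hD k).ae_lipAt_eq_zero (P.isDiffPiece k).nullMeasurableSet] with x hx k hk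
    exact ⟨D k x, hGk k x hk, hx k hk⟩

variable {P}

theorem IsDiff.add (hf : P.IsDiff f F) (hg : P.IsDiff g G) : P.IsDiff (f + g) (F + G) := by
  refine ⟨hf.1.add hg.1, ?_⟩
  filter_upwards [hf.2, hg.2] with x h1 h2 k hk
  obtain ⟨v, hv, hv0⟩ := h1 k hk
  obtain ⟨w, hw, hw0⟩ := h2 k hk
  refine ⟨v + w, by rw [Pi.add_apply, hv, hw, map_add, smul_add], ?_⟩
  rw [map_add, add_sub_add_comm, ← nonpos_iff_eq_zero]
  refine (lipAt_add_le _ _ _).trans ?_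
  rw [hv0, hw0, add_zero]

theorem IsDiff.smul (a : ℝ) (hf : P.IsDiff f F) : P.IsDiff (a • f) (a • F) := by
  refine ⟨hf.1.const_smul a, ?_⟩
  filter_upwards [hf.2] with x h1 k hk
  obtain ⟨v, hv, hv0⟩ := h1 k hk
  refine ⟨a • v, by rw [Pi.smul_apply, hv, map_smul, smul_comm], ?_⟩
  rw [map_smul, ← smul_sub, lipAt_smul, hv0, mul_zero]

theorem IsDiff.enorm_le (hf : P.IsDiff f F) : ∀ᵐ x ∂μ, ‖F x‖ₑ ≤ lipAt f x := by
  filter_upwards [hf.2, P.ae_exists_mem] with x h1 ⟨k, hk⟩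
  obtain ⟨v, hv, hv0⟩ := h1 k hk
  have hc := (P.isDiffPiece k).pos
  rw [hv, ← ofReal_norm, norm_smul, Real.norm_of_nonneg hc.le, norm_euclideanPad (P.dim_le k)]
  refine ((P.isDiffPiece k).le_lipAt x hk v).trans ?_
  have h2 := lipAt_sub_le f (f - linForm (P.coord k) v) x
  rwa [sub_sub_cancel, hv0, add_zero] at h2

variable (P) in
theorem exists_lipAt_le_mul : ∃ a : X → ℝ≥0, ∀ (f : X → ℝ) (F : X → EuclideanSpace ℝ (Fin P.N)),
    P.IsDiff f F → ∀ᵐ x ∂μ, lipAt f x ≤ a x * ‖F x‖ₑ := by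
  classical
  choose Λ hΛ using fun k => (P.isDiffPiece k).lipschitz
  refine ⟨fun x => if h : ∃ k, x ∈ P.piece k then
    (Λ h.choose / P.const h.choose).toNNReal else 0, fun f F hf => ?_⟩
  filter_upwards [hf.2, P.ae_exists_mem] with x h1 h
  rw [dif_pos h]
  obtain ⟨v, hv, hv0⟩ := h1 _ h.choose_spec
  have hc := (P.isDiffPiece h.choose).pos
  have h2 := lipAt_add_le (f - linForm (P.coord h.choose) v) (linForm (P.coord h.choose) v) x
  rw [sub_add_cancel, hv0, zero_add] at h2
  refine h2.trans ((lipAt_linForm_le (hΛ _) v x).trans (le_of_eq ?_))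
  rw [hv, ← ofReal_norm, norm_smul, Real.norm_of_nonneg hc.le, norm_euclideanPad (P.dim_le _)]
  change _ = ENNReal.ofReal _ * _
  rw [← ENNReal.ofReal_mul (by positivity)]
  congr 1
  field_simp

theorem IsDiff.ae_eq (hf : P.IsDiff f F) (hg : P.IsDiff f G) : F =ᵐ[μ] G := by
  have h := (hf.add (hg.smul (-1))).enorm_le
  have e : f + (-1 : ℝ) • f = 0 := by simp
  rw [e] at h
  filter_upwards [h] with x hx
  rw [lipAt_zero, nonpos_iff_eq_zero, enorm_eq_zero] at hx
  simpa [← sub_eq_add_neg, sub_eq_zero] using hx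

variable [BorelSpace X] [TopologicalSpace.SeparableSpace X] [Nonempty X] {p : ℝ≥0∞}

omit P f g F G in
theorem eLpNorm_lipAt_ne_top (hμ : IsDoublingMeasure μ) (hp0 : p ≠ 0) (hp : p ≠ ∞) {f : X → ℝ}
    (hf : f ∈ boundedSupportLipschitz X) : eLpNorm (lipAt f) p μ ≠ ∞ := by
  obtain ⟨G, hG, hGp⟩ := exists_isHajlaszBound_of_mem_boundedSupportLipschitz (p := p) hμ hf
  obtain ⟨⟨K, hK⟩, -⟩ := hf
  have h := eLpNorm_le_of_ae_le (p := p) (hμ.lipAt_le_two_mul hK hG)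
  rw [eLpNorm_const_mul_ennreal hp0 hp _ hG.aemeasurable] at h
  exact ne_top_of_le_ne_top (ENNReal.mul_ne_top (by simp) hGp) h

/-- The differential as a linear map to `L^p`, comparable pointwise to the Lipschitz constant. -/
theorem exists_linearMap_Lp (P : DiffPartition μ) (hμ : IsDoublingMeasure μ) (hp0 : p ≠ 0)
    (hp : p ≠ ∞) :
    ∃ (T : boundedSupportLipschitz X →ₗ[ℝ] Lp (EuclideanSpace ℝ (Fin P.N)) p μ) (a : X → ℝ≥0),
      ∀ f : boundedSupportLipschitz X,
        ∀ᵐ x ∂μ, ‖T f x‖ₑ ≤ lipAt f.1 x ∧ lipAt f.1 x ≤ a x * ‖T f x‖ₑ := by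
  choose D hD using fun f : boundedSupportLipschitz X => P.exists_isDiff f.2.1
  obtain ⟨a, ha⟩ := P.exists_lipAt_le_mul
  have hmem : ∀ f, MemLp (D f) p μ := by
    intro f
    refine ⟨(hD f).1, lt_of_le_of_lt ?_ (eLpNorm_lipAt_ne_top hμ hp0 hp f.2).lt_top⟩
    refine eLpNorm_mono_enorm_ae ?_
    filter_upwards [(hD f).enorm_le] with x hx
    rwa [enorm_eq_self]
  refine ⟨⟨⟨fun f => (hmem f).toLp (D f), fun f g => ?_⟩, fun c f => ?_⟩, a, fun f => ?_⟩
  · rw [← MemLp.toLp_add, MemLp.toLp_eq_toLp_iff]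
    exact (hD (f + g)).ae_eq ((hD f).add (hD g))
  · rw [RingHom.id_apply, ← MemLp.toLp_const_smul, MemLp.toLp_eq_toLp_iff]
    exact (hD (c • f)).ae_eq ((hD f).smul c)
  · filter_upwards [(hmem f).coeFn_toLp, (hD f).enorm_le, ha f.1 _ (hD f)] with x h1 h2 h3
    change ‖(hmem f).toLp (D f) x‖ₑ ≤ _ ∧ _ ≤ _ * ‖(hmem f).toLp (D f) x‖ₑ
    rw [h1]
    exact ⟨h2, h3⟩

end DiffPartition

end Pieces

/-! ### Convex combinations that are Cauchy for the Lipschitz constant in `L^p` -/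

theorem tailHull_comp_strictMono {V : Type*} [AddCommGroup V] [Module ℝ V] {x y : ℕ → V}
    (h : ∀ k, y k ∈ tailHull x k) {ns : ℕ → ℕ} (hns : StrictMono ns) (k : ℕ) :
    y (ns k) ∈ tailHull x k :=
  tailHull_anti x (hns.id_le k) (h (ns k))

/-- An array of mutual distances `a i j ≤ ρ i + ρ j` with `ρ → 0` has limits along its rows; they
measure the distances to an ideal limit point. -/
theorem le_liminf_add_liminf {a : ℕ → ℕ → ℝ≥0∞} {ρ : ℕ → ℝ≥0∞} (hρ : Tendsto ρ atTop (𝓝 0))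
    (haρ : ∀ i j, a i j ≤ ρ i + ρ j) (htri : ∀ i j m, a i j ≤ a i m + a m j)
    (hsymm : ∀ i j, a i j = a j i) (i j : ℕ) :
    a i j ≤ liminf (a i) atTop + liminf (a j) atTop := by
  have key : ∀ i m, a i m ≤ liminf (a i) atTop + ρ m := by
    intro i m
    refine ENNReal.le_of_forall_pos_le_add fun η hη _ => ?_
    rw [add_assoc, ← tsub_le_iff_right]
    refine le_liminf_of_le ?_ ?_
    · isBoundedDefault
    · filter_upwards [ENNReal.tendsto_nhds_zero.1 hρ η (by exact_mod_cast hη)] with m' hm'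
      rw [tsub_le_iff_right]
      refine (htri i m m').trans ?_
      gcongr
      refine (haρ m' m).trans ?_
      rw [add_comm]
      gcongr
  have hlim : Tendsto (fun m => liminf (a i) atTop + liminf (a j) atTop + (ρ m + ρ m)) atTop
      (𝓝 (liminf (a i) atTop + liminf (a j) atTop + (0 + 0))) :=
    tendsto_const_nhds.add (hρ.add hρ)
  rw [add_zero, add_zero] at hlim
  refine ge_of_tendsto' hlim fun m => ?_
  refine (htri i j m).trans ?_
  rw [hsymm m j, add_add_add_comm]
  gcongr <;> exact key _ m

theorem eLpNorm_liminf_le {X : Type*} [MeasurableSpace X] {μ : Measure X} {p : ℝ≥0∞} (hp0 : p ≠ 0)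
    (hp : p ≠ ∞) {f : ℕ → X → ℝ≥0∞} (hf : ∀ j, AEMeasurable (f j) μ) {c : ℝ≥0∞}
    (hc : ∀ j, eLpNorm (f j) p μ ≤ c) :
    eLpNorm (fun x => liminf (fun j => f j x) atTop) p μ ≤ c := by
  have ht : 0 < p.toReal := ENNReal.toReal_pos hp0 hp
  rw [← ENNReal.rpow_le_rpow_iff ht, ← lintegral_rpow_eq_eLpNorm_rpow hp0 hp]
  have e : ∀ x, liminf (fun j => f j x) atTop ^ p.toReal =
      liminf (fun j => f j x ^ p.toReal) atTop := fun x =>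
    (ENNReal.orderIsoRpow p.toReal ht).liminf_apply
  simp_rw [e]
  refine (lintegral_liminf_le' fun j => (hf j).pow_const _).trans ?_
  refine liminf_le_of_le (by isBoundedDefault) fun b hb => ?_
  obtain ⟨j, hj⟩ := hb.exists
  refine hj.trans ?_
  rw [lintegral_rpow_eq_eLpNorm_rpow hp0 hp]
  exact ENNReal.rpow_le_rpow (hc j) ht.le

section CauchyHull

variable {X : Type*} [MeasurableSpace X] {μ : Measure X} {p : ℝ≥0∞}

theorem convex_setOf_ofReal_coeFn_le (s : X → ℝ≥0∞) :
    Convex ℝ {w : Lp ℝ p μ | ∀ᵐ x ∂μ, 0 ≤ w x ∧ ENNReal.ofReal (w x) ≤ s x} := by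
  intro w hw w' hw' a b ha hb hab
  rw [mem_ofPred_eq] at hw hw' ⊢
  filter_upwards [hw, hw', Lp.coeFn_add (a • w) (b • w'), Lp.coeFn_smul a w,
    Lp.coeFn_smul b w'] with x h1 h2 e1 e2 e3
  rw [e1, Pi.add_apply, e2, e3, Pi.smul_apply, Pi.smul_apply, smul_eq_mul, smul_eq_mul]
  refine ⟨add_nonneg (mul_nonneg ha h1.1) (mul_nonneg hb h2.1), ?_⟩
  rw [ENNReal.ofReal_add (mul_nonneg ha h1.1) (mul_nonneg hb h2.1), ENNReal.ofReal_mul ha,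
    ENNReal.ofReal_mul hb]
  calc _ ≤ ENNReal.ofReal a * s x + ENNReal.ofReal b * s x := by
        gcongr
        exacts [h1.2, h2.2]
    _ = s x := by
      rw [← add_mul, ← ENNReal.ofReal_add ha hb, hab, ENNReal.ofReal_one, one_mul]

variable [MetricSpace X]

theorem convex_setOf_lipAt_sub_le_ofReal (g : X → ℝ) (s : X → ℝ≥0∞) :
    Convex ℝ {w : boundedSupportLipschitz X × Lp ℝ p μ | ∀ᵐ x ∂μ, 0 ≤ w.2 x ∧
      lipAt (w.1.1 - g) x ≤ ENNReal.ofReal (w.2 x) + s x} := by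
  intro w hw w' hw' a b ha hb hab
  rw [mem_ofPred_eq] at hw hw' ⊢
  have hab' : ENNReal.ofReal a + ENNReal.ofReal b = 1 := by
    rw [← ENNReal.ofReal_add ha hb, hab, ENNReal.ofReal_one]
  filter_upwards [hw, hw', Lp.coeFn_add (a • w.2) (b • w'.2), Lp.coeFn_smul a w.2,
    Lp.coeFn_smul b w'.2] with x h1 h2 e1 e2 e3
  have e4 : (a • w + b • w').2 x = a * w.2 x + b * w'.2 x := by
    change (a • w.2 + b • w'.2) x = _
    rw [e1, Pi.add_apply, e2, e3]
    rfl
  have e5 : (a • w + b • w').1.1 - g = a • (w.1.1 - g) + b • (w'.1.1 - g) := by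
    change a • w.1.1 + b • w'.1.1 - g = _
    rw [smul_sub, smul_sub, sub_add_sub_comm, ← add_smul, hab, one_smul]
  rw [e4, e5]
  refine ⟨add_nonneg (mul_nonneg ha h1.1) (mul_nonneg hb h2.1), ?_⟩
  refine (lipAt_add_le _ _ _).trans ?_
  rw [lipAt_smul, lipAt_smul, abs_of_nonneg ha, abs_of_nonneg hb,
    ENNReal.ofReal_add (mul_nonneg ha h1.1) (mul_nonneg hb h2.1), ENNReal.ofReal_mul ha,
    ENNReal.ofReal_mul hb]
  calc _ ≤ ENNReal.ofReal a * (ENNReal.ofReal (w.2 x) + s x) +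
        ENNReal.ofReal b * (ENNReal.ofReal (w'.2 x) + s x) := by
        gcongr
        exacts [h1.2, h2.2]
    _ = ENNReal.ofReal a * ENNReal.ofReal (w.2 x) + ENNReal.ofReal b * ENNReal.ofReal (w'.2 x) +
        (ENNReal.ofReal a + ENNReal.ofReal b) * s x := by ring
    _ = _ := by rw [hab', one_mul]

variable [BorelSpace X] [TopologicalSpace.SeparableSpace X]

theorem measurable_lipAt_coe (f : boundedSupportLipschitz X) : Measurable (lipAt f.1) := by
  obtain ⟨⟨K, hK⟩, -⟩ := f.2
  exact measurable_lipAt hK.continuous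

/-- A first passage to convex combinations makes the differentials converge in `L^p` and a.e. The
Lipschitz constants are comparable to the differentials, but only with a constant that depends on
the point. So the mutual distances converge to zero a.e.; a second passage to convex
combinations, applied to the distances from the ideal limit, makes them converge in `L^p`. -/
theorem DiffPartition.exists_tailHull_lipAt_cauchy (P : DiffPartition μ) (hμ : IsDoublingMeasure μ)
    [Nonempty X] [Fact (1 ≤ p)] (hp1 : 1 < p) (hp : p < ∞) {h : ℕ → boundedSupportLipschitz X} {C : ℝ≥0}
    (hC : ∀ j, eLpNorm (lipAt (h j).1) p μ ≤ C) :
    ∃ y : ℕ → boundedSupportLipschitz X, (∀ k, y k ∈ tailHull h k) ∧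
      ∀ ε : ℝ≥0∞, 0 < ε → ∃ N, ∀ i, N ≤ i → ∀ j, N ≤ j →
        eLpNorm (lipAt ((y i).1 - (y j).1)) p μ ≤ ε := by
  have hp0 : p ≠ 0 := (one_pos.trans hp1).ne'
  obtain ⟨T, a, hT⟩ := P.exists_linearMap_Lp hμ hp0 hp.ne
  obtain ⟨y, hy, z, hz⟩ := (Lp_hasTailLimits (F := EuclideanSpace ℝ (Fin P.N)) (μ := μ)
    hp1 hp).exists_lift T h ⟨C, fun j => by
      rw [Lp.norm_def]
      refine ENNReal.toReal_le_coe_of_le_coe ((eLpNorm_mono_enorm_ae ?_).trans (hC j))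
      filter_upwards [hT (h j)] with x hx
      rw [enorm_eq_self]
      exact hx.1⟩
  obtain ⟨ns, hns, hae⟩ := (tendstoInMeasure_of_tendsto_Lp hz).exists_seq_tendsto_ae
  set u : ℕ → boundedSupportLipschitz X := fun k => y (ns k) with hu
  have huh : ∀ k, u k ∈ tailHull h k := tailHull_comp_strictMono hy hns
  have huC : ∀ k, eLpNorm (lipAt (u k).1) p μ ≤ C := by
    intro k
    have hconv := convex_setOf_lipAt_le_add (μ := μ) hp1.le hp.ne (0 : X → ℝ≥0∞) (C : ℝ≥0∞)
      (boundedSupportLipschitz X)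
    have hmem : u k ∈ {f : boundedSupportLipschitz X | ∃ d, AEMeasurable d μ ∧
        eLpNorm d p μ ≤ C ∧ ∀ᵐ x ∂μ, lipAt f.1 x ≤ (0 : X → ℝ≥0∞) x + d x} := by
      refine tailHull_subset hconv (fun j _ => ?_) (huh k)
      rw [mem_ofPred_eq]
      exact ⟨_, (measurable_lipAt_coe (h j)).aemeasurable, hC j, Eventually.of_forall fun x => by simp⟩
    rw [mem_ofPred_eq] at hmem
    obtain ⟨d, -, hd, hle⟩ := hmem
    refine (eLpNorm_le_of_ae_le ?_).trans hd
    filter_upwards [hle] with x hx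
    simpa using hx
  -- distances to the ideal limit
  set e : ℕ → X → ℝ≥0∞ := fun i x => liminf (fun m => lipAt ((u i).1 - (u m).1) x) atTop with he
  have hem : ∀ i, Measurable (e i) := fun i =>
    Measurable.liminf fun m => measurable_lipAt_coe (u i - u m)
  have hrho : ∀ᵐ x ∂μ, ∃ ρ : ℕ → ℝ≥0∞, Tendsto ρ atTop (𝓝 0) ∧
      ∀ i j, lipAt ((u i).1 - (u j).1) x ≤ ρ i + ρ j := by
    filter_upwards [hae, ae_all_iff.2 fun i => ae_all_iff.2 fun j => hT (u i - u j),
      ae_all_iff.2 fun i => ae_all_iff.2 fun j => Lp.coeFn_sub (T (u i)) (T (u j))] with x h1 h2 h3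
    refine ⟨fun i => a x * ‖T (u i) x - z x‖ₑ, ?_, fun i j => ?_⟩
    · have h4 : Tendsto (fun i => ‖T (u i) x - z x‖ₑ) atTop (𝓝 0) := by
        have h5 := (h1.sub_const (z x)).enorm
        rwa [sub_self, enorm_zero] at h5
      have h6 := ENNReal.Tendsto.const_mul (a := (a x : ℝ≥0∞)) h4 (Or.inr ENNReal.coe_ne_top)
      rwa [mul_zero] at h6
    · refine (h2 i j).2.trans ?_
      rw [map_sub, h3 i j, Pi.sub_apply, ← mul_add]
      gcongr
      have h7 := enorm_sub_le (E := EuclideanSpace ℝ (Fin P.N)) (a := T (u i) x - z x)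
        (b := T (u j) x - z x)
      rwa [sub_sub_sub_cancel_right] at h7
  have hle : ∀ᵐ x ∂μ, ∀ i j, lipAt ((u i).1 - (u j).1) x ≤ e i x + e j x := by
    filter_upwards [hrho] with x ⟨ρ, h1, h2⟩ i j
    exact le_liminf_add_liminf h1 h2 (fun i j m => lipAt_sub_le_add _ _ _ x)
      (fun i j => lipAt_sub_comm _ _ x) i j
  have hlim : ∀ᵐ x ∂μ, Tendsto (fun i => e i x) atTop (𝓝 0) := by
    filter_upwards [hrho] with x ⟨ρ, h1, h2⟩
    refine tendsto_of_tendsto_of_tendsto_of_le_of_le tendsto_const_nhds h1 (fun _ => zero_le)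
      fun i => ?_
    have h3 : Tendsto (fun m => ρ i + ρ m) atTop (𝓝 (ρ i + 0)) := tendsto_const_nhds.add h1
    rw [add_zero] at h3
    rw [← h3.liminf_eq]
    exact liminf_le_liminf (Eventually.of_forall (h2 i))
  have heC : ∀ i, eLpNorm (e i) p μ ≤ (2 * C : ℝ≥0) := by
    intro i
    refine eLpNorm_liminf_le hp0 hp.ne (fun m => (measurable_lipAt_coe (u i - u m)).aemeasurable)
      fun m => ?_
    refine (eLpNorm_le_of_ae_le (Eventually.of_forall fun x => lipAt_sub_le _ _ x)).trans ?_
    refine (eLpNorm_add_le_of_aemeasurable (measurable_lipAt_coe (u i)).aemeasurable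
      (measurable_lipAt_coe (u m)).aemeasurable hp1.le).trans ?_
    rw [two_mul, ENNReal.coe_add]
    exact add_le_add (huC i) (huC m)
  have hetop : ∀ᵐ x ∂μ, ∀ i, e i x < ∞ := ae_all_iff.2 fun i =>
    ae_lt_top_of_eLpNorm_ne_top hp0 hp.ne (hem i).aemeasurable
      (ne_top_of_le_ne_top ENNReal.coe_ne_top (heC i))
  have hEn : ∀ i, eLpNorm (fun x => (e i x).toReal) p μ ≤ (2 * C : ℝ≥0) := by
    intro i
    refine (eLpNorm_mono_enorm_ae ?_).trans (heC i)
    filter_upwards [hetop] with x hx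
    rw [Real.enorm_of_nonneg ENNReal.toReal_nonneg, ENNReal.ofReal_toReal (hx i).ne, enorm_eq_self]
  have hEm : ∀ i, MemLp (fun x => (e i x).toReal) p μ := fun i =>
    ⟨(hem i).ennreal_toReal.aestronglyMeasurable, (hEn i).trans_lt ENNReal.coe_lt_top⟩
  set E : ℕ → Lp ℝ p μ := fun i => (hEm i).toLp _ with hE
  have hEx : ∀ᵐ x ∂μ, ∀ i, 0 ≤ E i x ∧ ENNReal.ofReal (E i x) = e i x := by
    filter_upwards [ae_all_iff.2 fun i => (hEm i).coeFn_toLp, hetop] with x h1 h2 i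
    rw [hE]
    simp only
    rw [h1 i]
    exact ⟨ENNReal.toReal_nonneg, ENNReal.ofReal_toReal (h2 i).ne⟩
  obtain ⟨w, hw, b, hb⟩ := (Lp_hasTailLimits (F := ℝ) (μ := μ) hp1 hp).exists_lift
    (LinearMap.snd ℝ (boundedSupportLipschitz X) (Lp ℝ p μ)) (fun i => (u i, E i))
    ⟨(2 * C : ℝ≥0), fun j => by
      rw [LinearMap.snd_apply, Lp.norm_toLp]
      exact ENNReal.toReal_le_coe_of_le_coe (hEn j)⟩
  -- the second components of the convex combinations are below tail suprema of the distances
  have hb0 : b = 0 := by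
    have h1 : ∀ k, ∀ᵐ x ∂μ, 0 ≤ (w k).2 x ∧ ENNReal.ofReal ((w k).2 x) ≤ ⨆ j ≥ k, e j x := by
      intro k
      have hmem : (w k).2 ∈ tailHull E k := by
        have h2 := image_tailHull (LinearMap.snd ℝ (boundedSupportLipschitz X) (Lp ℝ p μ))
          (fun i => (u i, E i)) k
        have h3 : (w k).2 ∈ LinearMap.snd ℝ (boundedSupportLipschitz X) (Lp ℝ p μ) ''
          tailHull (fun i => (u i, E i)) k := ⟨w k, hw k, rfl⟩
        rw [h2] at h3
        exact h3
      have h4 : (w k).2 ∈ {v : Lp ℝ p μ | ∀ᵐ x ∂μ, 0 ≤ v x ∧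
          ENNReal.ofReal (v x) ≤ ⨆ j ≥ k, e j x} := by
        refine tailHull_subset (convex_setOf_ofReal_coeFn_le _) (fun j hj => ?_) hmem
        rw [mem_ofPred_eq]
        filter_upwards [hEx] with x hx
        refine ⟨(hx j).1, (hx j).2.le.trans ?_⟩
        exact le_iSup₂ (f := fun j (_ : j ≥ k) => e j x) j hj
      rwa [mem_ofPred_eq] at h4
    obtain ⟨ms, hms, hlim'⟩ := (tendstoInMeasure_of_tendsto_Lp hb).exists_seq_tendsto_ae
    rw [Lp.eq_zero_iff_ae_eq_zero]
    filter_upwards [hlim', ae_all_iff.2 h1, hlim] with x h2 h3 h4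
    refine tendsto_nhds_unique h2 ?_
    have h5 : Tendsto (fun k => ⨆ j ≥ k, e j x) atTop (𝓝 0) := by
      rw [ENNReal.tendsto_nhds_zero] at h4 ⊢
      intro ε hε
      obtain ⟨N, hN⟩ := eventually_atTop.1 (h4 ε hε)
      filter_upwards [eventually_ge_atTop N] with k hk
      exact iSup₂_le fun j hj => hN j (hk.trans hj)
    have h6 : Tendsto (fun k => ENNReal.ofReal ((w k).2 x)) atTop (𝓝 0) :=
      tendsto_of_tendsto_of_tendsto_of_le_of_le tendsto_const_nhds h5 (fun _ => zero_le)
        fun k => (h3 k).2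
    have h7 := (ENNReal.tendsto_toReal ENNReal.zero_ne_top).comp h6
    have h8 : (ENNReal.toReal ∘ fun k => ENNReal.ofReal ((w k).2 x)) = fun k => (w k).2 x := by
      ext k
      exact ENNReal.toReal_ofReal (h3 k).1
    rw [h8] at h7
    exact h7.comp hms.tendsto_atTop
  have hw1 : ∀ j k, ∀ᵐ x ∂μ, 0 ≤ (w k).2 x ∧
      lipAt ((w k).1.1 - (u j).1) x ≤ ENNReal.ofReal ((w k).2 x) + e j x := by
    intro j k
    have hconv := convex_setOf_lipAt_sub_le_ofReal (μ := μ) (p := p) (u j).1 (e j)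
    have h1 : w k ∈ {v : boundedSupportLipschitz X × Lp ℝ p μ | ∀ᵐ x ∂μ, 0 ≤ v.2 x ∧
        lipAt (v.1.1 - (u j).1) x ≤ ENNReal.ofReal (v.2 x) + e j x} := by
      refine tailHull_subset hconv (fun i _ => ?_) (hw k)
      rw [mem_ofPred_eq]
      filter_upwards [hEx, hle] with x h2 h3
      refine ⟨(h2 i).1, ?_⟩
      rw [(h2 i).2]
      exact h3 i j
    rwa [mem_ofPred_eq] at h1
  have hw2 : ∀ j k, ∀ᵐ x ∂μ, lipAt ((w k).1.1 - (w j).1.1) x ≤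
      ENNReal.ofReal ((w k).2 x) + ENNReal.ofReal ((w j).2 x) := by
    intro j k
    have hconv := convex_setOf_lipAt_sub_le_ofReal (μ := μ) (p := p) (w j).1.1
      fun x => ENNReal.ofReal ((w j).2 x)
    have h1 : w k ∈ {v : boundedSupportLipschitz X × Lp ℝ p μ | ∀ᵐ x ∂μ, 0 ≤ v.2 x ∧
        lipAt (v.1.1 - (w j).1.1) x ≤ ENNReal.ofReal (v.2 x) + ENNReal.ofReal ((w j).2 x)} := by
      refine tailHull_subset hconv (fun i _ => ?_) (hw k)
      rw [mem_ofPred_eq]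
      filter_upwards [hEx, hw1 i j] with x h2 h3
      refine ⟨(h2 i).1, ?_⟩
      rw [(h2 i).2, add_comm, lipAt_sub_comm]
      exact h3.2
    rw [mem_ofPred_eq] at h1
    filter_upwards [h1] with x hx using hx.2
  refine ⟨fun k => (w k).1, fun k => ?_, fun ε hε => ?_⟩
  · refine tailHull_trans huh k ?_
    have h2 := image_tailHull (LinearMap.fst ℝ (boundedSupportLipschitz X) (Lp ℝ p μ))
      (fun i => (u i, E i)) k
    have h3 : (w k).1 ∈ LinearMap.fst ℝ (boundedSupportLipschitz X) (Lp ℝ p μ) ''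
      tailHull (fun i => (u i, E i)) k := ⟨w k, hw k, rfl⟩
    rw [h2] at h3
    exact h3
  · have hnorm : Tendsto (fun k => ENNReal.ofReal ‖(w k).2‖) atTop (𝓝 0) := by
      rw [hb0] at hb
      have h1 := ENNReal.tendsto_ofReal hb.norm
      rwa [norm_zero, ENNReal.ofReal_zero] at h1
    obtain ⟨N, hN⟩ := eventually_atTop.1 (ENNReal.tendsto_nhds_zero.1 hnorm (ε / 2)
      (ENNReal.half_pos hε.ne'))
    have hbd : ∀ i, N ≤ i → eLpNorm (fun x => ENNReal.ofReal ((w i).2 x)) p μ ≤ ε / 2 := by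
      intro i hi
      refine le_trans ?_ (hN i hi)
      rw [ofReal_norm, Lp.enorm_def]
      refine eLpNorm_mono_enorm fun x => ?_
      rw [enorm_eq_self, Real.enorm_eq_ofReal_abs]
      exact ENNReal.ofReal_le_ofReal (le_abs_self _)
    have hms : ∀ i, AEMeasurable (fun x => ENNReal.ofReal ((w i).2 x)) μ := fun i =>
      (Lp.aestronglyMeasurable (w i).2).aemeasurable.ennreal_ofReal
    refine ⟨N, fun i hi j hj => ?_⟩
    calc _ ≤ eLpNorm (fun x => ENNReal.ofReal ((w i).2 x) + ENNReal.ofReal ((w j).2 x)) p μ :=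
          eLpNorm_le_of_ae_le (hw2 j i)
      _ ≤ _ := eLpNorm_add_le_of_aemeasurable (hms i) (hms j) hp1.le
      _ ≤ ε / 2 + ε / 2 := add_le_add (hbd i hi) (hbd j hj)
      _ = ε := ENNReal.add_halves ε

end CauchyHull

/-! ### Alternating sums with well-separated scales -/

theorem ENNReal.tsum_two_inv_pow_ne_top : ∑' k : ℕ, (2⁻¹ : ℝ≥0∞) ^ k ≠ ∞ := by
  rw [ENNReal.tsum_geometric]
  simp [ENNReal.one_sub_inv_two]

section Scales

section AlternatingSum

variable {X : Type*} [MetricSpace X]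

/-- The partial sum `H 0 - H 1 + H 2 - ⋯` with `k` terms. -/
noncomputable def alternatingSum (H : ℕ → boundedSupportLipschitz X) (k : ℕ) :
    boundedSupportLipschitz X :=
  ∑ i ∈ Finset.range k, (-1 : ℝ) ^ i • H i

theorem alternatingSum_succ (H : ℕ → boundedSupportLipschitz X) (k : ℕ) :
    alternatingSum H (k + 1) = alternatingSum H k + (-1 : ℝ) ^ k • H k :=
  Finset.sum_range_succ _ _

end AlternatingSum

variable {X : Type*} [MeasurableSpace X] {μ : Measure X} {p : ℝ≥0∞}

theorem exists_measure_le_of_antitone {B : ℕ → Set X} (hB : Antitone B)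
    (hm : ∀ n, NullMeasurableSet (B n) μ) (hfin : μ (B 0) ≠ ∞) (h : ∀ᵐ x ∂μ, ∃ n, x ∉ B n)
    {ε : ℝ≥0∞} (hε : 0 < ε) : ∃ n, μ (B n) ≤ ε := by
  have h1 := tendsto_measure_iInter_atTop hm hB ⟨0, hfin⟩
  have h2 : μ (⋂ n, B n) = 0 := by
    refine measure_mono_null ?_ h
    intro x hx
    simp only [mem_compl_iff, mem_ofPred_eq, not_exists, not_not]
    exact fun n => mem_iInter.1 hx n
  rw [h2] at h1
  exact (ENNReal.tendsto_nhds_zero.1 h1 ε hε).exists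

theorem eLpNorm_tsum_le (hp1 : 1 ≤ p) (hp : p ≠ ∞) {f : ℕ → X → ℝ≥0∞}
    (hf : ∀ k, AEMeasurable (f k) μ) :
    eLpNorm (fun x => ∑' k, f k x) p μ ≤ ∑' k, eLpNorm (f k) p μ := by
  have hp0 : p ≠ 0 := (one_pos.trans_le hp1).ne'
  have h1 : ∀ n, eLpNorm (fun x => ∑ k ∈ Finset.range n, f k x) p μ ≤
      ∑ k ∈ Finset.range n, eLpNorm (f k) p μ := by
    intro n
    induction n with
    | zero => simp
    | succ n ih =>
      simp only [Finset.sum_range_succ]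
      refine (eLpNorm_add_le_of_aemeasurable ?_ (hf n) hp1).trans (by gcongr)
      exact Finset.aemeasurable_fun_sum _ fun k _ => hf k
  have h2 := eLpNorm_liminf_le (μ := μ) hp0 hp
    (f := fun n x => ∑ k ∈ Finset.range n, f k x)
    (fun n => Finset.aemeasurable_fun_sum _ fun k _ => hf k)
    fun n => (h1 n).trans (ENNReal.sum_le_tsum _)
  refine le_of_eq_of_le ?_ h2
  congr 1
  ext x
  exact ((ENNReal.tendsto_nat_tsum fun k => f k x).liminf_eq).symm

variable [MetricSpace X]

/-- A sequence `H` of tail convex combinations of `h`, with scales `r 0 > s 0 > r 1 > s 1 > ⋯`, such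
that `H k` has the Hajłasz gradient `l + δ k` and is negligible at scales above `s k`, while the
alternating sum of the earlier terms is controlled by its Lipschitz constant at scales below
`r k`. The sets `B₁`, `B₂` collect the points where further properties at these scales fail. -/
structure IsScaleSequence (μ : Measure X) (p : ℝ≥0∞) (h : ℕ → boundedSupportLipschitz X)
    (l : X → ℝ≥0∞) (B₁ : boundedSupportLipschitz X → ℕ → ℝ → Set X) (B₂ : ℝ → ℝ → Set X)
    (H : ℕ → boundedSupportLipschitz X) (r s : ℕ → ℝ) (δ β : ℕ → X → ℝ≥0∞) : Prop where
  mem_tailHull : ∀ k, H k ∈ tailHull h k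
  aemeasurable_excess : ∀ k, AEMeasurable (δ k) μ
  eLpNorm_excess_le : ∀ k, eLpNorm (δ k) p μ ≤ 2⁻¹ ^ k
  isHajlaszBound : ∀ k, IsHajlaszBound μ (H k).1 fun x => l x + δ k x
  pos : ∀ k, 0 < s k
  lt : ∀ k, s k < r k
  succ_lt : ∀ k, r (k + 1) < s k
  le_pow : ∀ k, r k ≤ (1 / 2) ^ k
  eLpNorm_le : ∀ k, eLpNorm (H k).1 p μ ≤ ENNReal.ofReal (s k) * 4⁻¹ ^ k
  aemeasurable_error : ∀ k, AEMeasurable (β k) μ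
  eLpNorm_error_le : ∀ k, eLpNorm (β k) p μ ≤ 2⁻¹ ^ k
  lipScale_le : ∀ k x, lipScale (alternatingSum H k).1 (r k) x ≤
    lipAt (alternatingSum H k).1 x + β k x
  measure_fst_le : ∀ k, μ (B₁ (alternatingSum H k) k (r k)) ≤ 2⁻¹ ^ k
  measure_snd_le : ∀ k, μ (B₂ (r k) (s k)) ≤ 2⁻¹ ^ k

variable [BorelSpace X] [TopologicalSpace.SeparableSpace X] [Nonempty X]

theorem exists_isScaleSequence (hμ : IsDoublingMeasure μ) (hp1 : 1 < p) (hp : p ≠ ∞)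
    {h : ℕ → boundedSupportLipschitz X} {l : X → ℝ≥0∞} (hl : AEMeasurable l μ)
    (h0 : Tendsto (fun j => eLpNorm (h j).1 p μ) atTop (𝓝 0))
    (hlip : ∀ j x, lipAt (h j).1 x ≤ l x) {C : ℝ}
    (hC : ∀ j, ∃ G, IsHajlaszBound μ (h j).1 G ∧ eLpNorm G p μ ≤ ENNReal.ofReal C)
    {B₁ : boundedSupportLipschitz X → ℕ → ℝ → Set X} {B₂ : ℝ → ℝ → Set X}
    (hB₁ : ∀ f k, ∀ ε : ℝ≥0∞, 0 < ε → ∃ r₀ > 0, ∀ r ≤ r₀, μ (B₁ f k r) ≤ ε)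
    (hB₂ : ∀ r > 0, ∀ ε : ℝ≥0∞, 0 < ε → ∃ s₀ > 0, ∀ s ≤ s₀, μ (B₂ r s) ≤ ε) :
    ∃ H r s δ β, IsScaleSequence μ p h l B₁ B₂ H r s δ β := by
  have hp0 : p ≠ 0 := (one_pos.trans hp1).ne'
  have hpos : ∀ k : ℕ, (0 : ℝ≥0∞) < 2⁻¹ ^ k := fun k => ENNReal.pow_pos (by simp) k
  have hr : ∀ (k : ℕ) (f : boundedSupportLipschitz X) (t : {t : ℝ // 0 < t}),
      ∃ r : {r : ℝ // 0 < r}, r.1 < t.1 ∧ r.1 ≤ (1 / 2) ^ k ∧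
        (∃ β : X → ℝ≥0∞, AEMeasurable β μ ∧ eLpNorm β p μ ≤ 2⁻¹ ^ k ∧
          ∀ x, lipScale f.1 r.1 x ≤ lipAt f.1 x + β x) ∧ μ (B₁ f k r.1) ≤ 2⁻¹ ^ k := by
    rintro k f ⟨t, ht⟩
    obtain ⟨r₀, hr₀, hr₀'⟩ := hB₁ f k _ (hpos k)
    obtain ⟨r, h1, h2, hβ⟩ := exists_lipScale_le_add (p := p) hμ hp0 hp f.2 (hpos k)
      (lt_min hr₀ (lt_min ht (by positivity : (0 : ℝ) < (1 / 2) ^ k)))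
    rw [lt_min_iff, lt_min_iff] at h2
    exact ⟨⟨r, h1⟩, h2.2.1, h2.2.2.le, hβ, hr₀' r h2.1.le⟩
  have hs : ∀ (k : ℕ) (r : {r : ℝ // 0 < r}),
      ∃ s : {s : ℝ // 0 < s}, s.1 < r.1 ∧ μ (B₂ r.1 s.1) ≤ 2⁻¹ ^ k := by
    rintro k ⟨r, hr⟩
    obtain ⟨s₀, hs₀, h1⟩ := hB₂ r hr _ (hpos k)
    exact ⟨⟨min s₀ (r / 2), by positivity⟩, (min_le_right _ _).trans_lt (half_lt_self hr),
      h1 _ (min_le_left _ _)⟩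
  have hH : ∀ (k : ℕ) (s : {s : ℝ // 0 < s}), ∃ H ∈ tailHull h k,
      eLpNorm H.1 p μ ≤ ENNReal.ofReal s.1 * 4⁻¹ ^ k ∧ ∃ δ, AEMeasurable δ μ ∧
        eLpNorm δ p μ ≤ 2⁻¹ ^ k ∧ IsHajlaszBound μ H.1 fun x => l x + δ x := by
    rintro k ⟨s, hs⟩
    have h1 : 0 < ENNReal.ofReal s * 4⁻¹ ^ k :=
      ENNReal.mul_pos (ENNReal.ofReal_pos.2 hs).ne' (ENNReal.pow_pos (by simp) k).ne'
    obtain ⟨N, hN⟩ := eventually_atTop.1 (ENNReal.tendsto_nhds_zero.1 h0 _ h1)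
    obtain ⟨H, hHm, δ, h2, h3, h4⟩ := exists_mem_tailHull_excess_le hμ hp1 hp hl h0
      (fun η hη => ⟨0, fun j _ => ⟨0, aemeasurable_const, by simp, Eventually.of_forall fun x => by
        simpa using hlip j x⟩⟩) hC (hpos k) (max k N)
    refine ⟨H, tailHull_anti h (le_max_left _ _) hHm, ?_, δ, h2, h3, h4⟩
    exact eLpNorm_le_of_mem_tailHull hp1.le (fun j hj => hN j ((le_max_right _ _).trans hj)) hHm
  choose rf hr1 hr2 hβ hr4 using hr
  choose β hβ1 hβ2 hβ3 using hβ
  choose sf hs1 hs2 using hs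
  choose Hf hH1 hH2 δ hδ1 hδ2 hδ3 using hH
  -- the state consists of the alternating sum and the previous scale
  set st : ℕ → boundedSupportLipschitz X × {t : ℝ // 0 < t} := fun k =>
    Nat.rec (0, ⟨1, one_pos⟩) (fun k σ => (σ.1 + (-1 : ℝ) ^ k • Hf k (sf k (rf k σ.1 σ.2)),
      sf k (rf k σ.1 σ.2))) k with hst
  set R : ℕ → {r : ℝ // 0 < r} := fun k => rf k (st k).1 (st k).2 with hR
  set S : ℕ → {r : ℝ // 0 < r} := fun k => sf k (R k) with hS
  set H : ℕ → boundedSupportLipschitz X := fun k => Hf k (S k) with hHdef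
  have hst2 : ∀ k, (st (k + 1)).2 = S k := fun k => rfl
  have hst1 : ∀ k, (st k).1 = alternatingSum H k := by
    intro k
    induction k with
    | zero => rfl
    | succ k ih =>
      rw [alternatingSum_succ, ← ih]
  refine ⟨H, fun k => (R k).1, fun k => (S k).1, fun k => δ k (S k),
    fun k => β k (st k).1 (st k).2, ?_⟩
  constructor
  · exact fun k => hH1 k _
  · exact fun k => hδ1 k _
  · exact fun k => hδ2 k _
  · exact fun k => hδ3 k _
  · exact fun k => (S k).2
  · exact fun k => hs1 k _
  · intro k
    have h1 := hr1 (k + 1) (st (k + 1)).1 (st (k + 1)).2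
    rwa [hst2] at h1
  · exact fun k => hr2 k _ _
  · exact fun k => hH2 k _
  · exact fun k => hβ1 k _ _
  · exact fun k => hβ2 k _ _
  · intro k x
    have h1 := hβ3 k (st k).1 (st k).2 x
    rw [hst1 k] at h1 ⊢
    simp only [hR]
    rwa [hst1 k]
  · intro k
    have h1 := hr4 k (st k).1 (st k).2
    simp only [hR]
    rwa [hst1 k] at h1 ⊢
  · exact fun k => hs2 k _

end Scales

/-! ### Coordinates in annuli -/

section Annulus

variable {X : Type*} [MetricSpace X] {f : X → ℝ} {x : X} {r s : ℝ}

/-- The supremum of the difference quotients of `f` at `x` at distances strictly between `s`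
and `r`. -/
noncomputable def lipAnnulus (f : X → ℝ) (s r : ℝ) (x : X) : ℝ≥0∞ :=
  ⨆ y, ⨆ _ : s < dist y x ∧ dist y x < r, diffQuot f x y

theorem lipAnnulus_anti (f : X → ℝ) {s' : ℝ} (h : s' ≤ s) (r : ℝ) (x : X) :
    lipAnnulus f s r x ≤ lipAnnulus f s' r x :=
  iSup_mono fun _ => iSup_mono' fun hy => ⟨⟨h.trans_lt hy.1, hy.2⟩, le_rfl⟩

theorem lowerSemicontinuous_lipAnnulus (hf : Continuous f) (s r : ℝ) :
    LowerSemicontinuous (lipAnnulus f s r) := by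
  intro x c hc
  simp only [lipAnnulus, lt_iSup_iff] at hc
  obtain ⟨y, ⟨hy1, hy2⟩, hcy⟩ := hc
  have hyx : dist y x ≠ 0 := by
    intro h
    rw [dist_eq_zero.1 h, diffQuot_self] at hcy
    exact not_lt_bot hcy
  have hd : Continuous fun z : X => dist y z := continuous_const.dist continuous_id
  have hcont : ContinuousAt (fun z : X => diffQuot f z y) x := by
    refine ENNReal.continuous_ofReal.continuousAt.comp (ContinuousAt.div ?_ hd.continuousAt hyx)
    exact (continuous_const.sub hf).abs.continuousAt
  filter_upwards [hcont.eventually (lt_mem_nhds hcy), hd.continuousAt.eventually (lt_mem_nhds hy1),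
    hd.continuousAt.eventually (gt_mem_nhds hy2)] with z h1 h2 h3
  exact h1.trans_le (le_iSup₂ (f := fun y (_ : s < dist y z ∧ dist y z < r) => diffQuot f z y)
    y ⟨h2, h3⟩)

theorem exists_lt_lipAnnulus {c : ℝ≥0∞} (h : c < lipScale f r x) :
    ∃ s > 0, c < lipAnnulus f s r x := by
  simp only [lipScale, lt_iSup_iff] at h
  obtain ⟨y, hy, hcy⟩ := h
  have hyx : 0 < dist y x := by
    refine dist_pos.2 fun h => ?_
    rw [h, diffQuot_self] at hcy
    exact not_lt_bot hcy
  exact ⟨dist y x / 2, half_pos hyx, hcy.trans_le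
    (le_iSup₂ (f := fun z (_ : dist y x / 2 < dist z x ∧ dist z x < r) => diffQuot f x z)
      y ⟨half_lt_self hyx, hy⟩)⟩

theorem lipAnnulus_smul (c : ℝ) (f : X → ℝ) (s r : ℝ) (x : X) :
    lipAnnulus (c • f) s r x = ENNReal.ofReal |c| * lipAnnulus f s r x := by
  simp only [lipAnnulus, ENNReal.mul_iSup, diffQuot_smul]

variable {n : ℕ} {ξ : X → EuclideanSpace ℝ (Fin n)} {c c' : ℝ}

/-- By compactness of the unit sphere, lower bounds for `v · ξ` at scales below `r` hold in a
common annulus for all `v`. -/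
theorem exists_forall_le_lipAnnulus (hc0 : 0 < c') (hc : c' < c)
    (h : ∀ v, ENNReal.ofReal (c * ‖v‖) ≤ lipScale (linForm ξ v) r x) :
    ∃ n : ℕ, ∀ v, ENNReal.ofReal (c' * ‖v‖) ≤ lipAnnulus (linForm ξ v) (1 / ((n : ℝ) + 1)) r x := by
  set U : ℕ → Set (EuclideanSpace ℝ (Fin n)) := fun n =>
    {v | ENNReal.ofReal c' < lipAnnulus (linForm ξ v) (1 / ((n : ℝ) + 1)) r x} with hU
  have hmono : Monotone U := by
    intro m n hmn v hv
    exact lt_of_lt_of_le hv (lipAnnulus_anti _ (by gcongr) r x)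
  have hopen : ∀ n, IsOpen (U n) := by
    intro n
    refine LowerSemicontinuous.isOpen_preimage ?_ (ENNReal.ofReal c')
    refine lowerSemicontinuous_iSup fun y => lowerSemicontinuous_iSup fun _ => ?_
    refine Continuous.lowerSemicontinuous ?_
    refine ENNReal.continuous_ofReal.comp (Continuous.div_const ?_ _)
    exact ((continuous_id.inner continuous_const).sub
      (continuous_id.inner continuous_const)).abs
  have hcov : Metric.sphere (0 : EuclideanSpace ℝ (Fin n)) 1 ⊆ ⋃ n, U n := by
    intro v hv
    have h1 : ENNReal.ofReal c' < lipScale (linForm ξ v) r x := by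
      refine lt_of_lt_of_le ?_ (h v)
      rw [mem_sphere_zero_iff_norm.1 hv, mul_one]
      exact (ENNReal.ofReal_lt_ofReal_iff (hc0.trans hc)).2 hc
    obtain ⟨s, hs, h2⟩ := exists_lt_lipAnnulus h1
    obtain ⟨m, hm⟩ := exists_nat_one_div_lt hs
    exact mem_iUnion.2 ⟨m, h2.trans_le (lipAnnulus_anti _ hm.le r x)⟩
  obtain ⟨m, hm⟩ := (isCompact_sphere (0 : EuclideanSpace ℝ (Fin n)) 1).elim_directed_cover U hopen
    hcov hmono.directed_le
  refine ⟨m, fun v => ?_⟩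
  rcases eq_or_ne v 0 with rfl | hv
  · simp
  have hv' : 0 < ‖v‖ := norm_pos_iff.2 hv
  have hs : ‖v‖⁻¹ • v ∈ U m := hm (by
    rw [mem_sphere_zero_iff_norm, norm_smul, norm_inv, norm_norm, inv_mul_cancel₀ hv'.ne'])
  have e : v = ‖v‖ • (‖v‖⁻¹ • v) := by rw [smul_smul, mul_inv_cancel₀ hv'.ne', one_smul]
  conv_rhs => rw [e]
  rw [map_smul, lipAnnulus_smul, abs_of_pos hv', mul_comm, ENNReal.ofReal_mul hv'.le]
  gcongr
  exact le_of_lt hs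

/-- Lower bounds for `v · ξ` in an annulus, for a dense set of `v`, yield points of the annulus
that are seen by an arbitrary given `v`. -/
theorem exists_le_abs_linForm_sub {Λ : ℝ≥0} (hξ : LipschitzWith Λ ξ) (hc0 : 0 < c') (hc : c' < c)
    {e : ℕ → EuclideanSpace ℝ (Fin n)} (he : DenseRange e)
    (h : ∀ k, ENNReal.ofReal (c * ‖e k‖) ≤ lipAnnulus (linForm ξ (e k)) s r x)
    {v : EuclideanSpace ℝ (Fin n)} (hv : v ≠ 0) :
    ∃ y, s < dist y x ∧ dist y x < r ∧ c' * ‖v‖ * dist y x ≤ |linForm ξ v y - linForm ξ v x| := by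
  have hv' : 0 < ‖v‖ := norm_pos_iff.2 hv
  have hη : 0 < (c - c') * ‖v‖ / (2 * (c + Λ + 1)) := by
    have := NNReal.coe_nonneg Λ
    have h1 : 0 < c - c' := sub_pos.2 hc
    have h2 : 0 < c := hc0.trans hc
    positivity
  obtain ⟨k, hk⟩ := he.exists_dist_lt v hη
  have hΛ := NNReal.coe_nonneg Λ
  have hden : 0 < 2 * (c + Λ + 1) := by linarith
  rw [dist_eq_norm, lt_div_iff₀ hden] at hk
  have hle : ‖v‖ ≤ ‖e k‖ + ‖v - e k‖ := by
    have := norm_add_le (e k) (v - e k)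
    rwa [add_sub_cancel] at this
  set t := ‖v - e k‖ with ht
  have ht0 : 0 ≤ t := norm_nonneg _
  -- a constant between `c'` and `c` that leaves room for the error of replacing `v` by `e k`
  set m : ℝ := c' * ‖v‖ + Λ * t with hm
  have hm0 : 0 < m := by positivity
  have hmc : m < c * ‖e k‖ := by
    nlinarith [mul_nonneg hΛ ht0, mul_pos (sub_pos.2 hc) hv', hc0.trans hc]
  have h1 : ENNReal.ofReal m < lipAnnulus (linForm ξ (e k)) s r x :=
    lt_of_lt_of_le ((ENNReal.ofReal_lt_ofReal_iff (hm0.trans hmc)).2 hmc) (h k)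
  simp only [lipAnnulus, lt_iSup_iff] at h1
  obtain ⟨y, ⟨hy1, hy2⟩, hy⟩ := h1
  refine ⟨y, hy1, hy2, ?_⟩
  have hyx : 0 < dist y x := by
    refine dist_pos.2 fun h => ?_
    rw [h, diffQuot_self] at hy
    exact not_lt_bot hy
  have h2 := (ENNReal.ofReal_lt_ofReal_iff_of_nonneg hm0.le).1 hy
  rw [lt_div_iff₀ hyx] at h2
  have h3 := abs_linForm_sub_le hξ (v - e k) x y
  have h4 : linForm ξ (e k) y - linForm ξ (e k) x = (linForm ξ v y - linForm ξ v x) -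
      (linForm ξ (v - e k) y - linForm ξ (v - e k) x) := by
    simp only [map_sub, Pi.sub_apply]
    ring
  rw [h4] at h2
  have h5 := abs_sub (linForm ξ v y - linForm ξ v x)
    (linForm ξ (v - e k) y - linForm ξ (v - e k) x)
  rw [← ht] at h3
  have h6 : m * dist y x = c' * ‖v‖ * dist y x + Λ * t * dist y x := by rw [hm]; ring
  linarith

variable [MeasurableSpace X] [BorelSpace X] {μ : Measure X} {Z : Set X}

theorem IsDiffPiece.exists_annulus_exceptional (hZ : IsDiffPiece μ Z ξ c) (hfin : μ Z ≠ ∞) :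
    ∃ B : ℝ → ℝ → Set X,
      (∀ r > 0, ∀ ε : ℝ≥0∞, 0 < ε → ∃ s₀ > 0, ∀ s ≤ s₀, μ (B r s) ≤ ε) ∧
      ∀ r s, ∀ x ∈ Z, x ∉ B r s → ∀ v ≠ 0, ∃ y, 2 * s < dist y x ∧ dist y x < r / 2 ∧
        c / 2 * ‖v‖ * dist y x ≤ |linForm ξ v y - linForm ξ v x| := by
  have hc := hZ.pos
  obtain ⟨Λ, hξ⟩ := hZ.lipschitz
  set e := TopologicalSpace.denseSeq (EuclideanSpace ℝ (Fin n)) with he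
  set G : ℝ → ℝ → Set X := fun s r => {x | ∀ k, ENNReal.ofReal (3 / 4 * c * ‖e k‖) ≤
    lipAnnulus (linForm ξ (e k)) s r x} with hG
  have hGm : ∀ s r, MeasurableSet (G s r) := by
    intro s r
    rw [hG]
    simp only [ofPred_forall]
    refine MeasurableSet.iInter fun k => measurableSet_le measurable_const ?_
    exact (lowerSemicontinuous_lipAnnulus (continuous_const.inner hξ.continuous) s r).measurable
  have hGanti : ∀ s s' r, s' ≤ s → G s r ⊆ G s' r := fun s s' r hs x hx k =>
    (hx k).trans (lipAnnulus_anti _ hs r x)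
  refine ⟨fun r s => Z \ G (2 * s) (r / 2), fun r hr ε hε => ?_, fun r s x hx hxB v hv => ?_⟩
  · have h1 : ∃ n : ℕ, μ (Z \ G (1 / ((n : ℝ) + 1)) (r / 2)) ≤ ε := by
      refine exists_measure_le_of_antitone (B := fun n : ℕ => Z \ G (1 / ((n : ℝ) + 1)) (r / 2))
        ?_ ?_ ?_ ?_ hε
      · intro m n hmn
        exact sdiff_subset_sdiff_right (hGanti _ _ _ (by gcongr))
      · exact fun n => hZ.nullMeasurableSet.diff (hGm _ _).nullMeasurableSet
      · exact ne_top_of_le_ne_top hfin (measure_mono sdiff_subset)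
      · refine Eventually.of_forall fun x => ?_
        by_cases hx : x ∈ Z
        · obtain ⟨m, hm⟩ := exists_forall_le_lipAnnulus (x := x) (r := r / 2) (c' := 3 / 4 * c)
            (by positivity) (by linarith : 3 / 4 * c < c) fun v =>
              (hZ.le_lipAt x hx v).trans (lipAt_le_lipScale _ x (half_pos hr))
          exact ⟨m, fun h => h.2 fun k => hm (e k)⟩
        · exact ⟨0, fun h => hx h.1⟩
    obtain ⟨m, hm⟩ := h1
    refine ⟨1 / ((m : ℝ) + 1) / 2, by positivity, fun s hs => le_trans (measure_mono ?_) hm⟩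
    exact sdiff_subset_sdiff_right (hGanti _ _ _ (by linarith))
  · have h1 : x ∈ G (2 * s) (r / 2) := by
      by_contra h
      exact hxB ⟨hx, h⟩
    exact exists_le_abs_linForm_sub hξ (by positivity) (by linarith : c / 2 < 3 / 4 * c)
      (TopologicalSpace.denseRange_denseSeq _) h1 hv

theorem IsDiffPiece.exists_differential_exceptional [TopologicalSpace.SeparableSpace X]
    (hZ : IsDiffPiece μ Z ξ c) (hfin : μ Z ≠ ∞) :
    ∃ (D : boundedSupportLipschitz X → X → EuclideanSpace ℝ (Fin n))
      (B : boundedSupportLipschitz X → ℕ → ℝ → Set X),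
      (∀ f, ∀ᵐ x ∂μ, x ∈ Z → lipAt (f.1 - linForm ξ (D f x)) x = 0) ∧
      (∀ f k, ∀ ε : ℝ≥0∞, 0 < ε → ∃ r₀ > 0, ∀ r ≤ r₀, μ (B f k r) ≤ ε) ∧
      ∀ f k r, ∀ x ∈ Z, x ∉ B f k r →
        lipScale (f.1 - linForm ξ (D f x)) r x ≤ ENNReal.ofReal ((1 / 2) ^ k) := by
  obtain ⟨Λ, hξ⟩ := hZ.lipschitz
  choose G hG using fun f : boundedSupportLipschitz X => hZ.exists_differential f.1 f.2.1
  set D : boundedSupportLipschitz X → X → EuclideanSpace ℝ (Fin n) := fun f => (hG f).1.mk _ with hD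
  have hDm : ∀ f, Measurable (D f) := fun f => (hG f).1.stronglyMeasurable_mk.measurable
  have hD0 : ∀ f, ∀ᵐ x ∂μ, x ∈ Z → lipAt (f.1 - linForm ξ (D f x)) x = 0 := by
    intro f
    have h1 := (hG f).1.ae_eq_mk
    rw [EventuallyEq, ae_restrict_iff'₀ hZ.nullMeasurableSet] at h1
    filter_upwards [h1, (hG f).ae_lipAt_eq_zero hZ.nullMeasurableSet] with x h2 h3 hx
    have h4 : D f x = G f x := (h2 hx).symm
    rw [h4]
    exact h3 hx
  set A : boundedSupportLipschitz X → ℕ → ℝ → Set X := fun f k r =>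
    {x | lipScale (f.1 - linForm ξ (D f x)) r x ≤ ENNReal.ofReal ((1 / 2) ^ k)} with hA
  have hAm : ∀ f k r, MeasurableSet (A f k r) := by
    intro f k r
    refine measurableSet_le ?_ measurable_const
    obtain ⟨⟨K, hK⟩, -⟩ := f.2
    have hF : Continuous (Function.uncurry fun (v : EuclideanSpace ℝ (Fin n)) (y : X) =>
        (f.1 - linForm ξ v) y) :=
      (hK.continuous.comp continuous_snd).sub
        (continuous_fst.inner (hξ.continuous.comp continuous_snd))
    exact measurable_lipScale_family hF r (hDm f)
  have hAanti : ∀ f k r r', r' ≤ r → A f k r ⊆ A f k r' := fun f k r r' h x hx =>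
    (lipScale_mono _ x h).trans hx
  refine ⟨D, fun f k r => Z \ A f k r, hD0, fun f k ε hε => ?_, fun f k r x hx hxB => ?_⟩
  · have h1 : ∃ n : ℕ, μ (Z \ A f k (1 / ((n : ℝ) + 1))) ≤ ε := by
      refine exists_measure_le_of_antitone (B := fun n : ℕ => Z \ A f k (1 / ((n : ℝ) + 1)))
        ?_ ?_ ?_ ?_ hε
      · intro m n hmn
        exact sdiff_subset_sdiff_right (hAanti _ _ _ _ (by gcongr))
      · exact fun n => hZ.nullMeasurableSet.diff (hAm _ _ _).nullMeasurableSet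
      · exact ne_top_of_le_ne_top hfin (measure_mono sdiff_subset)
      · filter_upwards [hD0 f] with x hx0
        by_cases hx : x ∈ Z
        · have h2 : lipAt (f.1 - linForm ξ (D f x)) x < ENNReal.ofReal ((1 / 2) ^ k) := by
            rw [hx0 hx]
            exact ENNReal.ofReal_pos.2 (by positivity)
          obtain ⟨m, hm⟩ := iInf_lt_iff.1 h2
          exact ⟨m, fun h => h.2 hm.le⟩
        · exact ⟨0, fun h => hx h.1⟩
    obtain ⟨m, hm⟩ := h1
    refine ⟨1 / ((m : ℝ) + 1), by positivity, fun r hr => le_trans (measure_mono ?_) hm⟩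
    exact sdiff_subset_sdiff_right (hAanti _ _ _ _ hr)
  · by_contra h
    exact hxB ⟨hx, h⟩

end Annulus

/-! ### Limits of alternating sums -/

theorem exists_tendsto_of_abs_sub_le {S s : ℕ → ℝ} {K : ℝ} (hK : 0 ≤ K) (hs : Antitone s)
    (h : ∀ i, |S (i + 1) - S i| ≤ K * (1 / 2) ^ i * s i) :
    ∃ u, Tendsto S atTop (𝓝 u) ∧ ∀ k, |S k - u| ≤ 2 * K * (1 / 2) ^ k * s k := by
  have hd : ∀ k n, dist (S (n + k)) (S (n + 1 + k)) ≤ 2 * K * (1 / 2) ^ k * s k / 2 / 2 ^ n := by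
    intro k n
    rw [dist_comm, Real.dist_eq, add_right_comm]
    refine (h (n + k)).trans ?_
    calc K * (1 / 2) ^ (n + k) * s (n + k) ≤ K * (1 / 2) ^ (n + k) * s k := by
          gcongr
          exact hs (Nat.le_add_left k n)
      _ = _ := by rw [pow_add, one_div, inv_pow, inv_pow]; field_simp
  obtain ⟨u, hu⟩ := cauchySeq_tendsto_of_complete (cauchySeq_of_le_geometric_two (hd 0))
  refine ⟨u, hu, fun k => ?_⟩
  have h1 := dist_le_of_le_geometric_two_of_tendsto₀ (f := fun n => S (n + k)) (hd k)
    ((tendsto_add_atTop_iff_nat k).2 hu)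
  simpa [Real.dist_eq] using h1

/-- Two points at distance `d` with `s (m + 1) ≤ d < s m`: the sum `S m` is controlled at this
scale by its Lipschitz constant, the next increment by its Hajłasz gradient, and the remainder by
its size relative to `s (m + 1)`. -/
theorem abs_sub_le_of_separated_scales {S : ℕ → ℝ} {S' : ℕ → ℝ} {r s : ℕ → ℝ} {u u' K d : ℝ}
    (hd : 0 < d) (hK : 0 ≤ K) (hs0 : Tendsto s atTop (𝓝 0)) (hsp : ∀ k, 0 < s k)
    (hsr : ∀ k, s k < r k)
    (hzero : S 0 = S' 0) (hS : ∀ k, d < r k → |S k - S' k| ≤ K * d)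
    (hstep : ∀ k, |(S (k + 1) - S k) - (S' (k + 1) - S' k)| ≤ 2 * K * d)
    (hu : ∀ k, |S k - u| ≤ 2 * K * (1 / 2) ^ k * s k)
    (hu' : ∀ k, |S' k - u'| ≤ 2 * K * (1 / 2) ^ k * s k) : |u - u'| ≤ 7 * K * d := by
  have hex : ∃ m, s m ≤ d := ((hs0.eventually (gt_mem_nhds hd)).exists).imp fun _ h => le_of_lt h
  classical
  set m := Nat.find hex with hm
  have hmd : s m ≤ d := Nat.find_spec hex
  have hSm : |S m - S' m| ≤ 3 * K * d := by
    rcases hm0 : m with _ | m'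
    · rw [hzero, sub_self, abs_zero]
      positivity
    · have h1 : d < s m' := not_le.1 (Nat.find_min hex (by omega))
      have h2 := hS m' (h1.trans (hsr m'))
      have h3 := hstep m'
      have h4 := abs_add_le (S m' - S' m') (S (m' + 1) - S m' - (S' (m' + 1) - S' m'))
      have h5 : S m' - S' m' + (S (m' + 1) - S m' - (S' (m' + 1) - S' m')) =
          S (m' + 1) - S' (m' + 1) := by ring
      rw [h5] at h4
      linarith
  have hsmall : 2 * K * (1 / 2) ^ m * s m ≤ 2 * K * d := by
    have h1 : ((1 : ℝ) / 2) ^ m ≤ 1 := pow_le_one₀ (by norm_num) (by norm_num)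
    have h2 := (hsp m).le
    calc 2 * K * (1 / 2) ^ m * s m ≤ 2 * K * 1 * d := by gcongr
      _ = _ := by ring
  have h1 := hu m
  have h2 := hu' m
  have h3 : u - u' = (S m - S' m) + ((S' m - u') - (S m - u)) := by ring
  rw [h3]
  have h4 := abs_add_le (S m - S' m) ((S' m - u') - (S m - u))
  have h5 := abs_sub (S' m - u') (S m - u)
  linarith

section Limit

variable {X : Type*} [MetricSpace X] {n : ℕ} {ξ : X → EuclideanSpace ℝ (Fin n)} {c : ℝ} {Λ : ℝ≥0}

/-- At the scales between `s k` and `r k` the sum `S k` is close both to its own linearization and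
to the limit function `f`. If every linear form is seen at these scales, then the differentials of
`S k` converge to that of `f`. -/
theorem tendsto_differential_of_separated_scales (hξ : LipschitzWith Λ ξ) (hc : 0 < c)
    {E : Set X} {f : X → ℝ} {S : ℕ → X → ℝ} {r s : ℕ → ℝ} {K : ℝ} (hK : 0 ≤ K) {x : X}
    (hx : x ∈ E) (hu : ∀ z ∈ E, ∀ k, |S k z - f z| ≤ 2 * K * (1 / 2) ^ k * s k)
    (hr0 : Tendsto r atTop (𝓝 0)) (hsp : ∀ k, 0 < s k)
    {V : EuclideanSpace ℝ (Fin n)} (hV : lipAt (f - linForm ξ V) x = 0)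
    (hdens : ∀ δ > 0, ∃ ρ > 0, ∀ y, dist y x < ρ → ∃ z ∈ E, dist z y ≤ δ * dist y x)
    {D : ℕ → EuclideanSpace ℝ (Fin n)}
    (hD : ∀ᶠ k in atTop, lipScale (S k - linForm ξ (D k)) (r k) x ≤ ENNReal.ofReal ((1 / 2) ^ k))
    (hann : ∀ᶠ k in atTop, ∀ v ≠ 0, ∃ y, 2 * s k < dist y x ∧ dist y x < r k / 2 ∧
      c / 2 * ‖v‖ * dist y x ≤ |linForm ξ v y - linForm ξ v x|) :
    Tendsto D atTop (𝓝 V) := by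
  rw [Metric.tendsto_nhds]
  intro η hη
  have hΛ := NNReal.coe_nonneg Λ
  set θ : ℝ := min (1 / 2) (c / (4 * (Λ + 1))) with hθ
  have hθ0 : 0 < θ := by positivity
  have hθ1 : θ ≤ 1 / 2 := min_le_left _ _
  have hθ2 : Λ * θ ≤ c / 4 := by
    have h1 : θ ≤ c / (4 * (Λ + 1)) := min_le_right _ _
    rw [le_div_iff₀ (by positivity)] at h1
    nlinarith
  obtain ⟨ρ, hρ, hden⟩ := hdens θ hθ0
  set ε : ℝ := η * c / 24 with hε
  have hε0 : 0 < ε := by positivity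
  obtain ⟨ρ', hρ', hfV⟩ := exists_forall_abs_sub_le_of_lipAt_lt
    (f := f - linForm ξ V) (x := x) (c := ε) (by rw [hV]; exact ENNReal.ofReal_pos.2 hε0)
  have hpow : Tendsto (fun k : ℕ => (1 + 4 * K) * (1 / 2 : ℝ) ^ k) atTop (𝓝 ((1 + 4 * K) * 0)) :=
    (tendsto_pow_atTop_nhds_zero_of_lt_one (by norm_num) (by norm_num)).const_mul _
  rw [mul_zero] at hpow
  filter_upwards [hD, hann, hpow.eventually (gt_mem_nhds hε0), hr0.eventually (gt_mem_nhds hρ),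
    hr0.eventually (gt_mem_nhds hρ')] with k hDk hak hpk hrk hrk'
  rcases eq_or_ne (D k - V) 0 with hw | hw
  · rwa [dist_eq_norm, hw, norm_zero]
  rw [dist_eq_norm]
  obtain ⟨y, hy1, hy2, hy⟩ := hak _ hw
  set w := D k - V with hwdef
  have hsk := hsp k
  have hd0 : 0 < dist y x := by linarith
  obtain ⟨z, hzE, hzy⟩ := hden y (by linarith)
  have hzy' : dist z y ≤ dist y x / 2 := by nlinarith
  have hzx1 : dist z x ≤ 3 / 2 * dist y x := by
    have := dist_triangle z y x
    linarith
  have hzx2 : dist y x / 2 ≤ dist z x := by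
    have := dist_triangle y z x
    rw [dist_comm y z] at this
    linarith
  have hzr : dist z x < r k := by linarith
  have hzs : s k < dist z x := by linarith
  -- the increment of `w · ξ` from `x` to `z` is large
  have hlow : c / 4 * ‖w‖ * dist y x ≤ |linForm ξ w z - linForm ξ w x| := by
    have h1 := abs_linForm_sub_le hξ w z y
    have h2 := abs_sub_abs_le_abs_sub (linForm ξ w y - linForm ξ w x) (linForm ξ w y - linForm ξ w z)
    rw [sub_sub_sub_cancel_left] at h2
    rw [dist_comm y z] at h1
    have h3 : Λ * ‖w‖ * dist z y ≤ c / 4 * ‖w‖ * dist y x := by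
      calc Λ * ‖w‖ * dist z y ≤ Λ * ‖w‖ * (θ * dist y x) := by gcongr
        _ = (Λ * θ) * (‖w‖ * dist y x) := by ring
        _ ≤ c / 4 * (‖w‖ * dist y x) := by gcongr
        _ = _ := by ring
    nlinarith
  -- and it is small, by comparison with `S k` and with `f`
  have hup : |linForm ξ w z - linForm ξ w x| ≤ 2 * ε * dist z x := by
    have h1 := abs_sub_le_of_diffQuot_le (f := S k - linForm ξ (D k)) (by positivity)
      ((diffQuot_le_lipScale _ hzr).trans hDk)
    have h2 := hfV z (by linarith)
    have h3 := hu z hzE k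
    have h4 := hu x hx k
    simp only [Pi.sub_apply] at h1 h2
    have e : linForm ξ w z - linForm ξ w x =
        ((f z - linForm ξ V z - (f x - linForm ξ V x)) -
          (S k z - linForm ξ (D k) z - (S k x - linForm ξ (D k) x))) +
        ((S k z - f z) - (S k x - f x)) := by
      rw [hwdef, map_sub]
      simp only [Pi.sub_apply]
      ring
    rw [e]
    have h5 : 2 * K * (1 / 2) ^ k * s k ≤ 2 * K * (1 / 2) ^ k * dist z x := by gcongr
    have h6 := abs_add_le ((f z - linForm ξ V z - (f x - linForm ξ V x)) -
          (S k z - linForm ξ (D k) z - (S k x - linForm ξ (D k) x))) ((S k z - f z) - (S k x - f x))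
    have h7 := abs_sub (f z - linForm ξ V z - (f x - linForm ξ V x))
      (S k z - linForm ξ (D k) z - (S k x - linForm ξ (D k) x))
    have h8 := abs_sub (S k z - f z) (S k x - f x)
    have h9 : (1 + 4 * K) * (1 / 2) ^ k * dist z x ≤ ε * dist z x := by gcongr
    linarith
  have hfinal : c / 4 * ‖w‖ ≤ 3 * ε := by
    refine le_of_mul_le_mul_right ?_ hd0
    calc c / 4 * ‖w‖ * dist y x ≤ 2 * ε * dist z x := hlow.trans hup
      _ ≤ 2 * ε * (3 / 2 * dist y x) := by gcongr
      _ = _ := by ring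
  have h1 : c * ‖w‖ ≤ c * (η / 2) := by
    rw [hε] at hfinal
    linarith
  have h2 := le_of_mul_le_mul_left h1 hc
  linarith

end Limit

section Main

variable {X : Type*} [MetricSpace X] [MeasurableSpace X] {μ : Measure X} {p : ℝ≥0∞}
  {h : ℕ → boundedSupportLipschitz X} {l : X → ℝ≥0∞} {τ : ℕ → X → ℝ≥0∞}

omit [MeasurableSpace X] in
theorem lipAt_alternatingSum_le {H : ℕ → boundedSupportLipschitz X}
    (hH : ∀ k, H k ∈ tailHull h k) {x : X}
    (hτ : ∀ k, ∀ f ∈ tailHull h k, ∀ g ∈ tailHull h k, lipAt (f.1 - g.1) x ≤ τ k x)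
    (hl : ∀ f ∈ tailHull h 0, lipAt f.1 x ≤ l x) (k : ℕ) :
    lipAt (alternatingSum H k).1 x ≤ l x + ∑' i, τ i x := by
  have h0 : lipAt (alternatingSum H 0).1 x = 0 := by
    change lipAt (0 : X → ℝ) x = 0
    exact lipAt_zero x
  have key : ∀ k, lipAt (alternatingSum H k).1 x ≤ l x + ∑ i ∈ Finset.range k, τ i x := by
    intro k
    induction k using Nat.twoStepInduction with
    | zero => rw [h0]; exact zero_le
    | one =>
      have e : alternatingSum H 1 = H 0 := by simp [alternatingSum]
      rw [e]
      exact (hl _ (hH 0)).trans le_self_add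
    | more k ih _ =>
      have e : (alternatingSum H (k + 2)).1 =
          (alternatingSum H k).1 + (-1 : ℝ) ^ k • ((H k).1 - (H (k + 1)).1) := by
        rw [alternatingSum_succ, alternatingSum_succ, pow_succ]
        change (alternatingSum H k).1 + (-1 : ℝ) ^ k • (H k).1 +
          ((-1 : ℝ) ^ k * -1) • (H (k + 1)).1 = _
        rw [smul_sub, mul_neg_one, neg_smul]
        abel
      rw [e]
      refine (lipAt_add_le _ _ _).trans ?_
      rw [lipAt_smul, abs_neg_one_pow, ENNReal.ofReal_one, one_mul]
      calc _ ≤ l x + ∑ i ∈ Finset.range k, τ i x + τ k x :=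
            add_le_add ih (hτ k _ (hH k) _ (tailHull_anti h (Nat.le_succ k) (hH (k + 1))))
        _ = l x + ∑ i ∈ Finset.range (k + 1), τ i x := by rw [Finset.sum_range_succ, add_assoc]
        _ ≤ _ := by
          gcongr
          omega
  refine (key k).trans ?_
  gcongr
  exact ENNReal.sum_le_tsum _

variable [BorelSpace X] [TopologicalSpace.SeparableSpace X] [Nonempty X] {Z : Set X} {n : ℕ}
  {ξ : X → EuclideanSpace ℝ (Fin n)} {c : ℝ}

/-- If `h j → 0` in `L^p` with bounded Hajłasz gradients, and the Lipschitz constants of the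
differences are summable, then the Lipschitz constants of `h j` tend to zero a.e. on each piece.
For the alternating sums of convex combinations `H k` converge, off sets of small measure, to
Lipschitz functions, and the differentials of the sums converge to those of the limits; hence the
differentials of the terms tend to zero. -/
theorem IsDiffPiece.ae_tendsto_lipAt (hZ : IsDiffPiece μ Z ξ c) (hfin : μ Z ≠ ∞)
    (hμ : IsDoublingMeasure μ) (hp1 : 1 < p) (hp : p ≠ ∞) (hl : AEMeasurable l μ)
    (hlp : eLpNorm l p μ ≠ ∞) (hτm : ∀ k, AEMeasurable (τ k) μ)
    (hτs : ∑' k, eLpNorm (τ k) p μ ≠ ∞)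
    (h0 : Tendsto (fun j => eLpNorm (h j).1 p μ) atTop (𝓝 0))
    (hτ : ∀ k, ∀ f ∈ tailHull h k, ∀ g ∈ tailHull h k, ∀ x, lipAt (f.1 - g.1) x ≤ τ k x)
    (hll : ∀ f ∈ tailHull h 0, ∀ x, lipAt f.1 x ≤ l x) {C : ℝ}
    (hC : ∀ j, ∃ G, IsHajlaszBound μ (h j).1 G ∧ eLpNorm G p μ ≤ ENNReal.ofReal C) :
    ∀ᵐ x ∂μ, x ∈ Z → Tendsto (fun k => lipAt (h k).1 x) atTop (𝓝 0) := by
  have hp0 : p ≠ 0 := (one_pos.trans hp1).ne'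
  obtain ⟨Λ, hξ⟩ := hZ.lipschitz
  obtain ⟨B₂, hB₂, hann⟩ := hZ.exists_annulus_exceptional hfin
  obtain ⟨D, B₁, hD0, hB₁, hD⟩ := hZ.exists_differential_exceptional hfin
  obtain ⟨H, r, s, δ, β, hs⟩ := exists_isScaleSequence hμ hp1 hp hl h0
    (fun j x => hll _ (mem_tailHull_of_le h (Nat.zero_le j)) x) hC hB₁ hB₂
  have hrp : ∀ k, 0 < r k := fun k => (hs.pos k).trans (hs.lt k)
  have hr0 : Tendsto r atTop (𝓝 0) :=
    tendsto_of_tendsto_of_tendsto_of_le_of_le tendsto_const_nhds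
      (tendsto_pow_atTop_nhds_zero_of_lt_one (by norm_num) (by norm_num : (1 / 2 : ℝ) < 1))
      (fun k => (hrp k).le) hs.le_pow
  have hs0 : Tendsto s atTop (𝓝 0) :=
    tendsto_of_tendsto_of_tendsto_of_le_of_le tendsto_const_nhds hr0
      (fun k => (hs.pos k).le) fun k => (hs.lt k).le
  have hsanti : Antitone s := antitone_nat_of_succ_le fun k =>
    ((hs.lt (k + 1)).trans (hs.succ_lt k)).le
  -- the size of `H k` relative to the scale `s k`
  set a : ℕ → X → ℝ≥0∞ := fun k x => 2 ^ k * (ENNReal.ofReal (s k))⁻¹ * ‖(H k).1 x‖ₑ with ha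
  have ham : ∀ k, AEMeasurable (a k) μ := fun k =>
    (aestronglyMeasurable_of_mem_boundedSupportLipschitz (H k).2).enorm.const_mul _
  have han : ∀ k, eLpNorm (a k) p μ ≤ 2⁻¹ ^ k := by
    intro k
    have hs1 : ENNReal.ofReal (s k) ≠ 0 := (ENNReal.ofReal_pos.2 (hs.pos k)).ne'
    simp only [ha]
    rw [eLpNorm_const_mul_ennreal hp0 hp _
      (aestronglyMeasurable_of_mem_boundedSupportLipschitz (H k).2).enorm, eLpNorm_enorm]
    calc _ ≤ 2 ^ k * (ENNReal.ofReal (s k))⁻¹ * (ENNReal.ofReal (s k) * 4⁻¹ ^ k) := by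
          gcongr
          exact hs.eLpNorm_le k
      _ = (ENNReal.ofReal (s k))⁻¹ * ENNReal.ofReal (s k) * (2 ^ k * 4⁻¹ ^ k) := by ring
      _ = 2⁻¹ ^ k := by
        rw [ENNReal.inv_mul_cancel hs1 ENNReal.ofReal_ne_top, one_mul, ← mul_pow]
        congr 1
        have : (4 : ℝ≥0∞) = 2 * 2 := by norm_num
        rw [this, ENNReal.mul_inv (by simp) (by simp), ← mul_assoc,
          ENNReal.mul_inv_cancel (by simp) (by simp), one_mul]
  have hfinite : ∀ f : ℕ → X → ℝ≥0∞, (∀ k, AEMeasurable (f k) μ) →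
      ∑' k, eLpNorm (f k) p μ ≠ ∞ → ∀ᵐ x ∂μ, ∑' k, f k x < ∞ := by
    intro f hf hfs
    exact ae_lt_top_of_eLpNorm_ne_top hp0 hp (AEMeasurable.tsum hf)
      (ne_top_of_le_ne_top hfs (eLpNorm_tsum_le hp1.le hp hf))
  have hgeom : ∀ f : ℕ → X → ℝ≥0∞, (∀ k, eLpNorm (f k) p μ ≤ 2⁻¹ ^ k) →
      ∑' k, eLpNorm (f k) p μ ≠ ∞ := fun f hf =>
    ne_top_of_le_ne_top ENNReal.tsum_two_inv_pow_ne_top (ENNReal.tsum_le_tsum hf)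
  set Γ : X → ℝ≥0∞ := fun x => l x + ∑' k, τ k x + ∑' k, δ k x + ∑' k, β k x + ∑' k, a k x with hΓ
  have hΓm : AEMeasurable Γ μ := (((hl.add (AEMeasurable.tsum hτm)).add
    (AEMeasurable.tsum hs.aemeasurable_excess)).add
    (AEMeasurable.tsum hs.aemeasurable_error)).add (AEMeasurable.tsum ham)
  have hτfin := hfinite τ hτm hτs
  have hΓfin : ∀ᵐ x ∂μ, Γ x < ∞ := by
    filter_upwards [ae_lt_top_of_eLpNorm_ne_top hp0 hp hl hlp, hτfin,
      hfinite δ hs.aemeasurable_excess (hgeom δ hs.eLpNorm_excess_le),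
      hfinite β hs.aemeasurable_error (hgeom β hs.eLpNorm_error_le),
      hfinite a ham (hgeom a han)] with x h1 h2 h3 h4 h5
    simp only [hΓ, ENNReal.add_lt_top]
    exact ⟨⟨⟨⟨h1, h2⟩, h3⟩, h4⟩, h5⟩
  choose N hN hHN using fun k => (hs.isHajlaszBound k).le
  set E : ℕ → Set X := fun K => {x | Γ x ≤ K} \ ⋃ k, N k with hE
  have hN0 : μ (⋃ k, N k) = 0 := measure_iUnion_null hN
  have hEm : ∀ K, NullMeasurableSet (E K) μ := fun K =>
    (nullMeasurableSet_le hΓm aemeasurable_const).diff (NullMeasurableSet.of_null hN0)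
  -- on `E K` the alternating sums converge to a Lipschitz function
  have hterm : ∀ K, ∀ x ∈ E K, ∀ k, |(alternatingSum H (k + 1)).1 x - (alternatingSum H k).1 x| ≤
      K * (1 / 2) ^ k * s k := by
    intro K x hx k
    have h1 : a k x ≤ K := (le_add_of_le_right (ENNReal.le_tsum (f := fun k => a k x) k)).trans hx.1
    have h2 := ENNReal.toReal_mono (ENNReal.natCast_ne_top K) h1
    simp only [ha] at h2
    rw [ENNReal.toReal_mul, ENNReal.toReal_mul, ENNReal.toReal_pow, ENNReal.toReal_inv,
      ENNReal.toReal_ofReal (hs.pos k).le, toReal_enorm, ENNReal.toReal_natCast,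
      ENNReal.toReal_ofNat, Real.norm_eq_abs] at h2
    have e : (alternatingSum H (k + 1)).1 x - (alternatingSum H k).1 x =
        (-1 : ℝ) ^ k * (H k).1 x := by
      rw [alternatingSum_succ]
      change (alternatingSum H k).1 x + (-1 : ℝ) ^ k * (H k).1 x - _ = _
      ring
    rw [e, abs_mul, abs_neg_one_pow, one_mul]
    have hsk := hs.pos k
    calc |(H k).1 x| = 2 ^ k * (s k)⁻¹ * |(H k).1 x| * ((1 / 2) ^ k * s k) := by
          rw [one_div, inv_pow]
          field_simp
      _ ≤ K * ((1 / 2) ^ k * s k) := by gcongr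
      _ = _ := by ring
  have hlim : ∀ K : ℕ, ∀ x : X, ∃ u, x ∈ E K → ∀ k,
      |(alternatingSum H k).1 x - u| ≤ 2 * K * (1 / 2) ^ k * s k := by
    intro K x
    by_cases hx : x ∈ E K
    · obtain ⟨u, -, hu⟩ := exists_tendsto_of_abs_sub_le
        (S := fun k => (alternatingSum H k).1 x) (Nat.cast_nonneg K) hsanti (hterm K x hx)
      exact ⟨u, fun _ => hu⟩
    · exact ⟨0, fun h => absurd h hx⟩
  choose u hu using hlim
  have hLip : ∀ K : ℕ, LipschitzOnWith (7 * K : ℝ≥0) (u K) (E K) := by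
    intro K
    refine LipschitzOnWith.of_dist_le_mul fun x hx y hy => ?_
    rcases eq_or_ne x y with rfl | hxy
    · simp
    rw [Real.dist_eq]
    push_cast
    refine abs_sub_le_of_separated_scales (S := fun k => (alternatingSum H k).1 x)
      (S' := fun k => (alternatingSum H k).1 y) (r := r) (s := s) (dist_pos.2 hxy)
      (Nat.cast_nonneg K) hs0 hs.pos hs.lt rfl ?_ ?_ (hu K x hx) (hu K y hy)
    · intro k hk
      refine abs_sub_le_of_diffQuot_le (Nat.cast_nonneg K) ?_
      refine (diffQuot_le_lipScale _ hk).trans ((hs.lipScale_le k y).trans ?_)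
      rw [ENNReal.ofReal_natCast]
      refine le_trans ?_ hy.1
      have h1 := lipAt_alternatingSum_le hs.mem_tailHull (fun k f hf g hg => hτ k f hf g hg y)
        (fun f hf => hll f hf y) k
      have h2 : β k y ≤ ∑' k, β k y := ENNReal.le_tsum k
      calc _ ≤ l y + ∑' k, τ k y + ∑' k, β k y := add_le_add h1 h2
        _ ≤ _ := by
          simp only [hΓ]
          exact (add_le_add le_self_add le_rfl).trans le_self_add
    · intro k
      have e : (alternatingSum H (k + 1)).1 x - (alternatingSum H k).1 x -
          ((alternatingSum H (k + 1)).1 y - (alternatingSum H k).1 y) =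
          (-1 : ℝ) ^ k * ((H k).1 x - (H k).1 y) := by
        rw [alternatingSum_succ]
        change (alternatingSum H k).1 x + (-1 : ℝ) ^ k * (H k).1 x - _ -
          ((alternatingSum H k).1 y + (-1 : ℝ) ^ k * (H k).1 y - _) = _
        ring
      rw [e, abs_mul, abs_neg_one_pow, one_mul]
      refine abs_sub_le_of_diffQuot_le (by positivity) ?_
      have hb : ∀ z ∈ E K, l z + δ k z ≤ K := by
        intro z hz
        refine le_trans ?_ hz.1
        have h2 : δ k z ≤ ∑' k, δ k z := ENNReal.le_tsum k
        simp only [hΓ]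
        refine le_trans ?_ (le_self_add.trans le_self_add)
        gcongr
        exact le_self_add
      have hnot : ∀ z ∈ E K, z ∉ N k := fun z hz h => hz.2 (mem_iUnion.2 ⟨k, h⟩)
      refine (hHN k y (hnot y hy) x (hnot x hx)).trans ((add_le_add (hb y hy) (hb x hx)).trans ?_)
      rw [ENNReal.ofReal_mul (by norm_num), ENNReal.ofReal_natCast, ENNReal.ofReal_ofNat, two_mul]
  choose f hfL hfE using fun K => (hLip K).extend_real
  choose V hV using fun K => hZ.exists_differential (f K) ⟨_, hfL K⟩
  have hBC1 : ∀ᵐ x ∂μ, ∀ᶠ k in atTop, x ∉ B₁ (alternatingSum H k) k (r k) :=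
    ae_eventually_notMem (ne_top_of_le_ne_top ENNReal.tsum_two_inv_pow_ne_top
      (ENNReal.tsum_le_tsum hs.measure_fst_le))
  have hBC2 : ∀ᵐ x ∂μ, ∀ᶠ k in atTop, x ∉ B₂ (r k) (s k) :=
    ae_eventually_notMem (ne_top_of_le_ne_top ENNReal.tsum_two_inv_pow_ne_top
      (ENNReal.tsum_le_tsum hs.measure_snd_le))
  filter_upwards [hΓfin, hτfin, hBC1, hBC2, compl_mem_ae_iff.2 hN0,
    ae_all_iff.2 fun K => hμ.ae_exists_dist_le (hEm K),
    ae_all_iff.2 fun k => hD0 (alternatingSum H k),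
    ae_all_iff.2 fun K => (hV K).ae_lipAt_eq_zero hZ.nullMeasurableSet] with
    x hx1 hx2 hx3 hx4 hx5 hx6 hx7 hx8 hxZ
  obtain ⟨K, hK⟩ := ENNReal.exists_nat_gt hx1.ne
  have hxE : x ∈ E K := ⟨hK.le, hx5⟩
  have hDV : Tendsto (fun k => D (alternatingSum H k) x) atTop (𝓝 (V K x)) := by
    refine tendsto_differential_of_separated_scales (S := fun k => (alternatingSum H k).1)
      hξ hZ.pos (Nat.cast_nonneg K) hxE (fun z hz k => ?_) hr0 hs.pos (hx8 K hxZ) (hx6 K hxE) ?_ ?_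
    · rw [← hfE K hz]
      exact hu K z hz k
    · filter_upwards [hx3] with k hk using hD _ _ _ x hxZ hk
    · filter_upwards [hx4] with k hk using hann _ _ x hxZ hk
  have hstep : ∀ k, lipAt (H k).1 x ≤
      ENNReal.ofReal (Λ * ‖D (alternatingSum H (k + 1)) x - D (alternatingSum H k) x‖) := by
    intro k
    have e : (-1 : ℝ) ^ k • (H k).1 =
        linForm ξ (D (alternatingSum H (k + 1)) x - D (alternatingSum H k) x) +
        (((alternatingSum H (k + 1)).1 - linForm ξ (D (alternatingSum H (k + 1)) x)) -
          ((alternatingSum H k).1 - linForm ξ (D (alternatingSum H k) x))) := by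
      have e1 : (alternatingSum H (k + 1)).1 = (alternatingSum H k).1 + (-1 : ℝ) ^ k • (H k).1 :=
        congrArg Subtype.val (alternatingSum_succ H k)
      rw [map_sub, e1]
      abel
    have e2 := lipAt_smul ((-1 : ℝ) ^ k) (H k).1 x
    rw [abs_neg_one_pow, ENNReal.ofReal_one, one_mul] at e2
    rw [← e2, e]
    refine (lipAt_add_le _ _ _).trans ?_
    refine (add_le_add (lipAt_linForm_le hξ _ x) (lipAt_sub_le _ _ x)).trans ?_
    rw [hx7 (k + 1) hxZ, hx7 k hxZ, add_zero, add_zero]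
  have hHlim : Tendsto (fun k => ENNReal.ofReal
      (Λ * ‖D (alternatingSum H (k + 1)) x - D (alternatingSum H k) x‖)) atTop (𝓝 0) := by
    have h1 := ((((tendsto_add_atTop_iff_nat 1).2 hDV).sub hDV).norm).const_mul (Λ : ℝ)
    rw [sub_self, norm_zero, mul_zero] at h1
    have h2 := ENNReal.tendsto_ofReal h1
    rwa [ENNReal.ofReal_zero] at h2
  have hsum := hHlim.add (ENNReal.tendsto_atTop_zero_of_tsum_ne_top hx2.ne)
  rw [add_zero] at hsum
  refine tendsto_of_tendsto_of_tendsto_of_le_of_le tendsto_const_nhds hsum (fun _ => zero_le)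
    fun k => ?_
  have h1 := lipAt_add_le (H k).1 ((h k).1 - (H k).1) x
  rw [add_sub_cancel] at h1
  exact h1.trans (add_le_add (hstep k)
    (hτ k _ (mem_tailHull_of_le h le_rfl) _ (hs.mem_tailHull k) x))

end Main

/-! ### Sequences of Lipschitz functions that tend to zero in `L^p` -/

section ZeroLimit

variable {X : Type*} [MetricSpace X] [MeasurableSpace X] {μ : Measure X} {p : ℝ≥0∞}

theorem convex_setOf_isHajlaszBound (hp1 : 1 ≤ p) (hp : p ≠ ∞) (c : ℝ≥0∞)
    (V : Submodule ℝ (X → ℝ)) :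
    Convex ℝ {f : V | ∃ G, IsHajlaszBound μ f.1 G ∧ eLpNorm G p μ ≤ c} := by
  have hp0 : p ≠ 0 := (one_pos.trans_le hp1).ne'
  rintro f ⟨F, hF, hFc⟩ g ⟨G, hG, hGc⟩ a b ha hb hab
  refine ⟨_, (hF.smul a).add (hG.smul b), ?_⟩
  refine (eLpNorm_add_le_of_aemeasurable (hF.smul a).aemeasurable (hG.smul b).aemeasurable
    hp1).trans ?_
  rw [eLpNorm_const_mul_ennreal hp0 hp _ hF.aemeasurable,
    eLpNorm_const_mul_ennreal hp0 hp _ hG.aemeasurable, abs_of_nonneg ha, abs_of_nonneg hb]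
  calc _ ≤ ENNReal.ofReal a * c + ENNReal.ofReal b * c := by gcongr
    _ = c := by rw [← add_mul, ← ENNReal.ofReal_add ha hb, hab, ENNReal.ofReal_one, one_mul]

omit [MeasurableSpace X] in
theorem lipAt_sub_le_of_mem_tailHull {z : ℕ → boundedSupportLipschitz X} {k : ℕ}
    {f : boundedSupportLipschitz X} (hf : f ∈ tailHull z k) (x : X) :
    lipAt (f.1 - (z k).1) x ≤ ∑' i, lipAt ((z (i + k)).1 - (z (i + k + 1)).1) x := by
  have h1 : ∀ n, lipAt ((z (n + k)).1 - (z k).1) x ≤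
      ∑ i ∈ Finset.range n, lipAt ((z (i + k)).1 - (z (i + k + 1)).1) x := by
    intro n
    induction n with
    | zero => simp
    | succ n ih =>
      rw [Finset.sum_range_succ, add_right_comm n 1 k]
      refine (lipAt_sub_le_add _ (z (n + k)).1 _ x).trans ?_
      rw [lipAt_sub_comm, add_comm]
      gcongr
  have hconv : Convex ℝ {f : boundedSupportLipschitz X | lipAt (f.1 - (z k).1) x ≤
      ∑' i, lipAt ((z (i + k)).1 - (z (i + k + 1)).1) x} :=
    (convex_setOf_lipAt_sub_le (z k).1 x _).linear_preimage (boundedSupportLipschitz X).subtype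
  have hmem : f ∈ {f : boundedSupportLipschitz X | lipAt (f.1 - (z k).1) x ≤
      ∑' i, lipAt ((z (i + k)).1 - (z (i + k + 1)).1) x} := by
    refine tailHull_subset hconv (fun j hj => ?_) hf
    rw [mem_ofPred_eq]
    obtain ⟨n, rfl⟩ := Nat.exists_eq_add_of_le' hj
    exact (h1 n).trans (ENNReal.sum_le_tsum _)
  rwa [mem_ofPred_eq] at hmem

variable [BorelSpace X] [TopologicalSpace.SeparableSpace X] [Nonempty X]

/-- A sequence that is bounded in `M^{1,p}` and tends to zero in `L^p` has convex combinations of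
its tails that tend to zero in `M^{1,p}`: suitable convex combinations have Lipschitz constants
tending to zero in `L^p`, which are almost Hajłasz gradients of further convex combinations. -/
theorem DiffPartition.exists_mem_tailHull_small (P : DiffPartition μ) (hμ : IsDoublingMeasure μ)
    [Fact (1 ≤ p)] (hp1 : 1 < p) (hp : p < ∞) {h : ℕ → boundedSupportLipschitz X}
    (h0 : Tendsto (fun j => eLpNorm (h j).1 p μ) atTop (𝓝 0)) {C : ℝ}
    (hC : ∀ j, ∃ G, IsHajlaszBound μ (h j).1 G ∧ eLpNorm G p μ ≤ ENNReal.ofReal C)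
    {ε : ℝ≥0∞} (hε : 0 < ε) (k : ℕ) :
    ∃ H ∈ tailHull h k, eLpNorm H.1 p μ ≤ ε ∧ ∃ G, IsHajlaszBound μ H.1 G ∧ eLpNorm G p μ ≤ ε := by
  have hp0 : p ≠ 0 := (one_pos.trans hp1).ne'
  have hlipC : ∀ j, eLpNorm (lipAt (h j).1) p μ ≤ (2 * C.toNNReal : ℝ≥0) := by
    intro j
    obtain ⟨G, hG, hGC⟩ := hC j
    obtain ⟨⟨K, hK⟩, -⟩ := (h j).2
    have h1 := eLpNorm_le_of_ae_le (p := p) (hμ.lipAt_le_two_mul hK hG)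
    rw [eLpNorm_const_mul_ennreal hp0 hp.ne _ hG.aemeasurable] at h1
    refine h1.trans ?_
    push_cast
    gcongr
    exact hGC
  obtain ⟨y, hy, hyC⟩ := P.exists_tailHull_lipAt_cauchy hμ hp1 hp hlipC
  obtain ⟨ns, hns, hnsC⟩ := extraction_forall_of_eventually' (P := fun m N => ∀ i, N ≤ i → ∀ j,
      N ≤ j → eLpNorm (lipAt ((y i).1 - (y j).1)) p μ ≤ 2⁻¹ ^ m) fun m => by
    obtain ⟨N, hN⟩ := hyC (2⁻¹ ^ m) (ENNReal.pow_pos (by simp) m)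
    exact ⟨N, fun k hk i hi j hj => hN i (hk.trans hi) j (hk.trans hj)⟩
  set z : ℕ → boundedSupportLipschitz X := fun m => y (ns m) with hz
  have hzh : ∀ m, z m ∈ tailHull h m := tailHull_comp_strictMono hy hns
  have hzg : ∀ m, eLpNorm (lipAt ((z m).1 - (z (m + 1)).1)) p μ ≤ 2⁻¹ ^ m := fun m =>
    hnsC m _ le_rfl _ (hns.monotone (Nat.le_succ m))
  have hgm : ∀ m, AEMeasurable (lipAt ((z m).1 - (z (m + 1)).1)) μ := fun m =>
    (measurable_lipAt_coe (z m - z (m + 1))).aemeasurable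
  -- the tails of the series of Lipschitz constants of the differences
  set τ : ℕ → X → ℝ≥0∞ := fun k x => ∑' i, lipAt ((z (i + k)).1 - (z (i + k + 1)).1) x with hτ
  have hτm : ∀ k, AEMeasurable (τ k) μ := fun k => AEMeasurable.tsum fun i => hgm (i + k)
  have hτn : ∀ k, eLpNorm (τ k) p μ ≤ (∑' i : ℕ, (2⁻¹ : ℝ≥0∞) ^ i) * 2⁻¹ ^ k := by
    intro k
    refine (eLpNorm_tsum_le hp1.le hp.ne fun i => hgm (i + k)).trans ?_
    rw [← ENNReal.tsum_mul_right]
    refine ENNReal.tsum_le_tsum fun i => ?_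
    rw [← pow_add]
    exact hzg (i + k)
  have hτs : ∑' k, eLpNorm (fun x => 2 * τ k x) p μ ≠ ∞ := by
    refine ne_top_of_le_ne_top ?_ (ENNReal.tsum_le_tsum fun k =>
      (eLpNorm_const_mul_ennreal hp0 hp.ne 2 (hτm k)).le.trans (mul_le_mul_right (hτn k) 2))
    rw [ENNReal.tsum_mul_left, ENNReal.tsum_mul_left]
    exact ENNReal.mul_ne_top (by simp) (ENNReal.mul_ne_top ENNReal.tsum_two_inv_pow_ne_top
      ENNReal.tsum_two_inv_pow_ne_top)
  set l : X → ℝ≥0∞ := fun x => lipAt (z 0).1 x + τ 0 x with hl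
  have hlm : AEMeasurable l μ := (measurable_lipAt_coe (z 0)).aemeasurable.add (hτm 0)
  have hln : eLpNorm l p μ ≠ ∞ := by
    refine ne_top_of_le_ne_top ?_ (eLpNorm_add_le_of_aemeasurable
      (measurable_lipAt_coe (z 0)).aemeasurable (hτm 0) hp1.le)
    refine ENNReal.add_ne_top.2 ⟨DiffPartition.eLpNorm_lipAt_ne_top hμ hp0 hp.ne (z 0).2, ?_⟩
    refine ne_top_of_le_ne_top ?_ (hτn 0)
    exact ENNReal.mul_ne_top ENNReal.tsum_two_inv_pow_ne_top (by simp)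
  have hz0 : Tendsto (fun j => eLpNorm (z j).1 p μ) atTop (𝓝 0) := by
    rw [ENNReal.tendsto_nhds_zero] at h0 ⊢
    intro η hη
    obtain ⟨N, hN⟩ := eventually_atTop.1 (h0 η hη)
    filter_upwards [eventually_ge_atTop N] with j hj
    exact eLpNorm_le_of_mem_tailHull hp1.le (fun i hi => hN i (hj.trans hi)) (hzh j)
  have hzC : ∀ j, ∃ G, IsHajlaszBound μ (z j).1 G ∧ eLpNorm G p μ ≤ ENNReal.ofReal C := by
    intro j
    have hconv := convex_setOf_isHajlaszBound (μ := μ) hp1.le hp.ne (ENNReal.ofReal C)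
      (boundedSupportLipschitz X)
    have hmem : z j ∈ {f : boundedSupportLipschitz X | ∃ G, IsHajlaszBound μ f.1 G ∧
        eLpNorm G p μ ≤ ENNReal.ofReal C} := tailHull_subset hconv (fun i _ => hC i) (hzh j)
    rwa [mem_ofPred_eq] at hmem
  have hhull : ∀ k, ∀ f ∈ tailHull z k, ∀ g ∈ tailHull z k, ∀ x,
      lipAt (f.1 - g.1) x ≤ 2 * τ k x := by
    intro k f hf g hg x
    refine (lipAt_sub_le_add f.1 (z k).1 g.1 x).trans ?_
    rw [lipAt_sub_comm (z k).1, two_mul]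
    exact add_le_add (lipAt_sub_le_of_mem_tailHull hf x) (lipAt_sub_le_of_mem_tailHull hg x)
  have hll : ∀ f ∈ tailHull z 0, ∀ x, lipAt f.1 x ≤ l x := by
    intro f hf x
    have h1 := lipAt_add_le (z 0).1 (f.1 - (z 0).1) x
    rw [add_sub_cancel] at h1
    exact h1.trans (add_le_add le_rfl (lipAt_sub_le_of_mem_tailHull hf x))
  have hae : ∀ᵐ x ∂μ, Tendsto (fun k => lipAt (z k).1 x) atTop (𝓝 0) := by
    obtain ⟨x₀⟩ := ‹Nonempty X›
    have : Nonempty X := ⟨x₀⟩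
    have h1 : ∀ m n : ℕ, ∀ᵐ x ∂μ, x ∈ P.piece m ∩ Metric.ball x₀ n →
        Tendsto (fun k => lipAt (z k).1 x) atTop (𝓝 0) := by
      intro m n
      refine ((P.isDiffPiece m).mono ((P.isDiffPiece m).nullMeasurableSet.inter
        measurableSet_ball.nullMeasurableSet) inter_subset_left).ae_tendsto_lipAt ?_ hμ hp1 hp.ne
        hlm hln (τ := fun k x => 2 * τ k x) (fun k => (hτm k).const_mul 2) hτs hz0 hhull hll hzC
      exact ne_top_of_le_ne_top (hμ.measure_ball_lt_top x₀ n).ne (measure_mono inter_subset_right)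
    filter_upwards [ae_all_iff.2 fun m => ae_all_iff.2 (h1 m), P.ae_exists_mem] with x hx ⟨m, hm⟩
    obtain ⟨n, hn⟩ := exists_nat_gt (dist x x₀)
    exact hx m n ⟨hm, hn⟩
  have hlim : Tendsto (fun k => eLpNorm (lipAt (z k).1) p μ) atTop (𝓝 0) :=
    tendsto_eLpNorm_zero_of_dominated hp0 hp.ne
      (fun k => (measurable_lipAt_coe (z k)).aemeasurable)
      (fun k => Eventually.of_forall fun x =>
        hll _ (mem_tailHull_of_le z (Nat.zero_le k)) x) hln hae
  obtain ⟨N, hN⟩ := eventually_atTop.1 (ENNReal.tendsto_nhds_zero.1 hz0 ε hε)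
  obtain ⟨H, hH, G, hGm, hGn, hG⟩ := exists_mem_tailHull_excess_le hμ hp1 hp.ne
    (l := 0) aemeasurable_const hz0 (fun η hη => by
      obtain ⟨M, hM⟩ := eventually_atTop.1 (ENNReal.tendsto_nhds_zero.1 hlim η hη)
      exact ⟨M, fun j hj => ⟨_, (measurable_lipAt_coe (z j)).aemeasurable, hM j hj,
        Eventually.of_forall fun x => le_add_self⟩⟩) hzC hε (max k N)
  refine ⟨H, tailHull_trans hzh k (tailHull_anti z (le_max_left _ _) hH), ?_, G, ?_, hGn⟩
  · exact eLpNorm_le_of_mem_tailHull hp1.le (fun j hj => hN j ((le_max_right _ _).trans hj)) hH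
  · simpa using hG

end ZeroLimit

/-! ### Tail limits in `M^{1,p}` -/

section HajlaszTailLimits

variable {X : Type*} [MetricSpace X] [MeasurableSpace X] {μ : Measure X} {p : ℝ≥0∞}

theorem convex_setOf_hajlasz_relation : Convex ℝ {w : Lp ℝ p μ × Lp ℝ p μ |
    ∃ E : Set X, μ E = 0 ∧ ∀ x ∉ E, ∀ y ∉ E, |w.1 x - w.1 y| ≤ (w.2 x + w.2 y) * dist x y} := by
  rintro w ⟨E, hE, h⟩ w' ⟨E', hE', h'⟩ a b ha hb hab
  have hae : ∀ᵐ x ∂μ, (a • w + b • w').1 x = a * w.1 x + b * w'.1 x ∧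
      (a • w + b • w').2 x = a * w.2 x + b * w'.2 x := by
    filter_upwards [Lp.coeFn_add (a • w.1) (b • w'.1), Lp.coeFn_smul a w.1, Lp.coeFn_smul b w'.1,
      Lp.coeFn_add (a • w.2) (b • w'.2), Lp.coeFn_smul a w.2, Lp.coeFn_smul b w'.2] with
      x e1 e2 e3 e4 e5 e6
    constructor
    · change (a • w.1 + b • w'.1) x = _
      rw [e1, Pi.add_apply, e2, e3]
      rfl
    · change (a • w.2 + b • w'.2) x = _
      rw [e4, Pi.add_apply, e5, e6]
      rfl
  refine ⟨E ∪ E' ∪ _, measure_union_null (measure_union_null hE hE') hae, fun x hx y hy => ?_⟩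
  simp only [mem_union, mem_compl_iff, mem_ofPred_eq, not_or, not_not] at hx hy
  rw [hx.2.1, hx.2.2, hy.2.1, hy.2.2]
  have h1 := h x hx.1.1 y hy.1.1
  have h2 := h' x hx.1.2 y hy.1.2
  calc |a * w.1 x + b * w'.1 x - (a * w.1 y + b * w'.1 y)|
      = |a * (w.1 x - w.1 y) + b * (w'.1 x - w'.1 y)| := by ring_nf
    _ ≤ |a * (w.1 x - w.1 y)| + |b * (w'.1 x - w'.1 y)| := abs_add_le _ _
    _ = a * |w.1 x - w.1 y| + b * |w'.1 x - w'.1 y| := by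
      rw [abs_mul, abs_mul, abs_of_nonneg ha, abs_of_nonneg hb]
    _ ≤ a * ((w.2 x + w.2 y) * dist x y) + b * ((w'.2 x + w'.2 y) * dist x y) := by gcongr
    _ = _ := by ring

/-- The Hajłasz inequality passes to limits in `L^p`. -/
theorem exists_isHajlaszGradient_of_tendsto [Fact (1 ≤ p)] {u : ℕ → Lp ℝ p μ} {g : ℕ → Lp ℝ p μ}
    {u₀ g₀ : Lp ℝ p μ} (hu : Tendsto u atTop (𝓝 u₀)) (hg : Tendsto g atTop (𝓝 g₀))
    (h : ∀ k, ∃ E : Set X, μ E = 0 ∧ ∀ x ∉ E, ∀ y ∉ E,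
      |u k x - u k y| ≤ (g k x + g k y) * dist x y) :
    ∃ g', IsHajlaszGradient μ p u₀ g' := by
  obtain ⟨ns, hns, hu'⟩ := (tendstoInMeasure_of_tendsto_Lp hu).exists_seq_tendsto_ae
  obtain ⟨ms, hms, hg'⟩ :=
    (tendstoInMeasure_of_tendsto_Lp (hg.comp hns.tendsto_atTop)).exists_seq_tendsto_ae
  choose E hE hE' using h
  refine ⟨fun x => |g₀ x|, fun x => abs_nonneg _, (Lp.memLp g₀).abs,
    (⋃ k, E k) ∪ {x | Tendsto (fun i => u (ns i) x) atTop (𝓝 (u₀ x)) ∧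
      Tendsto (fun i => g (ns (ms i)) x) atTop (𝓝 (g₀ x))}ᶜ,
    measure_union_null (measure_iUnion_null hE) (hu'.and hg'), fun x hx y hy => ?_⟩
  simp only [mem_union, mem_iUnion, mem_compl_iff, mem_ofPred_eq, not_or, not_not, not_exists]
    at hx hy
  have h1 : Tendsto (fun i => |u (ns (ms i)) x - u (ns (ms i)) y|) atTop (𝓝 |u₀ x - u₀ y|) :=
    ((hx.2.1.comp hms.tendsto_atTop).sub (hy.2.1.comp hms.tendsto_atTop)).abs
  have h2 : Tendsto (fun i => (g (ns (ms i)) x + g (ns (ms i)) y) * dist x y) atTop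
      (𝓝 ((g₀ x + g₀ y) * dist x y)) := (hx.2.2.add hy.2.2).mul_const _
  refine (le_of_tendsto_of_tendsto' h1 h2 fun i => hE' _ x (hx.1 _) y (hy.1 _)).trans ?_
  gcongr <;> exact le_abs_self _

variable [BorelSpace X] [TopologicalSpace.SeparableSpace X] [Nonempty X]

/-- For a bounded sequence in `M^{1,p}`, convex combinations of the functions together with their
gradients converge in `L^p`, so the limit lies in `M^{1,p}`. The difference from the limit is
approximated by Lipschitz functions, and a further passage to convex combinations makes it small. -/
theorem DiffPartition.hajlasz_hasTailLimits (P : DiffPartition μ) (hμ : IsDoublingMeasure μ)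
    [Fact (1 ≤ p)] (hp1 : 1 < p) (hp : p < ∞) : HasTailLimits (HajlaszSobolev μ p) := by
  have hp0 : p ≠ 0 := (one_pos.trans hp1).ne'
  rintro u ⟨K, hK⟩
  choose g hg hgK using fun j => (u j).exists_isHajlaszGradient_of_norm_lt
    (lt_of_le_of_lt (hK j) (lt_add_one K))
  have hK0 : 0 ≤ K := (norm_nonneg _).trans (hK 0)
  set φ : HajlaszSobolev μ p × Lp ℝ p μ →ₗ[ℝ] Lp ℝ p μ × Lp ℝ p μ :=
    LinearMap.prodMap (hajlaszSubmodule μ p).subtype LinearMap.id with hφ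
  obtain ⟨w, hw, ⟨u₀, g₀⟩, hlim⟩ := ((Lp_hasTailLimits (F := ℝ) (μ := μ) hp1 hp).prod
    (Lp_hasTailLimits (F := ℝ) (μ := μ) hp1 hp)).exists_lift φ
      (fun j => (u j, (hg j).memLp.toLp (g j))) ⟨K + 1, fun j => by
        refine max_le ?_ ?_
        · change ‖(u j).1‖ ≤ K + 1
          rw [Lp.norm_def]
          refine ENNReal.toReal_le_of_le_ofReal (by positivity) ((u j).eLpNorm_le.trans ?_)
          exact ENNReal.ofReal_le_ofReal ((hK j).trans (by linarith))
        · change ‖(hg j).memLp.toLp (g j)‖ ≤ K + 1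
          rw [Lp.norm_toLp]
          exact ENNReal.toReal_le_of_le_ofReal (by positivity) (hgK j)⟩
  have hlim1 : Tendsto (fun k => (w k).1.1) atTop (𝓝 u₀) :=
    (continuous_fst.tendsto _).comp hlim
  have hlim2 : Tendsto (fun k => (w k).2) atTop (𝓝 g₀) :=
    (continuous_snd.tendsto _).comp hlim
  have hrel : ∀ k, ∃ E : Set X, μ E = 0 ∧ ∀ x ∉ E, ∀ y ∉ E,
      |(w k).1.1 x - (w k).1.1 y| ≤ ((w k).2 x + (w k).2 y) * dist x y := by
    intro k
    have hconv := (convex_setOf_hajlasz_relation (μ := μ) (p := p)).linear_preimage φ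
    refine tailHull_subset hconv (fun j _ => ?_) (hw k)
    obtain ⟨E, hE, hle⟩ := (hg j).le
    refine ⟨E ∪ {x | (hg j).memLp.toLp (g j) x = g j x}ᶜ,
      measure_union_null hE (hg j).memLp.coeFn_toLp, fun x hx y hy => ?_⟩
    simp only [mem_union, mem_compl_iff, mem_ofPred_eq, not_or, not_not] at hx hy
    change |(u j).1 x - (u j).1 y| ≤
      ((hg j).memLp.toLp (g j) x + (hg j).memLp.toLp (g j) y) * dist x y
    rw [hx.2, hy.2]
    exact hle x hx.1 y hy.1
  obtain ⟨g', hg'⟩ := exists_isHajlaszGradient_of_tendsto hlim1 hlim2 hrel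
  set U : HajlaszSobolev μ p := ⟨u₀, g', hg'⟩ with hU
  set a : ℕ → HajlaszSobolev μ p := fun k => (w k).1 with ha
  have hau : ∀ k, a k ∈ tailHull u k := by
    intro k
    have h1 := mem_image_of_mem (LinearMap.fst ℝ (HajlaszSobolev μ p) (Lp ℝ p μ)) (hw k)
    rwa [image_tailHull] at h1
  have haK : ∀ k, ‖a k‖ ≤ K := fun k => norm_le_of_mem_tailHull (fun j _ => hK j) (hau k)
  set i := lipschitzToHajlasz (X := X) (μ := μ) (p := p) hμ hp0 hp.ne with hi
  have happrox : ∀ k : ℕ, ∃ f, ‖a k - U - i f‖ < 1 / ((k : ℝ) + 1) := by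
    intro k
    obtain ⟨f, hf⟩ := (denseRange_lipschitzToHajlasz hμ hp0 hp.ne).exists_dist_lt (a k - U)
      (by positivity : (0 : ℝ) < 1 / ((k : ℝ) + 1))
    exact ⟨f, by rwa [dist_eq_norm] at hf⟩
  choose h hh using happrox
  have hone : ∀ k : ℕ, 1 / ((k : ℝ) + 1) ≤ 1 := fun k => by
    rw [div_le_one (by positivity)]
    have : (0 : ℝ) ≤ k := Nat.cast_nonneg k
    linarith
  have hhC : ∀ j, ‖i (h j)‖ < K + ‖U‖ + 2 := by
    intro j
    have e : i (h j) = a j - U - (a j - U - i (h j)) := by abel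
    rw [e]
    have h1 := norm_sub_le (a j - U) (a j - U - i (h j))
    have h2 := norm_sub_le (a j) U
    linarith [haK j, hh j, hone j]
  have hC : ∀ j, ∃ G, IsHajlaszBound μ (h j).1 G ∧
      eLpNorm G p μ ≤ ENNReal.ofReal (K + ‖U‖ + 2) := by
    intro j
    obtain ⟨q, hq, hqn⟩ := (i (h j)).exists_isHajlaszGradient_of_norm_lt (hhC j)
    refine ⟨_, (hq.congr (coeFn_lipschitzToHajlasz hμ hp0 hp.ne (h j))).isHajlaszBound, ?_⟩
    rwa [eLpNorm_ofReal hq.nonneg]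
  have h0 : Tendsto (fun j => eLpNorm (h j).1 p μ) atTop (𝓝 0) := by
    have h1 : ∀ j, eLpNorm (h j).1 p μ ≤
        ENNReal.ofReal ‖(w j).1.1 - u₀‖ + ENNReal.ofReal (1 / ((j : ℝ) + 1)) := by
      intro j
      rw [← eLpNorm_congr_ae (coeFn_lipschitzToHajlasz hμ hp0 hp.ne (h j))]
      have h2 : ‖(i (h j)).1‖ ≤ ‖(w j).1.1 - u₀‖ + 1 / ((j : ℝ) + 1) := by
        have e : (i (h j)).1 = ((w j).1.1 - u₀) - (a j - U - i (h j)).1 := by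
          change (i (h j)).1 = ((w j).1.1 - u₀) - ((w j).1.1 - u₀ - (i (h j)).1)
          abel
        rw [e]
        refine (norm_sub_le _ _).trans ?_
        gcongr
        refine le_trans ?_ (hh j).le
        rw [Lp.norm_def]
        exact ENNReal.toReal_le_of_le_ofReal (norm_nonneg _) (HajlaszSobolev.eLpNorm_le _)
      rw [← ENNReal.ofReal_add (norm_nonneg _) (by positivity)]
      refine le_trans (le_of_eq ?_) (ENNReal.ofReal_le_ofReal h2)
      rw [Lp.norm_def, ENNReal.ofReal_toReal (Lp.memLp _).eLpNorm_ne_top]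
    have h3 : Tendsto (fun j : ℕ => ENNReal.ofReal ‖(w j).1.1 - u₀‖ +
        ENNReal.ofReal (1 / ((j : ℝ) + 1))) atTop (𝓝 (0 + 0)) := by
      refine Tendsto.add ?_ ?_
      · have h4 := ENNReal.tendsto_ofReal (hlim1.sub_const u₀).norm
        rwa [sub_self, norm_zero, ENNReal.ofReal_zero] at h4
      · have h4 := ENNReal.tendsto_ofReal tendsto_one_div_add_atTop_nhds_zero_nat
        rwa [ENNReal.ofReal_zero] at h4
    rw [add_zero] at h3
    exact tendsto_of_tendsto_of_tendsto_of_le_of_le tendsto_const_nhds h3 (fun _ => zero_le) h1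
  -- the same convex combinations are applied to `a` and to `h`
  have hfin : ∀ k : ℕ, ∃ y ∈ tailHull u k, ‖y - U‖ ≤ 3 * (1 / ((k : ℝ) + 1)) := by
    intro k
    have hk : (0 : ℝ) < 1 / ((k : ℝ) + 1) := by positivity
    obtain ⟨H, hH, hHn, G, hG, hGn⟩ := P.exists_mem_tailHull_small hμ hp1 hp h0 hC
      (ENNReal.ofReal_pos.2 hk) k
    have hHi : ‖i H‖ ≤ 1 / ((k : ℝ) + 1) + 1 / ((k : ℝ) + 1) :=
      HajlaszSobolev.norm_le hp.ne _ (coeFn_lipschitzToHajlasz hμ hp0 hp.ne H) hG hk.le hk.le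
        hHn hGn
    have hpair : ∃ Q ∈ tailHull (fun j => (a j, h j)) k, Q.2 = H := by
      have h1 := image_tailHull (LinearMap.snd ℝ (HajlaszSobolev μ p) (boundedSupportLipschitz X))
        (fun j => (a j, h j)) k
      have h2 : H ∈ LinearMap.snd ℝ (HajlaszSobolev μ p) (boundedSupportLipschitz X) ''
          tailHull (fun j => (a j, h j)) k := by
        rw [h1]
        exact hH
      exact h2
    obtain ⟨Q, hQ, rfl⟩ := hpair
    have hQa : Q.1 ∈ tailHull a k := by
      have h1 := mem_image_of_mem
        (LinearMap.fst ℝ (HajlaszSobolev μ p) (boundedSupportLipschitz X)) hQ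
      rwa [image_tailHull] at h1
    have hQn : ‖Q.1 - U - i Q.2‖ ≤ 1 / ((k : ℝ) + 1) := by
      set ψ : HajlaszSobolev μ p × boundedSupportLipschitz X →ₗ[ℝ] HajlaszSobolev μ p :=
        LinearMap.fst ℝ _ _ - i ∘ₗ LinearMap.snd ℝ _ _ with hψ
      have hconv := (convex_closedBall U (1 / ((k : ℝ) + 1))).linear_preimage ψ
      have hmem : Q ∈ ψ ⁻¹' Metric.closedBall U (1 / ((k : ℝ) + 1)) := by
        refine tailHull_subset hconv (fun j hj => ?_) hQ
        rw [mem_preimage, mem_closedBall_iff_norm]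
        change ‖a j - i (h j) - U‖ ≤ _
        rw [sub_right_comm]
        refine (hh j).le.trans ?_
        gcongr
      rw [mem_preimage, mem_closedBall_iff_norm] at hmem
      change ‖Q.1 - i Q.2 - U‖ ≤ _ at hmem
      rwa [sub_right_comm] at hmem
    refine ⟨Q.1, tailHull_trans hau k hQa, ?_⟩
    have h1 := norm_add_le (Q.1 - U - i Q.2) (i Q.2)
    rw [sub_add_cancel] at h1
    linarith
  choose y hy hyn using hfin
  refine ⟨y, hy, U, ?_⟩
  rw [tendsto_iff_norm_sub_tendsto_zero]
  have h1 : Tendsto (fun k : ℕ => 3 * (1 / ((k : ℝ) + 1))) atTop (𝓝 (3 * 0)) :=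
    tendsto_one_div_add_atTop_nhds_zero_nat.const_mul 3
  rw [mul_zero] at h1
  exact tendsto_of_tendsto_of_tendsto_of_le_of_le tendsto_const_nhds h1
    (fun _ => norm_nonneg _) hyn

end HajlaszTailLimits

theorem mainTheorem7 {X : Type*} [MetricSpace X] [TopologicalSpace.SeparableSpace X]
    [MeasurableSpace X] [BorelSpace X] (μ : Measure X) (hμ : IsDoublingMeasure μ)
    {ι : Type*} [Countable ι] (A : DiffAtlas μ ι) (hA : A.IsNondegenerate)
    (p : ℝ≥0∞) [Fact (1 ≤ p)] (hp1 : 1 < p) (hp : p < ∞) :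
    IsReflexiveBanach (A.Sobolev p) ∧ IsReflexiveBanach (HajlaszSobolev μ p) := by
  obtain ⟨m, -⟩ := hA
  have : Nonempty ι := ⟨m⟩
  have : Nonempty X := (nonempty_of_measure_ne_zero (A.isDiffChart m).measure_pos.ne').to_type
  obtain ⟨P⟩ := A.nonempty_diffPartition
  exact ⟨(A.sobolev_hasTailLimits hp1 hp).isReflexiveBanach,
    (P.hajlasz_hasTailLimits hμ hp1 hp).isReflexiveBanach⟩
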